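/- Let $k$ be an algebraically closed field and $\Lambda=kQ/I$ a gentle algebra: $Q$ is a finite quiver and $I$ an admissible ideal generated by paths of length two, such that at most two arrows start and at most two arrows end at each vertex, and for each arrow $a$ there is at most one arrow $b$ with $s(b)=e(a)$, $ba\notin I$, at most one arrow $b$ with $s(b)=e(a)$, $ba\in I$, at most one arrow $c$ with $e(c)=s(a)$, $ac\notin I$, and at most one arrow $c$ with $e(c)=s(a)$, $ac\in I$. Paths are read from right to left. A path $p$ gives a map $P(e(p))\to P(s(p))$ of projective left modules, $u\mapsto up$. A *homotopy letter* is a nontrivial path $p$ in $(Q,I)$ (direct) or the inverse $\bar p$ of one (inverse). A *closed homotopy word* is a nonempty sequence $w=w_n\cdots w_1$ of homotopy letters which, read cyclically, is a walk without subwalks $a\bar a$, $\bar a a$ ($a$ an arrow), whose homotopy letters are exactly $w_n,\dots,w_1$ (two cyclically consecutive letters of the same direction meet in a relation of $I$), with as many direct as inverse letters. It is a *homotopy band* if it is moreover not a proper power $v^m$, $m>1$. For $\nu\in k^*$ the complex $B^\bullet_{w,\nu}$ has one summand $P(x)$ for each vertex $x$ between consecutive letters; its differential has one component for each letter, given by the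 underlying path, from left to right for a direct and from right to left for an inverse letter, where the component of one chosen direct letter is multiplied by $\nu$. It is graded up to the choice of the degree of one summand. For a homotopy band this is the one-dimensional band complex. Let $\sigma=\beta\sigma_L\rho\sigma_R\alpha$ and $\tau=\delta\tau_L\rho\tau_R\gamma$ be homotopy bands, where $\sigma_L,\sigma_R,\tau_L,\tau_R$ are homotopy letters and $\alpha,\beta,\gamma,\delta,\rho$ are (possibly trivial) sequences of homotopy letters, let $\lambda,\mu\in k^*$, and suppose that both occurrences of $\rho$ run through the same vertices of $Q$ and lie in the same cohomological degrees of $B^\bullet_{\sigma,\lambda}$ and $B^\bullet_{\tau,\mu}$. Let $f^\bullet\colon B^\bullet_{\sigma,\lambda}\to B^\bullet_{\tau,\mu}$ be a graph map with overlap $\rho$. That is, one of the following holds at the right end of $\rho$, for nontrivial paths: (RG1) $\sigma_R=p$ and $\tau_R=p f_R$; (RG2) $\sigma_R=\bar p\bar f_R$ and $\tau_R=\bar p$; (RG3) $\sigma_R$ is direct, $\tau_R$ is inverse (and there is no $f_R$); one of the following holds at the left end: (LG1) $\sigma_L=f_Lp$ and $\tau_L=p$; (LG2) $\sigma_L=\bar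 p$ and $\tau_L=\bar f_L\bar p$; (LG3) $\sigma_L$ is inverse, $\tau_L$ is direct (and there is no $f_L$); and the components of $f^\bullet$ are the identities at the vertices of $\rho$ and the maps $f_L$, $f_R$, where they exist, between the outer ends of $\sigma_L,\tau_L$ and of $\sigma_R,\tau_R$, each up to a nonzero scalar such that all squares of the unfolded diagram commute. (Such an $f^\bullet$ is not an identity map.) Suppose that $f^\bullet$ is compatibly oriented: if $\rho$ is trivial and (RG3) and (LG3) hold, then the composites of the paths underlying $\tau_L$ and $\sigma_L$, and of those underlying $\tau_R$ and $\sigma_R$, through the common vertex are nonzero in $\Lambda$. Then $c=\beta\sigma_L\bar\tau_L\bar\delta\bar\gamma\bar\tau_R\sigma_R\alpha$, in which each of $\sigma_L\bar\tau_L$ and $\bar\tau_R\sigma_R$ becomes a single homotopy letter after cancellation, is a closed homotopy word (hence a homotopy band, unless it is a proper power), and in the homotopy category of complexes of $\Lambda$-modules $$M^\bullet_{f^\bullet}\;\cong\;\begin{cases}B^\bullet_{c,\lambda\mu^{-1}}&\text{if the number of homotopy letters of }\rho\text{ is even,}\\ B^\bullet_{c,-\lambda\mu^{-1}}&\text{if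 it is odd,}\end{cases}$$ where the scalar may be placed on any direct homotopy letter of $c$, and where $B^\bullet_{c,\pm\lambda\mu^{-1}}$ is graded so that the left end of $\beta\sigma_L$, which is also the right end of $\sigma_R\alpha$, has degree one less than in $B^\bullet_{\sigma,\lambda}$. -/

import Mathlib

open CategoryTheory

universe u v w

namespace Gentle

/-- A quiver with vertex set `V` and arrow set `E`, together with a set of paths of length two:
`rel b a` says that the path `b a` (first `a`, then `b`) is one of them. Paths are read from right
to left. -/
structure BoundQuiver (V : Type v) (E : Type w) where
  src : E → V
  tgt : E → V
  rel : E → E → Prop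
  src_eq_tgt_of_rel : ∀ {b a : E}, rel b a → src b = tgt a

section Words

variable {V : Type v} {E : Type w}

namespace BoundQuiver

variable (Q : BoundQuiver V E)

/-- `[aₙ, …, a₁]` is a nontrivial path `aₙ ⋯ a₁` in `(Q, I)`: consecutive arrows compose and no two
consecutive arrows form a relation. -/
def IsPath (p : List E) : Prop :=
  p ≠ [] ∧ p.IsChain (fun b a => Q.src b = Q.tgt a ∧ ¬ Q.rel b a)

/-- `(Q, I)` is gentle, where `I` is the ideal generated by the paths `b a` with `rel b a`. -/
structure IsGentle : Prop where
  card_src_le : ∀ x : V, {a : E | Q.src a = x}.encard ≤ 2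
  card_tgt_le : ∀ x : V, {a : E | Q.tgt a = x}.encard ≤ 2
  left_unique : ∀ a b b' : E, Q.src b = Q.tgt a → ¬ Q.rel b a →
    Q.src b' = Q.tgt a → ¬ Q.rel b' a → b = b'
  right_unique : ∀ a c c' : E, Q.src a = Q.tgt c → ¬ Q.rel a c →
    Q.src a = Q.tgt c' → ¬ Q.rel a c' → c = c'
  left_rel_unique : ∀ a b b' : E, Q.rel b a → Q.rel b' a → b = b'
  right_rel_unique : ∀ a c c' : E, Q.rel a c → Q.rel a c' → c = c'
  /-- `I` is admissible: it contains all sufficiently long paths. -/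
  admissible : ∃ N : ℕ, ∀ p : List E, Q.IsPath p → p.length ≤ N

/-- The end of a signed arrow on the left when a walk is written from left to right: `(a, true)` is
the arrow `a`, running from its source (on the right) to its target (on the left), and `(a, false)`
is the formal inverse of `a`. -/
def lend (x : E × Bool) : V := if x.2 then Q.tgt x.1 else Q.src x.1

/-- The end of a signed arrow on the right. -/
def rend (x : E × Bool) : V := if x.2 then Q.src x.1 else Q.tgt x.1

end BoundQuiver

/-- A path, as a walk. -/
def dirWalk (p : List E) : List (E × Bool) := p.map (fun a => (a, true))

/-- The inverse of a path, as a walk. -/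
def invWalk (p : List E) : List (E × Bool) := FreeGroup.invRev (dirWalk p)

/-- A homotopy letter is direct if it consists of arrows (and not of inverse arrows). -/
def isDirect (l : List (E × Bool)) : Bool := l.all (fun x => x.2)

/-- The path `p` underlying a homotopy letter `p` or `p⁻¹`. -/
def pathOf (l : List (E × Bool)) : List E :=
  if isDirect l then l.map Prod.fst else (l.map Prod.fst).reverse

/-- The change of cohomological degree from the left to the right end of a homotopy letter. -/
def sgn (l : List (E × Bool)) : ℤ := if isDirect l then 1 else -1

/-- The inverse of a sequence of homotopy letters. -/
def invWord (L : List (List (E × Bool))) : List (List (E × Bool)) :=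
  (L.map FreeGroup.invRev).reverse

namespace BoundQuiver

variable (Q : BoundQuiver V E)

/-- A nontrivial path in `(Q, I)` or the inverse of one. -/
def IsLetter (l : List (E × Bool)) : Prop :=
  ∃ p : List E, Q.IsPath p ∧ (l = dirWalk p ∨ l = invWalk p)

/-- The signed arrows `x`, `y` may stand on the two sides of the border `x | y` between two
consecutive homotopy letters of a walk. -/
def Border (x y : E × Bool) : Prop :=
  Q.rend x = Q.lend y ∧
    ((x.2 = true ∧ y.2 = true ∧ Q.rel x.1 y.1) ∨
     (x.2 = false ∧ y.2 = false ∧ Q.rel y.1 x.1) ∨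
     (x.2 ≠ y.2 ∧ x.1 ≠ y.1))

end BoundQuiver

/-- The cyclic successor. -/
def next {n : ℕ} (i : Fin n) : Fin n :=
  ⟨(i.1 + 1) % n, Nat.mod_lt _ (lt_of_le_of_lt (Nat.zero_le _) i.2)⟩

/-- A closed homotopy word: a nonempty sequence of homotopy letters which, read cyclically, is a
closed walk with exactly these homotopy letters, with as many direct as inverse letters. -/
structure ClosedWord (Q : BoundQuiver V E) where
  letters : List (List (E × Bool))
  ne_nil : letters ≠ []
  isLetter : ∀ l ∈ letters, Q.IsLetter l
  border : ∀ i : Fin letters.length,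
    ∀ x ∈ (letters.get i).getLast?, ∀ y ∈ (letters.get (next i)).head?, Q.Border x y
  balanced : letters.countP (fun l => isDirect l) = letters.countP (fun l => !isDirect l)

/-- A homotopy band: a closed homotopy word which is not a proper power. -/
structure HomotopyBand (Q : BoundQuiver V E) extends ClosedWord Q where
  primitive : ∀ (t : List (List (E × Bool))) (n : ℕ), 1 < n →
    letters ≠ (List.replicate n t).flatten

lemma dirWalk_ne_nil {p : List E} (h : p ≠ []) : dirWalk p ≠ [] := by
  simpa [dirWalk] using h

lemma invWalk_eq (p : List E) : invWalk p = p.reverse.map (fun a => (a, false)) := by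
  simp [invWalk, dirWalk, FreeGroup.invRev, List.map_reverse]

lemma BoundQuiver.IsLetter.ne_nil {Q : BoundQuiver V E} {l : List (E × Bool)}
    (h : Q.IsLetter l) : l ≠ [] := by
  obtain ⟨p, hp, rfl | rfl⟩ := h
  · exact dirWalk_ne_nil hp.1
  · simpa [invWalk_eq] using hp.1

namespace ClosedWord

variable {Q : BoundQuiver V E} (s : ClosedWord Q)

/-- The index set of the letters, and of the vertices of the unfolded diagram: the vertex `i` is
the left end of the letter `i`, and the vertex `next i` is its right end. -/
abbrev Idx : Type := Fin s.letters.length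

/-- The vertex of the quiver at a vertex of the unfolded diagram. -/
def vert (i : s.Idx) : V :=
  Q.lend ((s.letters.get i).head (s.isLetter _ (List.get_mem _ _)).ne_nil)

/-- The cohomological degree of the vertex `i`, when the vertex `0` has degree `d`. -/
def deg (d : ℤ) (i : ℕ) : ℤ := d + ((s.letters.take i).map sgn).sum

end ClosedWord

/-- The endpoint conditions at the right end of an overlap, for the letters `σR`, `τR` that follow
the overlap; `fR` is the path in the square, where `fR = []` means that there is no such path. -/
inductive RightEnd : List (E × Bool) → List (E × Bool) → List E → Prop
  | rg1 (p fR : List E) (hp : p ≠ []) (hf : fR ≠ []) :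
      RightEnd (dirWalk p) (dirWalk (p ++ fR)) fR
  | rg2 (p fR : List E) (hp : p ≠ []) (hf : fR ≠ []) :
      RightEnd (invWalk (fR ++ p)) (invWalk p) fR
  | rg3 (p q : List E) (hp : p ≠ []) (hq : q ≠ []) :
      RightEnd (dirWalk p) (invWalk q) []

/-- The endpoint conditions at the left end of an overlap, for the letters `σL`, `τL` that precede
the overlap. -/
inductive LeftEnd : List (E × Bool) → List (E × Bool) → List E → Prop
  | lg1 (p fL : List E) (hp : p ≠ []) (hf : fL ≠ []) :
      LeftEnd (dirWalk (fL ++ p)) (dirWalk p) fL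
  | lg2 (p fL : List E) (hp : p ≠ []) (hf : fL ≠ []) :
      LeftEnd (invWalk p) (invWalk (p ++ fL)) fL
  | lg3 (p q : List E) (hp : p ≠ []) (hq : q ≠ []) :
      LeftEnd (invWalk p) (dirWalk q) []

/-- The combinatorial data of a graph map between band complexes: a decomposition
`σ = β σL ρ σR α`, `τ = δ τL ρ τR γ` into homotopy letters `σL, σR, τL, τR` and homotopy substrings
`β, α, δ, γ, ρ` such that the endpoint conditions hold. -/
structure Overlap {Q : BoundQuiver V E} (s t : ClosedWord Q) where
  β : List (List (E × Bool))
  σL : List (E × Bool)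
  ρ : List (List (E × Bool))
  σR : List (E × Bool)
  α : List (List (E × Bool))
  δ : List (List (E × Bool))
  τL : List (E × Bool)
  τR : List (E × Bool)
  γ : List (List (E × Bool))
  fL : List E
  fR : List E
  word_left : s.letters = β ++ [σL] ++ ρ ++ [σR] ++ α
  word_right : t.letters = δ ++ [τL] ++ ρ ++ [τR] ++ γ
  leftEnd : LeftEnd σL τL fL
  rightEnd : RightEnd σR τR fR
  /-- The two occurrences of `ρ` run through the same vertices of the quiver. (This matters only if
  `ρ` is trivial, that is, a single vertex.) -/
  vertex : ∀ x ∈ σR.head?, ∀ y ∈ τR.head?, Q.lend x = Q.lend y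

/-- The overlap is compatibly oriented. This is a condition only if `ρ` is trivial and the third
endpoint condition holds at both ends. -/
def Overlap.Compatible {Q : BoundQuiver V E} {s t : ClosedWord Q} (O : Overlap s t) : Prop :=
  O.ρ = [] → O.fL = [] → O.fR = [] →
    Q.IsPath (pathOf O.τL ++ pathOf O.σL) ∧ Q.IsPath (pathOf O.τR ++ pathOf O.σR)

/-- The sequence of homotopy letters of `β σL τL⁻¹ δ⁻¹ γ⁻¹ τR⁻¹ σR α`, where `σL τL⁻¹` and
`τR⁻¹ σR` are single homotopy letters after cancellation. -/
def Overlap.coneLetters [DecidableEq E] {Q : BoundQuiver V E} {s t : ClosedWord Q}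
    (O : Overlap s t) : List (List (E × Bool)) :=
  O.β ++ [FreeGroup.reduce (O.σL ++ FreeGroup.invRev O.τL)] ++ invWord O.δ ++ invWord O.γ ++
    [FreeGroup.reduce (FreeGroup.invRev O.τR ++ O.σR)] ++ O.α

lemma next_injective {n : ℕ} : Function.Injective (next (n := n)) := by
  intro i j h
  have hi := i.2
  have hj := j.2
  have h' : (i.1 + 1) % n = (j.1 + 1) % n := congrArg Fin.val h
  apply Fin.ext
  have : i.1 % n = j.1 % n := Nat.ModEq.add_right_cancel' 1 h'
  rwa [Nat.mod_eq_of_lt hi, Nat.mod_eq_of_lt hj] at this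

lemma letter_direct {l : List (E × Bool)} (hd : isDirect l = true) :
    l = dirWalk (pathOf l) := by
  have h2 : ∀ x ∈ l, x.2 = true := by simpa [isDirect] using hd
  simp only [pathOf, hd, if_true, dirWalk, List.map_map]
  conv_lhs => rw [← List.map_id l]
  apply List.map_congr_left
  intro x hx
  exact Prod.ext rfl (h2 x hx)

lemma letter_inverse {Q : BoundQuiver V E} {l : List (E × Bool)} (hl : Q.IsLetter l) (hd : isDirect l = false) :
    l = invWalk (pathOf l) := by
  obtain ⟨p, hp, rfl | rfl⟩ := hl
  · simp [isDirect, dirWalk] at hd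
  · congr 1
    rw [pathOf, if_neg (by simp [hd]), invWalk_eq]
    simp [Function.comp_def]

lemma vert_eq {Q : BoundQuiver V E} (s : ClosedWord Q) (i : s.Idx) {x : E × Bool}
    (hx : (s.letters.get i).head? = some x) : s.vert i = Q.lend x := by
  unfold ClosedWord.vert
  congr 1
  exact List.head_of_head?_eq_some hx

end Words

section Algebra

variable (k : Type u) [Field k] {V : Type v} {E : Type w} [Fintype V]

/-- The defining relations of `kQ/I` on the trivial paths and the arrows. -/
inductive AlgRel (Q : BoundQuiver V E) :
    FreeAlgebra k (V ⊕ E) → FreeAlgebra k (V ⊕ E) → Prop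
  | idem (x : V) : AlgRel Q
      (FreeAlgebra.ι k (Sum.inl x) * FreeAlgebra.ι k (Sum.inl x)) (FreeAlgebra.ι k (Sum.inl x))
  | orth (x y : V) (h : x ≠ y) : AlgRel Q
      (FreeAlgebra.ι k (Sum.inl x) * FreeAlgebra.ι k (Sum.inl y)) 0
  | one : AlgRel Q (∑ x : V, FreeAlgebra.ι k (Sum.inl x)) 1
  | tgt (a : E) : AlgRel Q
      (FreeAlgebra.ι k (Sum.inl (Q.tgt a)) * FreeAlgebra.ι k (Sum.inr a))
      (FreeAlgebra.ι k (Sum.inr a))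
  | src (a : E) : AlgRel Q
      (FreeAlgebra.ι k (Sum.inr a) * FreeAlgebra.ι k (Sum.inl (Q.src a)))
      (FreeAlgebra.ι k (Sum.inr a))
  | rel (b a : E) (h : Q.rel b a) : AlgRel Q
      (FreeAlgebra.ι k (Sum.inr b) * FreeAlgebra.ι k (Sum.inr a)) 0

/-- The algebra `kQ/I`. -/
def BQAlg (Q : BoundQuiver V E) : Type (max u v w) := RingQuot (AlgRel k Q)

noncomputable instance (Q : BoundQuiver V E) : Ring (BQAlg k Q) :=
  inferInstanceAs (Ring (RingQuot (AlgRel k Q)))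

noncomputable instance (Q : BoundQuiver V E) : Algebra k (BQAlg k Q) :=
  inferInstanceAs (Algebra k (RingQuot (AlgRel k Q)))

noncomputable section

variable (Q : BoundQuiver V E)

/-- The trivial path at `x`. -/
def idem (x : V) : BQAlg k Q :=
  RingQuot.mkAlgHom k (AlgRel k Q) (FreeAlgebra.ι k (Sum.inl x))

/-- An arrow as an element of the algebra. -/
def arr (a : E) : BQAlg k Q :=
  RingQuot.mkAlgHom k (AlgRel k Q) (FreeAlgebra.ι k (Sum.inr a))

/-- A path as an element of the algebra. -/
def pathVal (p : List E) : BQAlg k Q := (p.map (arr k Q)).prod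

lemma idem_mul_arr (a : E) : idem k Q (Q.tgt a) * arr k Q a = arr k Q a := by
  have h := RingQuot.mkAlgHom_rel k (AlgRel.tgt (k := k) (Q := Q) a)
  rw [map_mul] at h
  exact h

lemma arr_mul_idem (a : E) : arr k Q a * idem k Q (Q.src a) = arr k Q a := by
  have h := RingQuot.mkAlgHom_rel k (AlgRel.src (k := k) (Q := Q) a)
  rw [map_mul] at h
  exact h

lemma arr_mul_arr {b a : E} (hr : Q.rel b a) : arr k Q b * arr k Q a = 0 := by
  have h := RingQuot.mkAlgHom_rel k (AlgRel.rel (k := k) (Q := Q) b a hr)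
  rw [map_mul, map_zero] at h
  exact h

/-- The indecomposable projective left module `P(x) = Λ eₓ`. -/
def proj (x : V) : Submodule (BQAlg k Q) (BQAlg k Q) := Submodule.span _ {idem k Q x}

/-- The homomorphism `P(x) → P(y)` given by right multiplication by (the component in `eₓ Λ e_y`
of) `r`. -/
def rmul (x y : V) (r : BQAlg k Q) : proj k Q x →ₗ[BQAlg k Q] proj k Q y :=
  LinearMap.codRestrict (proj k Q y)
    ((LinearMap.toSpanSingleton (BQAlg k Q) (BQAlg k Q) (r * idem k Q y)).comp
      (proj k Q x).subtype)
    (fun u => by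
      simp only [LinearMap.comp_apply, LinearMap.toSpanSingleton_apply, smul_eq_mul, ← mul_assoc]
      exact Submodule.smul_mem _ _ (Submodule.mem_span_singleton_self _))

/-- The direct sum of the modules `P(v p)` over all `p` of degree `n`. -/
abbrev gradedPiece {ι : Type} [Fintype ι] (v : ι → V) (deg : ι → ℤ) (n : ℤ) :
    ModuleCat.{max u v w} (BQAlg k Q) :=
  ModuleCat.of (BQAlg k Q) ((p : {p : ι // deg p = n}) → proj k Q (v p.1))

/-- The homomorphism given by a matrix with entries in `Λ`, with `F p q` describing the component
from the summand `p` to the summand `q`. -/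
def matLin {ι ι' : Type} [Fintype ι] (v : ι → V) (deg : ι → ℤ)
    (v' : ι' → V) (deg' : ι' → ℤ) (F : ι → ι' → BQAlg k Q) (i j : ℤ) :
    ((p : {p : ι // deg p = i}) → proj k Q (v p.1)) →ₗ[BQAlg k Q]
      ((q : {q : ι' // deg' q = j}) → proj k Q (v' q.1)) :=
  LinearMap.pi fun q => ∑ p : {p : ι // deg p = i},
    (rmul k Q (v p.1) (v' q.1) (F p.1 q.1)).comp
      (LinearMap.proj (φ := fun p : {p : ι // deg p = i} => proj k Q (v p.1)) p)

/-- The same homomorphism, between the graded pieces. -/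
def matMap {ι ι' : Type} [Fintype ι] [Fintype ι'] (v : ι → V) (deg : ι → ℤ)
    (v' : ι' → V) (deg' : ι' → ℤ) (F : ι → ι' → BQAlg k Q) (i j : ℤ) :
    gradedPiece k Q v deg i ⟶ gradedPiece k Q v' deg' j :=
  ModuleCat.ofHom (matLin k Q v deg v' deg' F i j)

lemma matLin_apply {ι ι' : Type} [Fintype ι] (v : ι → V) (deg : ι → ℤ)
    (v' : ι' → V) (deg' : ι' → ℤ) (F : ι → ι' → BQAlg k Q) (i j : ℤ)
    (x : (p : {p : ι // deg p = i}) → proj k Q (v p.1)) (q : {q : ι' // deg' q = j}) :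
    (matLin k Q v deg v' deg' F i j x q : BQAlg k Q) =
      ∑ p : {p : ι // deg p = i}, (x p : BQAlg k Q) * (F p.1 q.1 * idem k Q (v' q.1)) := by
  simp [matLin, rmul]

variable {Q}

/-- The scalar on the letter `i` when the scalar `lam` is placed on the letter `j`. -/
def weight {k : Type u} [Field k] (lam : kˣ) (j i : ℕ) : kˣ := if i = j then lam else 1

/-- The differential of the complex of a closed word as a matrix: a direct letter `i` gives a
component from the vertex `i` to the vertex `next i`, an inverse letter `i` gives a component from
the vertex `next i` to the vertex `i`. The scalar `lam` is placed on the letter `j`. -/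
def diffMatrix (s : ClosedWord Q) (lam : kˣ) (j : ℕ) (p q : s.Idx) : BQAlg k Q :=
  (if isDirect (s.letters.get p) = true ∧ q = next p then
    ((weight lam j p : kˣ) : k) • pathVal k Q (pathOf (s.letters.get p)) else 0) +
  (if isDirect (s.letters.get q) = false ∧ p = next q then
    ((weight lam j q : kˣ) : k) • pathVal k Q (pathOf (s.letters.get q)) else 0)

lemma pathVal_mul_eq_zero {p q : List E} {x y : E} (hx : p.getLast? = some x)
    (hy : q.head? = some y) (hr : Q.rel x y) :
    pathVal k Q p * idem k Q (Q.tgt y) * pathVal k Q q = 0 := by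
  obtain ⟨p', rfl⟩ := List.getLast?_eq_some_iff.1 hx
  obtain ⟨q', rfl⟩ := List.head?_eq_some_iff.1 hy
  simp only [pathVal, List.map_append, List.map_cons, List.map_nil, List.prod_append,
    List.prod_cons, List.prod_nil, mul_one]
  calc _ = (List.map (arr k Q) p').prod *
        (arr k Q x * (idem k Q (Q.tgt y) * arr k Q y)) * (List.map (arr k Q) q').prod := by
          simp only [mul_assoc]
    _ = 0 := by rw [idem_mul_arr, arr_mul_arr k Q hr]; simp

lemma diffMatrix_sq (s : ClosedWord Q) (lam : kˣ) (j : ℕ) (p q r : s.Idx) :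
    diffMatrix k s lam j p q * idem k Q (s.vert q) * diffMatrix k s lam j q r = 0 := by
  have key1 : isDirect (s.letters.get p) = true → q = next p →
      isDirect (s.letters.get q) = true →
      pathVal k Q (pathOf (s.letters.get p)) * idem k Q (s.vert q) *
        pathVal k Q (pathOf (s.letters.get q)) = 0 := by
    rintro h1 rfl h2
    have hp := s.isLetter _ (List.get_mem s.letters p)
    have hq := s.isLetter _ (List.get_mem s.letters (next p))
    obtain ⟨x, hx⟩ := Option.isSome_iff_exists.1 (List.getLast?_isSome.2 hp.ne_nil)
    obtain ⟨y, hy⟩ := Option.isSome_iff_exists.1 (List.isSome_head?.2 hq.ne_nil)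
    have hb := s.border p x hx y hy
    rw [vert_eq s _ hy]
    rw [letter_direct h1] at hx
    rw [letter_direct h2] at hy
    simp only [dirWalk, List.getLast?_map, List.head?_map, Option.map_eq_some_iff] at hx hy
    obtain ⟨a, ha, rfl⟩ := hx
    obtain ⟨b, hb', rfl⟩ := hy
    have hrel : Q.rel a b := by simpa [BoundQuiver.Border] using hb.2
    exact pathVal_mul_eq_zero k ha hb' hrel
  have key2 : isDirect (s.letters.get q) = false → q = next r →
      isDirect (s.letters.get r) = false →
      pathVal k Q (pathOf (s.letters.get q)) * idem k Q (s.vert q) *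
        pathVal k Q (pathOf (s.letters.get r)) = 0 := by
    rintro h1 rfl h2
    have hp := s.isLetter _ (List.get_mem s.letters r)
    have hq := s.isLetter _ (List.get_mem s.letters (next r))
    obtain ⟨x, hx⟩ := Option.isSome_iff_exists.1 (List.getLast?_isSome.2 hp.ne_nil)
    obtain ⟨y, hy⟩ := Option.isSome_iff_exists.1 (List.isSome_head?.2 hq.ne_nil)
    have hb := s.border r x hx y hy
    rw [vert_eq s _ hy]
    rw [letter_inverse hp h2] at hx
    rw [letter_inverse hq h1] at hy
    simp only [invWalk_eq, List.getLast?_map, List.head?_map, Option.map_eq_some_iff,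
      List.getLast?_reverse, List.head?_reverse] at hx hy
    obtain ⟨a, ha, rfl⟩ := hx
    obtain ⟨b, hb', rfl⟩ := hy
    have hrel : Q.rel b a := by simpa [BoundQuiver.Border] using hb.2
    have h3 : Q.lend (b, false) = Q.tgt a := by
      simpa [BoundQuiver.lend] using Q.src_eq_tgt_of_rel hrel
    rw [h3]
    exact pathVal_mul_eq_zero k hb' ha hrel
  unfold diffMatrix
  by_cases hq : isDirect (s.letters.get q) = true
  · by_cases hr : isDirect (s.letters.get r) = false ∧ q = next r
    · have h0 : ¬ (isDirect (s.letters.get p) = true ∧ q = next p) := by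
        rintro ⟨h1, h2⟩
        have := next_injective (h2.symm.trans hr.2)
        subst this
        simp [h1, -List.get_eq_getElem] at hr
      rw [if_neg h0, if_neg (by simp [hq, -List.get_eq_getElem])]
      simp
    · rw [if_neg hr, if_neg (by simp [hq, -List.get_eq_getElem] : ¬ (isDirect (s.letters.get q) = false ∧ p = next q))]
      split_ifs with h1 h2
      · simp [key1 h1.1 h1.2 hq, -List.get_eq_getElem]
      all_goals simp
  · have hq' : isDirect (s.letters.get q) = false := by simpa using hq
    rw [if_neg (by simp [hq', -List.get_eq_getElem] : ¬ (isDirect (s.letters.get q) = true ∧ r = next q))]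
    by_cases h1 : isDirect (s.letters.get p) = true ∧ q = next p
    · have h0 : ¬ (isDirect (s.letters.get r) = false ∧ q = next r) := by
        rintro ⟨h3, h2⟩
        have := next_injective (h2.symm.trans h1.2)
        subst this
        simp [h1, -List.get_eq_getElem] at h3
      rw [if_neg h0]
      simp
    · rw [if_neg h1]
      split_ifs with h2 h3
      · simp [key2 hq' h3.2 h3.1, -List.get_eq_getElem]
      all_goals simp

/-- The complex of a closed word with the vertex `0` in degree `d` and with the scalar `lam` on the
letter `j`. For a homotopy band and a direct letter `j` it is the one-dimensional band complex. -/
def bandComplex (s : ClosedWord Q) (d : ℤ) (lam : kˣ) (j : s.Idx) :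
    CochainComplex (ModuleCat.{max u v w} (BQAlg k Q)) ℤ where
  X n := gradedPiece k Q s.vert (fun i => s.deg d i) n
  d m n := if m + 1 = n then
      matMap k Q s.vert (fun i => s.deg d i) s.vert (fun i => s.deg d i)
        (diffMatrix k s lam j) m n
    else 0
  shape m n h := if_neg h
  d_comp_d' m n l h1 h2 := by
    have h1' : m + 1 = n := h1
    have h2' : n + 1 = l := h2
    rw [if_pos h1', if_pos h2']
    apply ModuleCat.hom_ext
    apply LinearMap.ext
    intro x
    apply funext
    intro r
    apply Subtype.ext
    change (matLin k Q s.vert _ s.vert _ _ n l (matLin k Q s.vert _ s.vert _ _ m n x) r :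
      BQAlg k Q) = 0
    rw [matLin_apply]
    apply Finset.sum_eq_zero
    intro q _
    rw [matLin_apply, Finset.sum_mul]
    apply Finset.sum_eq_zero
    intro p _
    have h := diffMatrix_sq k s lam j p.1 q.1 r.1
    calc _ = (x p : BQAlg k Q) * (diffMatrix k s lam j p.1 q.1 * idem k Q (s.vert q.1) *
          diffMatrix k s lam j q.1 r.1) * idem k Q (s.vert r.1) := by simp only [mul_assoc]
      _ = 0 := by rw [h]; simp

/-- The value of the path `f` in a square at the end of an overlap, or `0` if there is none. -/
def endVal (f : List E) : BQAlg k Q := if f = [] then 0 else pathVal k Q f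

/-- The matrix of a map of complexes with components `c i` (a multiple of the identity) at the
vertices of the overlap, and `aL fL` and `aR fR` next to its ends. -/
def graphMatrix {s t : ClosedWord Q} (O : Overlap s t) (c : ℕ → kˣ) (aL aR : kˣ)
    (p : s.Idx) (q : t.Idx) : BQAlg k Q :=
  (∑ i ∈ Finset.range (O.ρ.length + 1),
    if p.1 = O.β.length + 1 + i ∧ q.1 = O.δ.length + 1 + i then
      algebraMap k (BQAlg k Q) (c i) else 0) +
  (if p.1 = O.β.length ∧ q.1 = O.δ.length then (aL : k) • endVal k O.fL else 0) +
  (if p.1 = (O.β.length + O.ρ.length + 2) % s.letters.length ∧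
      q.1 = (O.δ.length + O.ρ.length + 2) % t.letters.length then
    (aR : k) • endVal k O.fR else 0)

variable {k}

/-- The squares of the unfolded diagram of a graph map commute, where the scalars `lam` and `mu` are
placed on the letters `js` and `jt`. -/
structure SquaresCommute {s t : ClosedWord Q} (O : Overlap s t) (lam : kˣ) (js : ℕ)
    (mu : kˣ) (jt : ℕ) (c : ℕ → kˣ) (aL aR : kˣ) : Prop where
  inner : ∀ (i : ℕ) (hi : i < O.ρ.length),
    if isDirect O.ρ[i] then
      c i * weight mu jt (O.δ.length + 1 + i) = weight lam js (O.β.length + 1 + i) * c (i + 1)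
    else
      c (i + 1) * weight mu jt (O.δ.length + 1 + i) = weight lam js (O.β.length + 1 + i) * c i
  left : O.fL ≠ [] →
    if isDirect O.σL then
      aL * weight mu jt O.δ.length = weight lam js O.β.length * c 0
    else
      c 0 * weight mu jt O.δ.length = weight lam js O.β.length * aL
  right : O.fR ≠ [] →
    if isDirect O.σR then
      c O.ρ.length * weight mu jt (O.δ.length + 1 + O.ρ.length) =
        weight lam js (O.β.length + 1 + O.ρ.length) * aR
    else
      aR * weight mu jt (O.δ.length + 1 + O.ρ.length) =
        weight lam js (O.β.length + 1 + O.ρ.length) * c O.ρ.length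

/-- `f` is a graph map given by the overlap `O`. The overlap must occur in the same cohomological
degrees in both complexes. The components on the overlap are identities up to the nonzero scalars
which are forced by the places of `lam` and `mu`. -/
structure IsGraphMap {s t : ClosedWord Q} (O : Overlap s t) (d : ℤ) (lam : kˣ) (js : s.Idx)
    (e : ℤ) (mu : kˣ) (jt : t.Idx)
    (f : bandComplex k s d lam js ⟶ bandComplex k t e mu jt) : Prop where
  degree : s.deg d (O.β.length + 1) = t.deg e (O.δ.length + 1)
  components : ∃ (c : ℕ → kˣ) (aL aR : kˣ), SquaresCommute O lam js mu jt c aL aR ∧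
    ∀ n : ℤ, f.f n = matMap k Q s.vert (fun i => s.deg d i) t.vert (fun i => t.deg e i)
      (graphMatrix k O c aL aR) n n

end

end Algebra

end Gentle

/-! The cone of $f$ is the sum of the projectives at all vertices of $\sigma$, lowered by one
degree, and of $\tau$; its differential $D$ is the block matrix with diagonal blocks $-D_\sigma$,
$D_\tau$ and off-diagonal block $f$. Along $\rho$ the components of $f$ are nonzero multiples of
identities, so Gaussian elimination cancels the two copies of $\rho$ against each other
(`gaussEquiv`, `contractionEquiv`). If $h$ inverts these components, the differential that survives
on the vertices outside $\rho$ is $D-DhD$.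

The cancelled block is diagonal, so $DhD$ only contains composites which enter the $\tau$-copy of
$\rho$ along $\tau_L$ or $\tau_R$, jump back by $h$, and leave the $\sigma$-copy along $\sigma_L$ or
$\sigma_R$. A composite from one end to the other could only occur for trivial $\rho$, and then its
two paths meet in a relation (`LeftEnd.rel_of_direct`, `Overlap.mat_mul_contraction_mul_mat_cross`).
At a given end either the component $f_L$ (or $f_R$) is present and the composite is zero, or there
is no such component and the composite is the nonzero product of two paths. Both cases give one
component, along the merged letter $\sigma_L\bar\tau_L$ or $\bar\tau_R\sigma_R$
(`LeftEnd.exists_mat_eq`). The outer summands therefore form one cycle, spelled by $c$.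

That $c$ is a closed homotopy word is a matter of gentleness. Where cancellation exposes a new arrow
at a border, the uniqueness axioms show that the border is still admissible (`LeftEnd.mergedLetter`,
`Overlap.coneWord`). Under the third endpoint condition they also show that the two paths compose,
as soon as the overlap or its other end provides a common neighbour; compatibility of orientation
covers the remaining case.

The scalars are handled by holonomy: the product around the cycle of the scalars of direct letters
and the inverse scalars of inverse letters. Rescaling summands changes the single scalars but not
the holonomy, and a cyclic diagram with the right holonomy is isomorphic to the band complex with
that parameter (`exists_inclusion`). For $c$, the word $\sigma$ contributes $\lambda$ and $\tau$
contributes $\mu^{-1}$. The commuting squares cancel the parts along $\rho$ up to the sign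
$(-1)^{|\rho|}$, which is left over from $-D_\sigma$ (`cone_holonomy`,
`Overlap.prod_hol_coneEdges`).

Right ends are reduced to left ends throughout by inverting the words. -/

namespace Gentle

noncomputable section

/-! ### Complexes of projectives as matrices over the algebra, and Gaussian elimination -/

section MatrixComplexes

variable {k : Type u} [Field k] {V : Type v} {E : Type w} [Fintype V] {Q : BoundQuiver V E}

lemma idem_mul_idem (x : V) : idem k Q x * idem k Q x = idem k Q x := by
  have h := RingQuot.mkAlgHom_rel k (AlgRel.idem (k := k) (Q := Q) x)
  rw [map_mul] at h
  exact h

lemma mul_idem_of_mem_proj {x : V} {u : BQAlg k Q} (hu : u ∈ proj k Q x) :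
    u * idem k Q x = u := by
  obtain ⟨a, rfl⟩ := Submodule.mem_span_singleton.1 hu
  rw [smul_eq_mul, mul_assoc, idem_mul_idem]

variable {ι ι' ι'' ι''' : Type}

/-- A matrix with entries `F p q` in `e_{v p} Λ e_{v' q}`, homogeneous of degree `n`. -/
structure IsGraded (v : ι → V) (deg : ι → ℤ) (v' : ι' → V) (deg' : ι' → ℤ) (n : ℤ)
    (F : Matrix ι ι' (BQAlg k Q)) : Prop where
  left : ∀ p q, idem k Q (v p) * F p q = F p q
  right : ∀ p q, F p q * idem k Q (v' q) = F p q
  degree : ∀ p q, F p q ≠ 0 → deg' q = deg p + n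

/-- The identity matrix of `⨁ P(v p)`. -/
def idMat (k : Type u) [Field k] (Q : BoundQuiver V E) [DecidableEq ι] (v : ι → V) :
    Matrix ι ι (BQAlg k Q) :=
  Matrix.diagonal fun p => idem k Q (v p)

section

variable {v : ι → V} {deg : ι → ℤ} {v' : ι' → V} {deg' : ι' → ℤ} {v'' : ι'' → V}
  {deg'' : ι'' → ℤ} {n m : ℤ}

namespace IsGraded

lemma zero : IsGraded (k := k) (Q := Q) v deg v' deg' n 0 :=
  ⟨fun _ _ => by simp, fun _ _ => by simp, fun _ _ h => (h rfl).elim⟩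

lemma add {F G : Matrix ι ι' (BQAlg k Q)} (hF : IsGraded v deg v' deg' n F)
    (hG : IsGraded v deg v' deg' n G) : IsGraded v deg v' deg' n (F + G) where
  left p q := by simp only [Matrix.add_apply, mul_add, hF.left, hG.left]
  right p q := by simp only [Matrix.add_apply, add_mul, hF.right, hG.right]
  degree p q h := by
    by_cases h1 : F p q = 0
    · exact hG.degree p q fun h2 => h (by simp [h1, h2])
    · exact hF.degree p q h1

lemma neg {F : Matrix ι ι' (BQAlg k Q)} (hF : IsGraded v deg v' deg' n F) :
    IsGraded v deg v' deg' n (-F) where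
  left p q := by simp only [Matrix.neg_apply, mul_neg, hF.left]
  right p q := by simp only [Matrix.neg_apply, neg_mul, hF.right]
  degree p q h := hF.degree p q fun h2 => h (by simp [h2])

lemma sub {F G : Matrix ι ι' (BQAlg k Q)} (hF : IsGraded v deg v' deg' n F)
    (hG : IsGraded v deg v' deg' n G) : IsGraded v deg v' deg' n (F - G) := by
  rw [sub_eq_add_neg]
  exact hF.add hG.neg

lemma sum {α : Type*} (s : Finset α) {F : α → Matrix ι ι' (BQAlg k Q)}
    (hF : ∀ a ∈ s, IsGraded v deg v' deg' n (F a)) :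
    IsGraded v deg v' deg' n (∑ a ∈ s, F a) :=
  Finset.sum_induction _ _ (fun _ _ => IsGraded.add) IsGraded.zero hF

lemma listSum {L : List (Matrix ι ι' (BQAlg k Q))}
    (hF : ∀ F ∈ L, IsGraded v deg v' deg' n F) :
    IsGraded v deg v' deg' n L.sum := by
  induction L with
  | nil => exact IsGraded.zero
  | cons F L ih =>
    rw [List.sum_cons]
    exact (hF F (by simp)).add (ih fun G hG => hF G (by simp [hG]))

lemma mul [Fintype ι'] {F : Matrix ι ι' (BQAlg k Q)} {G : Matrix ι' ι'' (BQAlg k Q)}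
    (hF : IsGraded v deg v' deg' n F) (hG : IsGraded v' deg' v'' deg'' m G) :
    IsGraded v deg v'' deg'' (n + m) (F * G) where
  left p q := by simp only [Matrix.mul_apply, Finset.mul_sum, ← mul_assoc, hF.left]
  right p q := by simp only [Matrix.mul_apply, Finset.sum_mul, mul_assoc, hG.right]
  degree p q h := by
    rw [Matrix.mul_apply] at h
    obtain ⟨r, -, hr⟩ := Finset.exists_ne_zero_of_sum_ne_zero h
    have h1 := hF.degree p r fun h1 => hr (by simp [h1])
    have h2 := hG.degree r q fun h2 => hr (by simp [h2])
    omega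

lemma single [DecidableEq ι] [DecidableEq ι'] {p : ι} {q : ι'} {a : BQAlg k Q}
    (h1 : idem k Q (v p) * a = a) (h2 : a * idem k Q (v' q) = a) (h3 : deg' q = deg p + n) :
    IsGraded v deg v' deg' n (Matrix.single p q a) where
  left i j := by
    by_cases h : p = i ∧ q = j
    · obtain ⟨rfl, rfl⟩ := h
      simpa using h1
    · simp [Matrix.single_apply_of_ne (h := h)]
  right i j := by
    by_cases h : p = i ∧ q = j
    · obtain ⟨rfl, rfl⟩ := h
      simpa using h2
    · simp [Matrix.single_apply_of_ne (h := h)]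
  degree i j h0 := by
    by_cases h : p = i ∧ q = j
    · obtain ⟨rfl, rfl⟩ := h
      exact h3
    · exact (h0 (by simp [Matrix.single_apply_of_ne (h := h)])).elim

lemma id_mul [Fintype ι] [DecidableEq ι] {F : Matrix ι ι' (BQAlg k Q)}
    (hF : IsGraded v deg v' deg' n F) : idMat k Q v * F = F := by
  ext p q
  rw [idMat, Matrix.diagonal_mul, hF.left]

lemma mul_id [Fintype ι'] [DecidableEq ι'] {F : Matrix ι ι' (BQAlg k Q)}
    (hF : IsGraded v deg v' deg' n F) : F * idMat k Q v' = F := by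
  ext p q
  rw [idMat, Matrix.mul_diagonal, hF.right]

end IsGraded

lemma isGraded_idMat [DecidableEq ι] : IsGraded (k := k) (Q := Q) v deg v deg 0 (idMat k Q v) where
  left p q := by
    by_cases h : p = q
    · subst h; simp [idMat, idem_mul_idem]
    · simp [idMat, h]
  right p q := by
    by_cases h : p = q
    · subst h; simp [idMat, idem_mul_idem]
    · simp [idMat, h]
  degree p q h := by
    by_cases h' : p = q
    · subst h'; simp
    · exact (h (by simp [idMat, h'])).elim

/-- The homomorphism `⨁ P(v p) → ⨁ P(v' q)` given by a matrix, in degrees `i` and `j`. -/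
def matrixLin [Fintype ι] (v : ι → V) (deg : ι → ℤ) (v' : ι' → V) (deg' : ι' → ℤ)
    (F : Matrix ι ι' (BQAlg k Q)) (i j : ℤ) :
    ((p : {p : ι // deg p = i}) → proj k Q (v p.1)) →ₗ[BQAlg k Q]
      ((q : {q : ι' // deg' q = j}) → proj k Q (v' q.1)) :=
  matLin k Q v deg v' deg' F i j

lemma matrixLin_apply [Fintype ι] (F : Matrix ι ι' (BQAlg k Q)) (i j : ℤ)
    (x : (p : {p : ι // deg p = i}) → proj k Q (v p.1)) (q : {q : ι' // deg' q = j}) :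
    (matrixLin v deg v' deg' F i j x q : BQAlg k Q) =
      ∑ p : {p : ι // deg p = i}, (x p : BQAlg k Q) * (F p.1 q.1 * idem k Q (v' q.1)) :=
  matLin_apply k Q v deg v' deg' F i j x q

/-- Matrices act on rows from the right, so products are taken in the order of composition. The
matrix product sums over all intermediate summands, the composite only over those of degree `j`;
homogeneity of `F` kills the others. -/
lemma matrixLin_comp [Fintype ι] [Fintype ι'] {F : Matrix ι ι' (BQAlg k Q)}
    (hF : IsGraded v deg v' deg' n F) (G : Matrix ι' ι'' (BQAlg k Q)) {i j : ℤ}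
    (hij : i + n = j) (l : ℤ) :
    matrixLin v' deg' v'' deg'' G j l ∘ₗ matrixLin v deg v' deg' F i j =
      matrixLin v deg v'' deg'' (F * G) i l := by
  refine LinearMap.ext fun x => funext fun r => Subtype.ext ?_
  rw [LinearMap.comp_apply, matrixLin_apply, matrixLin_apply]
  simp only [matrixLin_apply, Finset.sum_mul]
  rw [Finset.sum_comm]
  refine Finset.sum_congr rfl fun p _ => ?_
  rw [Matrix.mul_apply, Finset.sum_mul, Finset.mul_sum,
    ← Finset.sum_filter_of_ne (p := fun q => deg' q = j) (s := Finset.univ),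
    Finset.sum_subtype (p := fun q => deg' q = j) _ (by simp)]
  · refine Finset.sum_congr rfl fun q _ => ?_
    rw [hF.right]
    simp only [mul_assoc]
  · intro q _ hq
    rw [hF.degree p.1 q fun h => hq (by simp [h]), p.2, hij]

lemma matrixLin_id [Fintype ι] [DecidableEq ι] (i : ℤ) :
    matrixLin v deg v deg (idMat k Q v) i i = LinearMap.id := by
  refine LinearMap.ext fun x => funext fun r => Subtype.ext ?_
  rw [matrixLin_apply, Finset.sum_eq_single r]
  · simp only [idMat, Matrix.diagonal_apply_eq, idem_mul_idem]
    exact mul_idem_of_mem_proj (x r).2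
  · intro p _ hp
    have : p.1 ≠ r.1 := fun h => hp (Subtype.ext h)
    simp [idMat, this]
  · simp

lemma matrixLin_add [Fintype ι] (F G : Matrix ι ι' (BQAlg k Q)) (i j : ℤ) :
    matrixLin v deg v' deg' (F + G) i j =
      matrixLin v deg v' deg' F i j + matrixLin v deg v' deg' G i j := by
  refine LinearMap.ext fun x => funext fun r => Subtype.ext ?_
  rw [LinearMap.add_apply, Pi.add_apply, Submodule.coe_add]
  simp only [matrixLin_apply, Matrix.add_apply, add_mul, mul_add, Finset.sum_add_distrib]

lemma matrixLin_neg [Fintype ι] (F : Matrix ι ι' (BQAlg k Q)) (i j : ℤ) :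
    matrixLin v deg v' deg' (-F) i j = -matrixLin v deg v' deg' F i j := by
  refine LinearMap.ext fun x => funext fun r => Subtype.ext ?_
  rw [LinearMap.neg_apply, Pi.neg_apply, Submodule.coe_neg]
  simp only [matrixLin_apply, Matrix.neg_apply, neg_mul, mul_neg, Finset.sum_neg_distrib]

lemma matrixLin_zero [Fintype ι] (i j : ℤ) :
    matrixLin v deg v' deg' (0 : Matrix ι ι' (BQAlg k Q)) i j = 0 := by
  refine LinearMap.ext fun x => funext fun r => Subtype.ext ?_
  simp [matrixLin_apply]

/-- Elements of $P(x)$ absorb $e_x$ on the right, so only the corners $e_{v p}\Lambda e_{v' q}$ of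
the entries matter. This permits replacing the plain scalars in `graphMatrix` by multiples of
idempotents. -/
lemma matrixLin_congr [Fintype ι] {F G : Matrix ι ι' (BQAlg k Q)}
    (h : ∀ p q, idem k Q (v p) * F p q * idem k Q (v' q) =
      idem k Q (v p) * G p q * idem k Q (v' q)) (i j : ℤ) :
    matrixLin v deg v' deg' F i j = matrixLin v deg v' deg' G i j := by
  refine LinearMap.ext fun x => funext fun r => Subtype.ext ?_
  simp only [matrixLin_apply]
  refine Finset.sum_congr rfl fun p _ => ?_
  rw [← mul_idem_of_mem_proj (x p).2]
  simp only [mul_assoc] at h ⊢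
  rw [h]

/-- A homogeneous matrix is recovered from its maps by evaluation at the generators $e_{v p}$. Hence
identities between morphisms can be turned into identities of matrices. -/
lemma IsGraded.eq_zero [Fintype ι] [DecidableEq ι] {F : Matrix ι ι' (BQAlg k Q)}
    (hF : IsGraded v deg v' deg' n F)
    (h : ∀ i, matrixLin v deg v' deg' F i (i + n) = 0) : F = 0 := by
  ext p q
  by_contra h0
  have hd := hF.degree p q h0
  let P : {p' // deg p' = deg p} := ⟨p, rfl⟩
  let x : (p' : {p' // deg p' = deg p}) → proj k Q (v p'.1) :=
    Pi.single P ⟨idem k Q (v p), Submodule.mem_span_singleton_self _⟩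
  have h1 := congrArg (fun y => (y ⟨q, hd⟩ : BQAlg k Q)) (LinearMap.congr_fun (h (deg p)) x)
  simp only [matrixLin_apply] at h1
  rw [Finset.sum_eq_single P] at h1
  · simp only [x, Pi.single_eq_same] at h1
    rw [hF.right, hF.left] at h1
    exact h0 (by simpa using h1)
  · intro p' _ hp'
    simp [x, Pi.single_eq_of_ne hp']
  · simp

end

section

variable [Fintype ι] [Fintype ι'] {v : ι → V} {deg : ι → ℤ} {v' : ι' → V} {deg' : ι' → ℤ}

/-- The homomorphism given by a matrix, between the graded pieces. -/
def matrixHom (v : ι → V) (deg : ι → ℤ) (v' : ι' → V) (deg' : ι' → ℤ)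
    (F : Matrix ι ι' (BQAlg k Q)) (i j : ℤ) :
    gradedPiece k Q v deg i ⟶ gradedPiece k Q v' deg' j :=
  ModuleCat.ofHom (matrixLin v deg v' deg' F i j)

lemma matrixHom_comp [Fintype ι''] {v'' : ι'' → V} {deg'' : ι'' → ℤ} {n : ℤ}
    {F : Matrix ι ι' (BQAlg k Q)}
    (hF : IsGraded v deg v' deg' n F) (G : Matrix ι' ι'' (BQAlg k Q)) {i j : ℤ}
    (hij : i + n = j) (l : ℤ) :
    matrixHom v deg v' deg' F i j ≫ matrixHom v' deg' v'' deg'' G j l =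
      matrixHom v deg v'' deg'' (F * G) i l := by
  rw [matrixHom, matrixHom, matrixHom, ← matrixLin_comp hF G hij l, ModuleCat.ofHom_comp]

lemma matrixHom_id [DecidableEq ι] (i : ℤ) :
    matrixHom v deg v deg (idMat k Q v) i i = 𝟙 _ := by
  rw [matrixHom, matrixLin_id]
  rfl

lemma matrixHom_add (F G : Matrix ι ι' (BQAlg k Q)) (i j : ℤ) :
    matrixHom v deg v' deg' (F + G) i j =
      matrixHom v deg v' deg' F i j + matrixHom v deg v' deg' G i j := by
  rw [matrixHom, matrixLin_add]
  rfl

lemma matrixHom_neg (F : Matrix ι ι' (BQAlg k Q)) (i j : ℤ) :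
    matrixHom v deg v' deg' (-F) i j = -matrixHom v deg v' deg' F i j := by
  rw [matrixHom, matrixLin_neg]
  rfl

lemma matrixHom_sub (F G : Matrix ι ι' (BQAlg k Q)) (i j : ℤ) :
    matrixHom v deg v' deg' (F - G) i j =
      matrixHom v deg v' deg' F i j - matrixHom v deg v' deg' G i j := by
  rw [sub_eq_add_neg, matrixHom_add, matrixHom_neg, sub_eq_add_neg]

lemma matrixHom_zero (i j : ℤ) :
    matrixHom v deg v' deg' (0 : Matrix ι ι' (BQAlg k Q)) i j = 0 := by
  rw [matrixHom, matrixLin_zero]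
  rfl

/-- The complex with terms `⨁ P(v p)` and differential given by a matrix. -/
def matComplex (v : ι → V) (deg : ι → ℤ) (D : Matrix ι ι (BQAlg k Q))
    (hD : IsGraded v deg v deg 1 D) (hDD : D * D = 0) :
    CochainComplex (ModuleCat.{max u v w} (BQAlg k Q)) ℤ where
  X n := gradedPiece k Q v deg n
  d m n := if m + 1 = n then matrixHom v deg v deg D m n else 0
  shape m n h := if_neg h
  d_comp_d' m n l h1 h2 := by
    have h1' : m + 1 = n := h1
    have h2' : n + 1 = l := h2
    rw [if_pos h1', if_pos h2', matrixHom_comp hD D h1', hDD, matrixHom_zero]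

lemma matComplex_d {D : Matrix ι ι (BQAlg k Q)} {hD : IsGraded v deg v deg 1 D}
    {hDD : D * D = 0} {m n : ℤ} (h : m + 1 = n) :
    (matComplex v deg D hD hDD).d m n = matrixHom v deg v deg D m n := if_pos h

variable {D : Matrix ι ι (BQAlg k Q)} {hD : IsGraded v deg v deg 1 D} {hDD : D * D = 0}
  {D' : Matrix ι' ι' (BQAlg k Q)} {hD' : IsGraded v' deg' v' deg' 1 D'} {hDD' : D' * D' = 0}

/-- The map of complexes given by a matrix. -/
def matComplexMap (F : Matrix ι ι' (BQAlg k Q)) (hF : IsGraded v deg v' deg' 0 F)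
    (h : F * D' = D * F) : matComplex v deg D hD hDD ⟶ matComplex v' deg' D' hD' hDD' where
  f n := matrixHom v deg v' deg' F n n
  comm' i j hij := by
    have hij' : i + 1 = j := hij
    rw [matComplex_d hij', matComplex_d hij']
    refine (matrixHom_comp hF D' (add_zero i) j).trans ?_
    rw [h]
    exact (matrixHom_comp hD F hij' j).symm

variable (hD hDD hD' hDD') in
/-- A homomorphism between terms of two complexes, given by a matrix. -/
def matComplexComp (F : Matrix ι ι' (BQAlg k Q)) (i j : ℤ) :
    (matComplex v deg D hD hDD).X i ⟶ (matComplex v' deg' D' hD' hDD').X j :=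
  matrixHom v deg v' deg' F i j

/-- A matrix of degree `-1` gives a homotopy. -/
def matHomotopy (F G : matComplex v deg D hD hDD ⟶ matComplex v' deg' D' hD' hDD')
    (A B : Matrix ι ι' (BQAlg k Q)) (hA : ∀ n, F.f n = matrixHom v deg v' deg' A n n)
    (hB : ∀ n, G.f n = matrixHom v deg v' deg' B n n)
    (H : Matrix ι ι' (BQAlg k Q)) (hH : IsGraded v deg v' deg' (-1) H)
    (h : A = D * H + H * D' + B) : Homotopy F G where
  hom i j := if j + 1 = i then matComplexComp hD hDD hD' hDD' H i j else 0
  zero i j hij := if_neg hij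
  comm i := by
    rw [dNext_eq _ (show (ComplexShape.up ℤ).Rel i (i + 1) from rfl),
      prevD_eq _ (show (ComplexShape.up ℤ).Rel (i - 1) i from by simp), if_pos rfl,
      if_pos (by ring), matComplex_d rfl, matComplex_d (by ring), hA, hB, h]
    refine ((matrixHom_add _ _ _ _).trans (congrArg₂ _ (matrixHom_add _ _ _ _) rfl)).trans ?_
    exact congrArg₂ _ (congrArg₂ _ (matrixHom_comp hD H rfl i).symm
      (matrixHom_comp hH D' (by ring) i).symm) rfl

/-- Gaussian elimination: contracting the pairs of summands matched by the homotopy `h`. -/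
def gaussEquiv [DecidableEq ι] [DecidableEq ι'] (inc : Matrix ι' ι (BQAlg k Q))
    (prj : Matrix ι ι' (BQAlg k Q)) (h eU eW : Matrix ι ι (BQAlg k Q))
    (hinc : IsGraded v' deg' v deg 0 inc) (hprj : IsGraded v deg v' deg' 0 prj)
    (hh : IsGraded v deg v deg (-1) h)
    (h1 : inc * prj = idMat k Q v') (h2 : prj * inc = idMat k Q v - eU - eW)
    (h3 : h * D * eW = eW) (h4 : eU * D * h = eU)
    (h5 : eW * h = h) (h6 : h * h = 0) (h7 : inc * h = 0) (h8 : h * prj = 0)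
    (h9 : inc * D * prj - inc * D * h * D * prj = D') :
    HomotopyEquiv (matComplex v deg D hD hDD) (matComplex v' deg' D' hD' hDD') := by
  -- Here `eU` and `eW` project to the sources and targets of the cancelled isomorphisms, and `h`
  -- leads from the targets back to the sources. Inserting `h = eW * h` reduces the claim to `h3`.
  have hDh : h * D * h = h := by
    conv_lhs => rw [← h5, ← Matrix.mul_assoc, h5, h3, h5]
  have a1 : ∀ X : Matrix ι ι' (BQAlg k Q), D * (D * X) = 0 := fun X => by
    rw [← Matrix.mul_assoc, hDD, Matrix.zero_mul]
  have a2 : ∀ X : Matrix ι ι (BQAlg k Q), D * (D * X) = 0 := fun X => by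
    rw [← Matrix.mul_assoc, hDD, Matrix.zero_mul]
  have a3 : ∀ X : Matrix ι ι' (BQAlg k Q), h * (h * X) = 0 := fun X => by
    rw [← Matrix.mul_assoc, h6, Matrix.zero_mul]
  have a4 : ∀ X : Matrix ι ι' (BQAlg k Q), h * (D * (h * X)) = h * X := fun X => by
    rw [← Matrix.mul_assoc, ← Matrix.mul_assoc, hDh]
  have a5 : ∀ X : Matrix ι ι (BQAlg k Q), h * (D * (h * X)) = h * X := fun X => by
    rw [← Matrix.mul_assoc, ← Matrix.mul_assoc, hDh]
  have a6 : ∀ X : Matrix ι ι (BQAlg k Q), inc * (h * X) = 0 := fun X => by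
    rw [← Matrix.mul_assoc, h7, Matrix.zero_mul]
  have a7 : ∀ X : Matrix ι ι' (BQAlg k Q), inc * (h * X) = 0 := fun X => by
    rw [← Matrix.mul_assoc, h7, Matrix.zero_mul]
  -- The projection and the inclusion are perturbed by the zigzags through the cancelled pairs. The
  -- result is a strong deformation retract: one composite is the identity, the other differs from
  -- it by the boundary of `h`.
  have hIP : (inc - inc * D * h) * (prj - h * D * prj) = idMat k Q v' := by
    simp only [Matrix.sub_mul, Matrix.mul_sub, Matrix.mul_assoc, h8, Matrix.mul_zero, a3, a7,
      h1, sub_zero]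
  have hPI : (prj - h * D * prj) * (inc - inc * D * h) = idMat k Q v - h * D - D * h := by
    have e1 : (prj - h * D * prj) * (inc - inc * D * h) =
        prj * inc - h * D * (prj * inc) - (prj * inc) * D * h +
          h * D * (prj * inc) * D * h := by
      simp only [Matrix.sub_mul, Matrix.mul_sub, Matrix.mul_assoc]
      abel
    have hDh' : h * D * idMat k Q v = h * D := by rw [Matrix.mul_assoc, hD.mul_id]
    have e2 : h * D * (idMat k Q v - eU - eW) = h * D - h * D * eU - eW := by
      rw [Matrix.mul_sub, Matrix.mul_sub, h3, hDh']
    have e3 : (idMat k Q v - eU - eW) * D * h = D * h - eU - eW * D * h := by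
      rw [Matrix.sub_mul, Matrix.sub_mul, Matrix.sub_mul, Matrix.sub_mul, h4, hD.id_mul]
    have e4 : h * D * D * h = 0 := by
      simp only [Matrix.mul_assoc, a2, Matrix.mul_zero]
    have e5 : h * D * eU * D * h = h * D * eU := by
      rw [Matrix.mul_assoc (h * D), Matrix.mul_assoc (h * D), h4]
    rw [e1, h2, e2, e3, Matrix.sub_mul, Matrix.sub_mul, Matrix.sub_mul, Matrix.sub_mul, e4, e5]
    abel
  -- The reduced differential is the old one transported along the perturbed maps; with `hPI` this
  -- makes both of them chain maps.
  have hIDP : D' = (inc - inc * D * h) * D * (prj - h * D * prj) := by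
    rw [← h9]
    simp only [Matrix.sub_mul, Matrix.mul_sub, Matrix.mul_assoc, a4]
    abel
  have hgI : IsGraded v' deg' v deg 0 (inc - inc * D * h) :=
    hinc.sub (by simpa using (hinc.mul hD).mul hh)
  have hgP : IsGraded v deg v' deg' 0 (prj - h * D * prj) :=
    hprj.sub (by simpa using (hh.mul hD).mul hprj)
  have cP : (prj - h * D * prj) * D' = D * (prj - h * D * prj) := by
    rw [hIDP, ← Matrix.mul_assoc, ← Matrix.mul_assoc, hPI]
    simp only [Matrix.sub_mul, Matrix.mul_sub, Matrix.mul_assoc, a1, a4, Matrix.mul_zero,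
      hD.id_mul]
    abel
  have cI : (inc - inc * D * h) * D = D' * (inc - inc * D * h) := by
    rw [hIDP, Matrix.mul_assoc ((inc - inc * D * h) * D), hPI]
    simp only [Matrix.sub_mul, Matrix.mul_sub, Matrix.mul_assoc, a2, a5, Matrix.mul_zero,
      hD.mul_id]
    abel
  exact
    { hom := matComplexMap _ hgP cP
      inv := matComplexMap _ hgI cI
      homotopyHomInvId := matHomotopy _ _ _ _
        (fun n => (matrixHom_comp hgP _ (add_zero n) n)) (fun n => (matrixHom_id n).symm)
        (-h) hh.neg (by rw [hPI, Matrix.mul_neg, Matrix.neg_mul]; abel)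
      homotopyInvHomId := Homotopy.ofEq (by
        ext n : 1
        refine (matrixHom_comp hgI _ (add_zero n) n).trans ?_
        rw [hIP, matrixHom_id]
        rfl) }

end

end MatrixComplexes

end

end Gentle

namespace Gentle

noncomputable section

/-! ### The mapping cone of a map given by a matrix -/

section MatrixCones

open CochainComplex HomComplex

variable {k : Type u} [Field k] {V : Type v} {E : Type w} [Fintype V] {Q : BoundQuiver V E}
  {ι ι' ι'' : Type} [Fintype ι] [Fintype ι'] [Fintype ι'']
  {v : ι → V} {deg : ι → ℤ} {v' : ι' → V} {deg' : ι' → ℤ} {v'' : ι'' → V} {deg'' : ι'' → ℤ}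
  {D : Matrix ι ι (BQAlg k Q)} {hD : IsGraded v deg v deg 1 D} {hDD : D * D = 0}
  {D' : Matrix ι' ι' (BQAlg k Q)} {hD' : IsGraded v' deg' v' deg' 1 D'} {hDD' : D' * D' = 0}
  {D'' : Matrix ι'' ι'' (BQAlg k Q)} {hD'' : IsGraded v'' deg'' v'' deg'' 1 D''}
  {hDD'' : D'' * D'' = 0}

lemma matComplexComp_comp {n : ℤ} {F : Matrix ι ι' (BQAlg k Q)}
    (hF : IsGraded v deg v' deg' n F) (G : Matrix ι' ι'' (BQAlg k Q)) {i j : ℤ}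
    (hij : i + n = j) (l : ℤ) :
    matComplexComp hD hDD hD' hDD' F i j ≫ matComplexComp hD' hDD' hD'' hDD'' G j l =
      matComplexComp hD hDD hD'' hDD'' (F * G) i l :=
  matrixHom_comp hF G hij l

lemma matComplexComp_id [DecidableEq ι] (i : ℤ) :
    matComplexComp hD hDD hD hDD (idMat k Q v) i i = 𝟙 _ :=
  matrixHom_id i

lemma matComplexComp_add (F G : Matrix ι ι' (BQAlg k Q)) (i j : ℤ) :
    matComplexComp hD hDD hD' hDD' (F + G) i j =
      matComplexComp hD hDD hD' hDD' F i j + matComplexComp hD hDD hD' hDD' G i j :=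
  matrixHom_add F G i j

lemma matComplexComp_neg (F : Matrix ι ι' (BQAlg k Q)) (i j : ℤ) :
    matComplexComp hD hDD hD' hDD' (-F) i j = -matComplexComp hD hDD hD' hDD' F i j :=
  matrixHom_neg F i j

lemma matComplexComp_zero (i j : ℤ) :
    matComplexComp hD hDD hD' hDD' (0 : Matrix ι ι' (BQAlg k Q)) i j = 0 :=
  matrixHom_zero i j

lemma matComplex_d_eq_comp {m n : ℤ} (h : m + 1 = n) :
    (matComplex v deg D hD hDD).d m n = matComplexComp hD hDD hD hDD D m n := if_pos h

/-- Commutation with the differentials need not be checked by hand for the matrix of a graph map: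
the given morphism $f$ is a chain map, and a homogeneous matrix is determined by its maps. -/
lemma matrix_comm_of_hom [DecidableEq ι]
    (f : matComplex v deg D hD hDD ⟶ matComplex v' deg' D' hD' hDD')
    {F : Matrix ι ι' (BQAlg k Q)} (hF : IsGraded v deg v' deg' 0 F)
    (hf : ∀ n, f.f n = matComplexComp hD hDD hD' hDD' F n n) : F * D' = D * F := by
  refine sub_eq_zero.1 (IsGraded.eq_zero (v := v) (deg := deg) (v' := v') (deg' := deg') (n := 1)
    (by simpa using (hF.mul hD').sub (hD.mul hF)) fun i => ?_)
  have h := f.comm i (i + 1)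
  rw [hf, hf, matComplex_d_eq_comp rfl, matComplex_d_eq_comp rfl,
    matComplexComp_comp hF D' (add_zero i), matComplexComp_comp hD F rfl] at h
  have h2 : matrixHom v deg v' deg' (F * D' - D * F) i (i + 1) = 0 :=
    (matrixHom_sub _ _ _ _).trans (sub_eq_zero.2 h)
  exact congrArg ModuleCat.Hom.hom h2

section

variable (D D') in
/-- The differential of the mapping cone of the map of complexes given by a matrix. -/
def coneMatrix (F : Matrix ι ι' (BQAlg k Q)) : Matrix (ι ⊕ ι') (ι ⊕ ι') (BQAlg k Q) :=
  Matrix.fromBlocks (-D) F 0 D'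

/-- The summands of a mapping cone. -/
abbrev coneVert (v : ι → V) (v' : ι' → V) : ι ⊕ ι' → V := Sum.elim v v'

/-- The degrees of the summands of a mapping cone. -/
abbrev coneDeg (deg : ι → ℤ) (deg' : ι' → ℤ) : ι ⊕ ι' → ℤ := Sum.elim (fun i => deg i - 1) deg'

omit [Fintype ι] [Fintype ι'] in
lemma isGraded_coneMatrix {F : Matrix ι ι' (BQAlg k Q)} (hD : IsGraded v deg v deg 1 D)
    (hD' : IsGraded v' deg' v' deg' 1 D') (hF : IsGraded v deg v' deg' 0 F) :
    IsGraded (coneVert v v') (coneDeg deg deg') (coneVert v v') (coneDeg deg deg') 1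
      (coneMatrix D D' F) where
  left := by
    rintro (p | p) (q | q)
    · exact hD.neg.left p q
    · exact hF.left p q
    · exact mul_zero _
    · exact hD'.left p q
  right := by
    rintro (p | p) (q | q)
    · exact hD.neg.right p q
    · exact hF.right p q
    · exact zero_mul _
    · exact hD'.right p q
  degree := by
    rintro (p | p) (q | q) h
    · have := hD.neg.degree p q h
      simp only [Sum.elim_inl]; omega
    · have := hF.degree p q h
      simp only [Sum.elim_inl, Sum.elim_inr]; omega
    · exact (h rfl).elim
    · exact hD'.degree p q h

omit [Fintype ι''] in
lemma fromCols_mul_coneMatrix (A : Matrix ι'' ι (BQAlg k Q)) (B : Matrix ι'' ι' (BQAlg k Q))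
    (F : Matrix ι ι' (BQAlg k Q)) :
    Matrix.fromCols A B * coneMatrix D D' F = Matrix.fromCols (-(A * D)) (A * F + B * D') := by
  rw [coneMatrix, Matrix.fromCols_mul_fromBlocks]
  simp

lemma coneMatrix_mul_self {F : Matrix ι ι' (BQAlg k Q)} (hDD : D * D = 0) (hDD' : D' * D' = 0)
    (hF : F * D' = D * F) : coneMatrix D D' F * coneMatrix D D' F = 0 := by
  rw [coneMatrix, Matrix.fromBlocks_multiply, ← Matrix.fromBlocks_zero]
  congr 1
  · simp [hDD]
  · simp [hF]
  · simp
  · simp [hDD']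

variable [DecidableEq ι] [DecidableEq ι']

omit [Fintype ι] [Fintype ι'] [DecidableEq ι'] in
lemma isGraded_coneInl : IsGraded (k := k) (Q := Q) v deg (coneVert v v') (coneDeg deg deg') (-1)
    (Matrix.fromCols (idMat k Q v) 0) where
  left := by
    rintro p (q | q)
    · exact (isGraded_idMat (deg := deg)).left p q
    · exact mul_zero _
  right := by
    rintro p (q | q)
    · exact (isGraded_idMat (deg := deg)).right p q
    · exact zero_mul _
  degree := by
    rintro p (q | q) h
    · have := (isGraded_idMat (deg := deg)).degree p q h
      simp only [Sum.elim_inl]; omega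
    · exact (h rfl).elim

omit [Fintype ι] [Fintype ι'] [DecidableEq ι] in
lemma isGraded_coneInr : IsGraded (k := k) (Q := Q) v' deg' (coneVert v v') (coneDeg deg deg') 0
    (Matrix.fromCols 0 (idMat k Q v')) where
  left := by
    rintro p (q | q)
    · exact mul_zero _
    · exact (isGraded_idMat (deg := deg')).left p q
  right := by
    rintro p (q | q)
    · exact zero_mul _
    · exact (isGraded_idMat (deg := deg')).right p q
  degree := by
    rintro p (q | q) h
    · exact (h rfl).elim
    · exact (isGraded_idMat (deg := deg')).degree p q h

omit [Fintype ι] [Fintype ι'] [DecidableEq ι'] in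
lemma isGraded_coneFst : IsGraded (k := k) (Q := Q) (coneVert v v') (coneDeg deg deg') v deg 1
    (Matrix.fromRows (idMat k Q v) 0) where
  left := by
    rintro (q | q) p
    · exact (isGraded_idMat (deg := deg)).left q p
    · exact mul_zero _
  right := by
    rintro (q | q) p
    · exact (isGraded_idMat (deg := deg)).right q p
    · exact zero_mul _
  degree := by
    rintro (q | q) p h
    · have := (isGraded_idMat (deg := deg)).degree q p h
      simp only [Sum.elim_inl]; omega
    · exact (h rfl).elim

omit [Fintype ι] [Fintype ι'] [DecidableEq ι] in
lemma isGraded_coneSnd : IsGraded (k := k) (Q := Q) (coneVert v v') (coneDeg deg deg') v' deg' 0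
    (Matrix.fromRows 0 (idMat k Q v')) where
  left := by
    rintro (q | q) p
    · exact mul_zero _
    · exact (isGraded_idMat (deg := deg')).left q p
  right := by
    rintro (q | q) p
    · exact zero_mul _
    · exact (isGraded_idMat (deg := deg')).right q p
  degree := by
    rintro (q | q) p h
    · exact (h rfl).elim
    · exact (isGraded_idMat (deg := deg')).degree q p h

/-- The mapping cone of a map given by a matrix is given by a matrix. -/
def mappingConeIso (f : matComplex v deg D hD hDD ⟶ matComplex v' deg' D' hD' hDD')
    {F : Matrix ι ι' (BQAlg k Q)} (hF : IsGraded v deg v' deg' 0 F)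
    (hf : ∀ n, f.f n = matComplexComp hD hDD hD' hDD' F n n) :
    mappingCone f ≅ matComplex (coneVert v v') (coneDeg deg deg') (coneMatrix D D' F)
      (isGraded_coneMatrix hD hD' hF)
      (coneMatrix_mul_self hDD hDD' (matrix_comm_of_hom f hF hf)) :=
  HomologicalComplex.Hom.isoOfComponents
    (fun n =>
      { hom := (mappingCone.fst f).1.v n (n + 1) rfl ≫
            matComplexComp hD hDD _ _ (Matrix.fromCols (idMat k Q v) 0) (n + 1) n +
          (mappingCone.snd f).v n n (add_zero n) ≫
            matComplexComp hD' hDD' _ _ (Matrix.fromCols 0 (idMat k Q v')) n n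
        inv := matComplexComp _ _ hD hDD (Matrix.fromRows (idMat k Q v) 0) n (n + 1) ≫
            (mappingCone.inl f).v (n + 1) n (by omega) +
          matComplexComp _ _ hD' hDD' (Matrix.fromRows 0 (idMat k Q v')) n n ≫
            (mappingCone.inr f).f n
        hom_inv_id := by
          apply mappingCone.ext_from f (n + 1) n rfl
          · simp only [Preadditive.comp_add, Preadditive.add_comp, Category.assoc,
              mappingCone.inl_v_fst_v_assoc, mappingCone.inl_v_snd_v_assoc, Limits.zero_comp,
              add_zero, Category.comp_id]
            rw [← Category.assoc, ← Category.assoc,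
              matComplexComp_comp isGraded_coneInl _ (by ring),
              matComplexComp_comp isGraded_coneInl _ (by ring), Matrix.fromCols_mul_fromRows,
              Matrix.fromCols_mul_fromRows]
            simp only [Matrix.mul_zero, Matrix.zero_mul, add_zero,
              isGraded_idMat (deg := deg) |>.id_mul, matComplexComp_zero, matComplexComp_id,
              Limits.zero_comp, Category.id_comp]
          · simp only [Preadditive.comp_add, Preadditive.add_comp, Category.assoc,
              mappingCone.inr_f_fst_v_assoc, mappingCone.inr_f_snd_v_assoc, Limits.zero_comp,
              zero_add, Category.comp_id]
            rw [← Category.assoc, ← Category.assoc,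
              matComplexComp_comp isGraded_coneInr _ (by ring),
              matComplexComp_comp isGraded_coneInr _ (by ring), Matrix.fromCols_mul_fromRows,
              Matrix.fromCols_mul_fromRows]
            simp only [Matrix.mul_zero, Matrix.zero_mul, zero_add,
              isGraded_idMat (deg := deg') |>.id_mul, matComplexComp_zero, matComplexComp_id,
              Limits.zero_comp, Category.id_comp]
        inv_hom_id := by
          simp only [Preadditive.comp_add, Preadditive.add_comp, Category.assoc,
              mappingCone.inr_f_fst_v_assoc, mappingCone.inr_f_snd_v_assoc,
              mappingCone.inl_v_fst_v_assoc, mappingCone.inl_v_snd_v_assoc, Limits.zero_comp,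
              Limits.comp_zero, add_zero, zero_add]
          rw [matComplexComp_comp isGraded_coneFst _ (by ring),
            matComplexComp_comp isGraded_coneSnd _ (by ring), ← matComplexComp_add,
            ← matComplexComp_id]
          congr 1
          ext (p | p) (q | q) <;>
            simp [Matrix.fromRows_mul, Matrix.mul_fromCols,
              idMat, Matrix.diagonal_apply, idem_mul_idem] })
    (by
      rintro i j hij
      obtain rfl : i + 1 = j := hij
      rw [matComplex_d_eq_comp rfl]
      apply mappingCone.ext_from f (i + 1) i rfl
      · simp only [Preadditive.comp_add, Preadditive.add_comp, Category.assoc,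
              mappingCone.inl_v_fst_v_assoc, mappingCone.inl_v_snd_v_assoc, Limits.zero_comp,
              add_zero]
        -- The differential of the cone on the first summand yields the blocks `F` and `-D` of the
        -- first row of `coneMatrix`.
        rw [mappingCone.inl_v_d_assoc f (i + 1) i (i + 1 + 1) (by ring) (by ring),
          mappingCone.inl_v_d_assoc f (i + 1) i (i + 1 + 1) (by ring) (by ring),
          matComplexComp_comp isGraded_coneInl _ (by ring)]
        simp only [Preadditive.sub_comp, Category.assoc,
          mappingCone.inr_f_fst_v_assoc, mappingCone.inr_f_snd_v_assoc,
              mappingCone.inl_v_fst_v_assoc, mappingCone.inl_v_snd_v_assoc, Limits.zero_comp,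
              Limits.comp_zero, sub_zero, zero_sub]
        rw [hf, matComplex_d_eq_comp rfl, matComplexComp_comp hF _ (by ring),
          matComplexComp_comp hD _ (by ring), ← matComplexComp_neg, ← matComplexComp_add,
          fromCols_mul_coneMatrix]
        congr 1
        rw [Matrix.mul_fromCols, Matrix.mul_fromCols]
        ext p (q | q) <;>
          simp [hF.mul_id, hF.id_mul, hD.mul_id, hD.id_mul]
      · simp only [Preadditive.comp_add, Preadditive.add_comp, Category.assoc,
              mappingCone.inr_f_fst_v_assoc, mappingCone.inr_f_snd_v_assoc, Limits.zero_comp,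
              zero_add]
        rw [mappingCone.inr_f_d_assoc, mappingCone.inr_f_d_assoc,
          matComplexComp_comp isGraded_coneInr _ (by ring), matComplex_d_eq_comp rfl]
        simp only [mappingCone.inr_f_fst_v_assoc, mappingCone.inr_f_snd_v_assoc, Limits.zero_comp,
              Limits.comp_zero, zero_add]
        rw [matComplexComp_comp hD' _ (by ring), fromCols_mul_coneMatrix]
        congr 1
        rw [Matrix.mul_fromCols]
        ext p (q | q) <;>
          simp [hD'.mul_id, hD'.id_mul])

end

end MatrixCones

end

end Gentle

namespace Gentle

/-! ### Cyclic chains and surgery on them -/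

section Lists

variable {α : Type*} {R : α → α → Prop}

/-- Links the indexed border condition of a closed word with `Cycle.Chain`, which is invariant under
rotation. -/
lemma cycle_chain_iff_next {L : List α} (hL : L ≠ []) :
    Cycle.Chain R (L : Cycle α) ↔ ∀ i : Fin L.length, R (L.get i) (L.get (next i)) := by
  obtain ⟨a, l, rfl⟩ := List.exists_cons_of_ne_nil hL
  rw [Cycle.chain_coe_cons, ← List.cons_append, List.isChain_iff_getElem]
  have key : ∀ i : Fin (a :: l).length,
      ((a :: l) ++ [a])[i.1 + 1]'(by have := i.2; simp at this ⊢; omega) =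
        (a :: l).get (next i) := by
    rintro ⟨i, hi⟩
    simp only [List.length_cons] at hi
    rcases Nat.lt_or_ge (i + 1) (l.length + 1) with h | h
    · have h1 : (next ⟨i, hi⟩ : Fin (a :: l).length) = ⟨i + 1, h⟩ :=
        Fin.ext (Nat.mod_eq_of_lt h)
      rw [List.getElem_append_left h, h1]
      rfl
    · have h0 : i = l.length := by omega
      subst h0
      have h1 : (next ⟨l.length, hi⟩ : Fin (a :: l).length) = ⟨0, by simp⟩ :=
        Fin.ext (Nat.mod_self _)
      rw [List.getElem_append_right h, h1]
      simp
  constructor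
  · intro h i
    have := h i.1 (by have := i.2; simp at this ⊢; omega)
    rw [List.getElem_append_left i.2, key i] at this
    exact this
  · intro h i hi
    have hi' : i < (a :: l).length := by simpa using hi
    rw [List.getElem_append_left hi', key ⟨i, hi'⟩]
    exact h ⟨i, hi'⟩

/-- A cycle cut at two of its entries falls into two arcs that share these entries. With the cuts at
the letters beside the overlap, the arc through the overlap can be exchanged for an arc of the other
word. -/
lemma cycle_chain_split {β M γ : List α} {a b : α} :
    Cycle.Chain R ((β ++ [a] ++ M ++ [b] ++ γ : List α) : Cycle α) ↔
      List.IsChain R (b :: (γ ++ β ++ [a])) ∧ List.IsChain R (a :: (M ++ [b])) := by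
  have h : ((β ++ [a] ++ M ++ [b] ++ γ : List α) : Cycle α) =
      ((b :: (γ ++ β ++ a :: M) : List α) : Cycle α) := by
    rw [Cycle.coe_eq_coe]
    have := List.isRotated_append (l := β ++ [a] ++ M) (l' := [b] ++ γ)
    simpa using this
  rw [h, Cycle.chain_coe_cons]
  have h2 : b :: (γ ++ β ++ a :: M ++ [b]) = (b :: (γ ++ β)) ++ a :: (M ++ [b]) := by simp
  rw [h2, List.isChain_split]
  simp

/-- If `M` is empty the two ends are neighbours, so the hypotheses allow an arbitrary `z` and are
applied one after the other. -/
lemma isChain_replace_ends {a a' b b' : α} {M : List α} (h : List.IsChain R (a :: (M ++ [b])))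
    (ha : ∀ z, R a z → R a' z) (hb : ∀ z, R z b → R z b') :
    List.IsChain R (a' :: (M ++ [b'])) := by
  cases M with
  | nil =>
    simp only [List.nil_append, List.isChain_pair] at h ⊢
    exact ha _ (hb _ h)
  | cons c M =>
    rw [List.cons_append, List.isChain_cons_cons] at h ⊢
    refine ⟨ha _ h.1, ?_⟩
    have h2 := h.2
    rw [← List.cons_append, List.isChain_append] at h2 ⊢
    refine ⟨h2.1, List.isChain_singleton _, ?_⟩
    intro x hx y hy
    obtain rfl : b' = y := by simpa using hy
    exact hb _ (h2.2.2 x hx b (by simp))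

end Lists

/-! ### Homotopy letters, borders, and the merged letter at an end of the overlap -/

section Walks

variable {V : Type v} {E : Type w}

open FreeGroup (invRev)

lemma dirWalk_append (p q : List E) : dirWalk (p ++ q) = dirWalk p ++ dirWalk q := by
  simp [dirWalk]

lemma invWalk_append (p q : List E) : invWalk (p ++ q) = invWalk q ++ invWalk p := by
  simp [invWalk_eq]

lemma invRev_dirWalk (p : List E) : invRev (dirWalk p) = invWalk p := rfl

lemma invRev_invWalk (p : List E) : invRev (invWalk p) = dirWalk p :=
  FreeGroup.invRev_invRev

lemma head?_invRev (l : List (E × Bool)) :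
    (invRev l).head? = l.getLast?.map fun x => (x.1, !x.2) := by
  simp [FreeGroup.invRev, List.head?_reverse]

lemma getLast?_invRev (l : List (E × Bool)) :
    (invRev l).getLast? = l.head?.map fun x => (x.1, !x.2) := by
  simp [FreeGroup.invRev, List.getLast?_reverse]

lemma head?_dirWalk (p : List E) : (dirWalk p).head? = p.head?.map fun a => (a, true) := by
  simp [dirWalk]

lemma getLast?_dirWalk (p : List E) :
    (dirWalk p).getLast? = p.getLast?.map fun a => (a, true) := by
  simp [dirWalk]

lemma head?_invWalk (p : List E) : (invWalk p).head? = p.getLast?.map fun a => (a, false) := by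
  simp [invWalk_eq, List.head?_reverse]

lemma getLast?_invWalk (p : List E) :
    (invWalk p).getLast? = p.head?.map fun a => (a, false) := by
  simp [invWalk_eq, List.getLast?_reverse]

@[simp] lemma isDirect_dirWalk (p : List E) : isDirect (dirWalk p) = true := by
  simp [isDirect, dirWalk]

lemma isDirect_invWalk {p : List E} (hp : p ≠ []) : isDirect (invWalk p) = false := by
  obtain ⟨a, l, rfl⟩ := List.exists_cons_of_ne_nil hp
  simp [isDirect, invWalk_eq]

@[simp] lemma pathOf_dirWalk (p : List E) : pathOf (dirWalk p) = p := by
  rw [pathOf, if_pos (isDirect_dirWalk p)]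
  simp [dirWalk, Function.comp_def]

lemma pathOf_invWalk {p : List E} (hp : p ≠ []) : pathOf (invWalk p) = p := by
  rw [pathOf, if_neg (by simp [isDirect_invWalk hp])]
  simp [invWalk_eq, Function.comp_def]

@[simp] lemma sgn_dirWalk (p : List E) : sgn (dirWalk p) = 1 := by simp [sgn]

lemma sgn_invWalk {p : List E} (hp : p ≠ []) : sgn (invWalk p) = -1 := by
  simp [sgn, isDirect_invWalk hp]

lemma isReduced_dirWalk (p : List E) : FreeGroup.IsReduced (dirWalk p) := by
  rw [FreeGroup.IsReduced, dirWalk, List.isChain_map]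
  exact List.Pairwise.isChain (by simp [List.pairwise_iff_getElem])

lemma isReduced_invWalk (p : List E) : FreeGroup.IsReduced (invWalk p) := by
  rw [FreeGroup.IsReduced, invWalk_eq, List.isChain_map]
  exact List.Pairwise.isChain (by simp [List.pairwise_iff_getElem])

/-- Reduced words represent elements of the free group uniquely. The merged letters are thus found
by a computation in the group. -/
lemma reduce_eq_of_mk_eq [DecidableEq E] {L L' : List (E × Bool)}
    (h : FreeGroup.mk L = FreeGroup.mk L') (h' : FreeGroup.IsReduced L') :
    FreeGroup.reduce L = L' := by
  rw [← FreeGroup.toWord_mk, h, FreeGroup.toWord_mk, h'.reduce_eq]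

lemma mk_append (L L' : List (E × Bool)) :
    FreeGroup.mk (L ++ L') = FreeGroup.mk L * FreeGroup.mk L' := FreeGroup.mul_mk.symm

lemma mk_invRev (L : List (E × Bool)) : FreeGroup.mk (invRev L) = (FreeGroup.mk L)⁻¹ :=
  FreeGroup.inv_mk.symm

lemma mk_invWalk (p : List E) : FreeGroup.mk (invWalk p) = (FreeGroup.mk (dirWalk p))⁻¹ :=
  mk_invRev _

lemma reduce_lg1 [DecidableEq E] (p f : List E) :
    FreeGroup.reduce (dirWalk (f ++ p) ++ invRev (dirWalk p)) = dirWalk f := by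
  refine reduce_eq_of_mk_eq ?_ (isReduced_dirWalk f)
  simp [mk_append, mk_invRev, dirWalk_append, -FreeGroup.mul_mk, -FreeGroup.inv_mk]

lemma reduce_lg2 [DecidableEq E] (p f : List E) :
    FreeGroup.reduce (invWalk p ++ invRev (invWalk (p ++ f))) = dirWalk f := by
  refine reduce_eq_of_mk_eq ?_ (isReduced_dirWalk f)
  simp [mk_append, mk_invRev, invWalk_append, mk_invWalk, -FreeGroup.mul_mk, -FreeGroup.inv_mk]

lemma reduce_lg3 [DecidableEq E] (p q : List E) :
    FreeGroup.reduce (invWalk p ++ invRev (dirWalk q)) = invWalk (q ++ p) := by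
  refine reduce_eq_of_mk_eq ?_ (isReduced_invWalk _)
  simp [mk_append, mk_invRev, invWalk_append, mk_invWalk, -FreeGroup.mul_mk, -FreeGroup.inv_mk]

/-- Inversion of words exchanges the two ends of an overlap, so that statements are only needed for
left ends. The path in the square stays the same. -/
lemma RightEnd.inv {a b : List (E × Bool)} {f : List E} (h : RightEnd a b f) :
    LeftEnd (invRev a) (invRev b) f := by
  cases h with
  | rg1 p f hp hf => exact LeftEnd.lg2 p _ hp hf
  | rg2 p f hp hf =>
    rw [invRev_invWalk, invRev_invWalk]
    exact LeftEnd.lg1 p _ hp hf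
  | rg3 p q hp hq =>
    rw [invRev_dirWalk, invRev_invWalk]
    exact LeftEnd.lg3 p q hp hq

/-- Under the first two endpoint conditions both letters contain the nonempty path `p` next to the
overlap. They therefore have the same neighbours across that border. -/
lemma LeftEnd.head?_eq {a b : List (E × Bool)} {f : List E} (h : LeftEnd a b f) (hf : f ≠ []) :
    a.getLast? = b.getLast? := by
  cases h with
  | lg1 p f hp hf =>
    rw [getLast?_dirWalk, getLast?_dirWalk, List.getLast?_append_of_ne_nil _ hp]
  | lg2 p f hp hf =>
    rw [getLast?_invWalk, getLast?_invWalk, List.head?_append_of_ne_nil _ hp]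
  | lg3 p q hp hq => exact (hf rfl).elim

lemma RightEnd.head?_eq {a b : List (E × Bool)} {f : List E} (h : RightEnd a b f) (hf : f ≠ []) :
    a.head? = b.head? := by
  have := h.inv.head?_eq hf
  rw [getLast?_invRev, getLast?_invRev] at this
  exact Option.map_injective (fun x y hxy => by
    simpa [Prod.ext_iff] using hxy) this

namespace BoundQuiver

variable (Q : BoundQuiver V E)

lemma lend_inv (x : E × Bool) : Q.lend (x.1, !x.2) = Q.rend x := by
  rcases x with ⟨x, _ | _⟩ <;> rfl

lemma rend_inv (x : E × Bool) : Q.rend (x.1, !x.2) = Q.lend x := by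
  rcases x with ⟨x, _ | _⟩ <;> rfl

variable {Q}

lemma Border.inv {x y : E × Bool} (h : Q.Border x y) :
    Q.Border (y.1, !y.2) (x.1, !x.2) := by
  rcases x with ⟨x, s⟩
  rcases y with ⟨y, t⟩
  refine ⟨by rw [lend_inv, rend_inv]; exact h.1.symm, ?_⟩
  have h2 := h.2
  cases s <;> cases t <;> simp_all [eq_comm]

/-- A walk may turn from the end of `a` into the inverse of `b` if it may continue to `a'`, where
`b a'` is a path. -/
lemma IsGentle.border_direct (hQ : Q.IsGentle) {z : E × Bool} {a b : E}
    (h : Q.Border z (a, true)) (h1 : Q.src b = Q.tgt a) (h2 : ¬ Q.rel b a) :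
    Q.Border z (b, false) := by
  rcases z with ⟨z, s⟩
  obtain ⟨h3, h4⟩ := h
  refine ⟨by rw [h3]; exact h1.symm, ?_⟩
  cases s
  · right; left
    refine ⟨rfl, rfl, ?_⟩
    -- If `b z` were nonzero, `z` and `a` would both precede `b` without a relation and would
    -- coincide; the border `z⁻¹ | a` excludes this.
    by_contra h5
    have h6 : z ≠ a := by simpa using h4
    exact h6 (hQ.right_unique b z a (h1.trans (by simpa [lend, rend] using h3.symm)) h5 h1 h2)
  · right; right
    have h6 : Q.rel z a := by simpa using h4
    exact ⟨by simp, fun h7 => h2 ((show z = b from h7) ▸ h6)⟩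

/-- The mirror image of `border_direct`: a direct `z` with `z b` nonzero would coincide with `a` by
uniqueness of nonzero continuations of `b`, and an inverse `z` meets `a` in a relation whereas `b`
does not. -/
lemma IsGentle.border_inverse (hQ : Q.IsGentle) {z : E × Bool} {a b : E}
    (h : Q.Border z (a, false)) (h1 : Q.src a = Q.tgt b) (h2 : ¬ Q.rel a b) :
    Q.Border z (b, true) := by
  rcases z with ⟨z, s⟩
  obtain ⟨h3, h4⟩ := h
  refine ⟨by rw [h3]; exact h1, ?_⟩
  cases s
  · right; right
    have h6 : Q.rel a z := by simpa using h4
    exact ⟨by simp, fun h7 => h2 ((show z = b from h7) ▸ h6)⟩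
  · left
    refine ⟨rfl, rfl, ?_⟩
    by_contra h5
    have h6 : z ≠ a := by simpa using h4
    exact h6 (hQ.left_unique b z a ((by simpa [lend, rend] using h3 : Q.src z = Q.src a).trans h1)
      h5 h1 h2)

/-- An inverse and a direct arrow with a common continuation across a border compose. -/
lemma IsGentle.compose_of_border (hQ : Q.IsGentle) {r : E × Bool} {a b : E}
    (h1 : Q.Border (a, false) r) (h2 : Q.Border (b, true) r) :
    Q.src b = Q.tgt a ∧ ¬ Q.rel b a := by
  rcases r with ⟨r, s⟩
  refine ⟨by simpa [rend] using h2.1.trans h1.1.symm, fun h => ?_⟩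
  -- If `b a` were a relation, then `r` would be a second arrow in relation with `a`, or with `b`.
  -- Uniqueness of relations gives `b = r` or `a = r`, which is a cancellation at one of the
  -- borders.
  cases s
  · have h3 : Q.rel r a := by simpa using h1.2
    have h4 : b ≠ r := by simpa using h2.2
    exact h4 (hQ.left_rel_unique a b r h h3)
  · have h3 : a ≠ r := by simpa using h1.2
    have h4 : Q.rel b r := by simpa using h2.2
    exact h3 (hQ.right_rel_unique b a r h h4)

variable (Q) in
/-- Two homotopy letters may be consecutive letters of a walk. -/
def LetterBorder (l l' : List (E × Bool)) : Prop :=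
  ∀ x ∈ l.getLast?, ∀ y ∈ l'.head?, Q.Border x y

variable (Q) in
/-- The left end of a walk. -/
def StartsAt (l : List (E × Bool)) (x : V) : Prop := ∀ y ∈ l.head?, Q.lend y = x

variable (Q) in
/-- The right end of a walk. -/
def EndsAt (l : List (E × Bool)) (x : V) : Prop := ∀ y ∈ l.getLast?, Q.rend y = x

lemma LetterBorder.inv {l l' : List (E × Bool)} (h : Q.LetterBorder l l') :
    Q.LetterBorder (invRev l') (invRev l) := by
  intro x hx y hy
  rw [getLast?_invRev] at hx
  rw [head?_invRev] at hy
  obtain ⟨x', hx', rfl⟩ := Option.map_eq_some_iff.1 hx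
  obtain ⟨y', hy', rfl⟩ := Option.map_eq_some_iff.1 hy
  exact (h y' hy' x' hx').inv

lemma StartsAt.inv {l : List (E × Bool)} {x : V} (h : Q.StartsAt l x) :
    Q.EndsAt (invRev l) x := by
  intro y hy
  rw [getLast?_invRev] at hy
  obtain ⟨y', hy', rfl⟩ := Option.map_eq_some_iff.1 hy
  rw [rend_inv]
  exact h y' hy'

lemma EndsAt.inv {l : List (E × Bool)} {x : V} (h : Q.EndsAt l x) :
    Q.StartsAt (invRev l) x := by
  intro y hy
  rw [head?_invRev] at hy
  obtain ⟨y', hy', rfl⟩ := Option.map_eq_some_iff.1 hy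
  rw [lend_inv]
  exact h y' hy'

lemma IsLetter.inv {l : List (E × Bool)} (h : Q.IsLetter l) : Q.IsLetter (invRev l) := by
  obtain ⟨p, hp, rfl | rfl⟩ := h
  · exact ⟨p, hp, Or.inr rfl⟩
  · exact ⟨p, hp, Or.inl (invRev_invWalk p)⟩

lemma IsLetter.isPath {l : List (E × Bool)} (h : Q.IsLetter l) : Q.IsPath (pathOf l) := by
  obtain ⟨p, hp, rfl | rfl⟩ := h
  · rwa [pathOf_dirWalk]
  · rwa [pathOf_invWalk hp.1]

lemma IsLetter.isDirect_invRev {l : List (E × Bool)} (h : Q.IsLetter l) :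
    isDirect (invRev l) = !isDirect l := by
  obtain ⟨p, hp, rfl | rfl⟩ := h
  · rw [invRev_dirWalk, isDirect_invWalk hp.1, isDirect_dirWalk]; rfl
  · rw [invRev_invWalk, isDirect_invWalk hp.1, isDirect_dirWalk]; rfl

lemma IsLetter.sgn_invRev {l : List (E × Bool)} (h : Q.IsLetter l) :
    sgn (invRev l) = -sgn l := by
  rw [sgn, h.isDirect_invRev, sgn]
  cases isDirect l <;> simp

lemma IsLetter.pathOf_invRev {l : List (E × Bool)} (h : Q.IsLetter l) :
    pathOf (invRev l) = pathOf l := by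
  obtain ⟨p, hp, rfl | rfl⟩ := h
  · rw [invRev_dirWalk, pathOf_invWalk hp.1, pathOf_dirWalk]
  · rw [invRev_invWalk, pathOf_invWalk hp.1, pathOf_dirWalk]

lemma isPath_append {p q : List E} (hp : p ≠ []) (hq : q ≠ []) :
    Q.IsPath (p ++ q) ↔ Q.IsPath p ∧ Q.IsPath q ∧
      ∀ b ∈ p.getLast?, ∀ a ∈ q.head?, Q.src b = Q.tgt a ∧ ¬ Q.rel b a := by
  simp [IsPath, List.isChain_append, hp, hq]

lemma isLetter_dirWalk {p : List E} : Q.IsLetter (dirWalk p) ↔ Q.IsPath p :=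
  ⟨fun h => by simpa using h.isPath, fun h => ⟨p, h, Or.inl rfl⟩⟩

lemma isLetter_invWalk {p : List E} : Q.IsLetter (invWalk p) ↔ Q.IsPath p :=
  ⟨fun h => isLetter_dirWalk.1 (invRev_invWalk p ▸ h.inv), fun h => ⟨p, h, Or.inr rfl⟩⟩

end BoundQuiver

section

variable {Q : BoundQuiver V E} {a b : List (E × Bool)} {f : List E}

open BoundQuiver

/-- The combinatorial properties of the letter `a b⁻¹` at the left end of an overlap. -/
structure MergedLetter (Q : BoundQuiver V E) (a b l : List (E × Bool)) : Prop where
  isLetter : Q.IsLetter l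
  border_left : ∀ z, Q.LetterBorder z a → Q.LetterBorder z l
  border_right : ∀ z, Q.LetterBorder (invRev b) z → Q.LetterBorder l z
  startsAt : ∀ x, Q.StartsAt a x → Q.StartsAt l x
  endsAt : ∀ x, Q.StartsAt b x → Q.EndsAt l x
  -- The summand 1 is the degree of the jump from the copy of the overlap in the first word, which
  -- is lowered in the cone, to the copy in the second word.
  sgn_eq : sgn l = 1 + sgn a - sgn b

/-- Under the first two conditions the common path `p` cancels and the direct letter `f` remains. On
one side it shows the same outer arrow as before; on the other side its outer arrow composes with an
arrow of `p`, and gentleness carries the border over. Under the third condition nothing cancels,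
both outer arrows persist, and only the composability `hab` is needed. -/
lemma LeftEnd.mergedLetter [DecidableEq E] (hQ : Q.IsGentle) (h : LeftEnd a b f) (ha : Q.IsLetter a)
    (hb : Q.IsLetter b) (hab : f = [] → Q.IsPath (pathOf b ++ pathOf a)) :
    MergedLetter Q a b (FreeGroup.reduce (a ++ invRev b)) := by
  cases h with
  | lg1 p f hp hf =>
    rw [reduce_lg1]
    rw [isLetter_dirWalk, isPath_append hf hp] at ha
    obtain ⟨hf', hp', hj⟩ := ha
    have hh : (dirWalk f).head? = (dirWalk (f ++ p)).head? := by
      rw [head?_dirWalk, head?_dirWalk, List.head?_append_of_ne_nil _ hf]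
    obtain ⟨y, hy⟩ := Option.isSome_iff_exists.1 (List.isSome_head?.2 hp)
    refine ⟨isLetter_dirWalk.2 hf', ?_, ?_, ?_, ?_, by simp⟩
    · intro z hz
      rwa [LetterBorder, hh]
    · intro z hz x hx r hr
      rw [getLast?_dirWalk] at hx
      obtain ⟨x, hx', rfl⟩ := Option.map_eq_some_iff.1 hx
      have h1 := hz (y, false) (by rw [invRev_dirWalk, getLast?_invWalk, hy]; rfl) r hr
      obtain ⟨h2, h3⟩ := hj x hx' y hy
      simpa using (hQ.border_direct h1.inv h2 h3).inv
    · intro x hx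
      rwa [StartsAt, hh]
    · intro v hv x hx
      rw [getLast?_dirWalk] at hx
      obtain ⟨x, hx', rfl⟩ := Option.map_eq_some_iff.1 hx
      rw [← hv (y, true) (by rw [head?_dirWalk, hy]; rfl)]
      exact (hj x hx' y hy).1
  | lg2 p f hp hf =>
    rw [reduce_lg2]
    rw [isLetter_invWalk, isPath_append hp hf] at hb
    obtain ⟨hp', hf', hj⟩ := hb
    have hh : (dirWalk f).getLast? = (invRev (invWalk (p ++ f))).getLast? := by
      rw [invRev_invWalk, getLast?_dirWalk, getLast?_dirWalk, List.getLast?_append_of_ne_nil _ hf]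
    obtain ⟨y, hy⟩ := Option.isSome_iff_exists.1 (List.getLast?_isSome.2 hp)
    refine ⟨isLetter_dirWalk.2 hf', ?_, ?_, ?_, ?_, ?_⟩
    · intro z hz r hr x hx
      rw [head?_dirWalk] at hx
      obtain ⟨x, hx', rfl⟩ := Option.map_eq_some_iff.1 hx
      have h1 := hz r hr (y, false) (by rw [head?_invWalk, hy]; rfl)
      obtain ⟨h2, h3⟩ := hj y hy x hx'
      exact hQ.border_inverse h1 h2 h3
    · intro z hz
      rwa [LetterBorder, hh]
    · intro v hv x hx
      rw [head?_dirWalk] at hx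
      obtain ⟨x, hx', rfl⟩ := Option.map_eq_some_iff.1 hx
      rw [← hv (y, false) (by rw [head?_invWalk, hy]; rfl)]
      exact (hj y hy x hx').1.symm
    · intro x hx
      rw [EndsAt, hh]
      exact hx.inv
    · rw [sgn_invWalk hp, sgn_invWalk (by simp [hp]), sgn_dirWalk]; norm_num
  | lg3 p q hp hq =>
    rw [reduce_lg3]
    have hpath := hab rfl
    rw [pathOf_dirWalk, pathOf_invWalk hp] at hpath
    have hh : (invWalk (q ++ p)).head? = (invWalk p).head? := by
      rw [head?_invWalk, head?_invWalk, List.getLast?_append_of_ne_nil _ hp]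
    have hl : (invWalk (q ++ p)).getLast? = (invRev (dirWalk q)).getLast? := by
      rw [invRev_dirWalk, getLast?_invWalk, getLast?_invWalk, List.head?_append_of_ne_nil _ hq]
    refine ⟨isLetter_invWalk.2 hpath, ?_, ?_, ?_, ?_, ?_⟩
    · intro z hz
      rwa [LetterBorder, hh]
    · intro z hz
      rwa [LetterBorder, hl]
    · intro x hx
      rwa [StartsAt, hh]
    · intro x hx
      rw [EndsAt, hl]
      exact hx.inv
    · rw [sgn_invWalk hp, sgn_invWalk (by simp [hp]), sgn_dirWalk]; norm_num

/-- Two letters of opposite directions that border the same walk compose through the common vertex,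
by `compose_of_border`. This is why compatibility has to be assumed only in the absence of a common
neighbour. -/
lemma LeftEnd.isPath_of_border (hQ : Q.IsGentle) (h : LeftEnd a b f) (hf : f = [])
    (ha : Q.IsLetter a) (hb : Q.IsLetter b) {z : List (E × Bool)} (hz : z ≠ [])
    (h1 : Q.LetterBorder a z) (h2 : Q.LetterBorder b z) :
    Q.IsPath (pathOf b ++ pathOf a) := by
  cases h with
  | lg1 p f hp hf' => exact (hf' hf).elim
  | lg2 p f hp hf' => exact (hf' hf).elim
  | lg3 p q hp hq =>
    rw [pathOf_dirWalk, pathOf_invWalk hp, isPath_append hq hp]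
    refine ⟨isLetter_dirWalk.1 hb, isLetter_invWalk.1 ha, ?_⟩
    intro y hy x hx
    obtain ⟨r, hr⟩ := Option.isSome_iff_exists.1 (List.isSome_head?.2 hz)
    exact hQ.compose_of_border (h1 (x, false) (by rw [getLast?_invWalk, hx]; rfl) r hr)
      (h2 (y, true) (by rw [getLast?_dirWalk, hy]; rfl) r hr)

/-- Brings the merged letter of the right end, once inverted, into the form of a left end. -/
lemma reduce_invRev_append [DecidableEq E] (a b : List (E × Bool)) :
    FreeGroup.reduce (invRev b ++ a) =
      invRev (FreeGroup.reduce (invRev a ++ invRev (invRev b))) := by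
  rw [← FreeGroup.reduce_invRev, FreeGroup.invRev_append, FreeGroup.invRev_invRev,
    FreeGroup.invRev_invRev]

end

end Walks

end Gentle

namespace Gentle

/-! ### The closed homotopy word of the cone -/

section ConeWord

variable {V : Type v} {E : Type w} {Q : BoundQuiver V E}

open FreeGroup (invRev)
open BoundQuiver

lemma sum_map_sgn (L : List (List (E × Bool))) :
    (L.map sgn).sum = L.countP (fun l => isDirect l) - L.countP (fun l => !isDirect l) := by
  induction L with
  | nil => simp
  | cons l L ih =>
    rw [List.map_cons, List.sum_cons, ih, List.countP_cons, List.countP_cons, sgn]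
    cases isDirect l <;> simp <;> ring

/-- In this form balance is additive in the letters, and it says that the degree returns to its
initial value after one turn. -/
lemma countP_eq_iff_sum_sgn (L : List (List (E × Bool))) :
    L.countP (fun l => isDirect l) = L.countP (fun l => !isDirect l) ↔ (L.map sgn).sum = 0 := by
  rw [sum_map_sgn]
  omega

lemma sum_map_sgn_invWord {L : List (List (E × Bool))} (hL : ∀ l ∈ L, Q.IsLetter l) :
    ((invWord L).map sgn).sum = -(L.map sgn).sum := by
  induction L with
  | nil => simp [invWord]
  | cons l L ih =>
    have h1 : invWord (l :: L) = invWord L ++ [invRev l] := by simp [invWord]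
    rw [h1, List.map_append, List.sum_append, ih fun x hx => hL x (by simp [hx])]
    simp [(hL l (by simp)).sgn_invRev]

lemma isChain_invWord {L : List (List (E × Bool))} (h : L.IsChain Q.LetterBorder) :
    (invWord L).IsChain Q.LetterBorder := by
  rw [invWord, List.isChain_reverse, List.isChain_map]
  exact h.imp fun _ _ h => h.inv

namespace ClosedWord

variable (s : ClosedWord Q)

lemma cycle_chain : Cycle.Chain Q.LetterBorder (s.letters : Cycle (List (E × Bool))) :=
  (cycle_chain_iff_next s.ne_nil).2 s.border

lemma sum_sgn : (s.letters.map sgn).sum = 0 := (countP_eq_iff_sum_sgn _).1 s.balanced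

/-- The differential of the first word enters the cone with a minus sign on each letter; an even
number of letters makes the total sign trivial. -/
lemma even_length : Even s.letters.length := by
  refine ⟨s.letters.countP (fun l => isDirect l), ?_⟩
  conv_rhs => rw [s.balanced]
  rw [List.length_eq_countP_add_countP (fun l => isDirect l)]
  rw [s.balanced]
  congr 2
  ext l
  simp

lemma startsAt (i : s.Idx) : Q.StartsAt (s.letters.get i) (s.vert i) :=
  fun _ hx => (vert_eq s i hx).symm

lemma endsAt (i : s.Idx) : Q.EndsAt (s.letters.get i) (s.vert (next i)) := by
  intro x hx
  have hne := (s.isLetter _ (List.get_mem s.letters (next i))).ne_nil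
  obtain ⟨y, hy⟩ := Option.isSome_iff_exists.1 (List.isSome_head?.2 hne)
  rw [vert_eq s _ hy]
  exact (s.border i x hx y hy).1

end ClosedWord

namespace Overlap

variable {s t : ClosedWord Q} (O : Overlap s t)

lemma isLetter_left {l : List (E × Bool)} (h : l ∈ O.β ++ [O.σL] ++ O.ρ ++ [O.σR] ++ O.α) :
    Q.IsLetter l := s.isLetter l (O.word_left ▸ h)

lemma isLetter_right {l : List (E × Bool)} (h : l ∈ O.δ ++ [O.τL] ++ O.ρ ++ [O.τR] ++ O.γ) :
    Q.IsLetter l := t.isLetter l (O.word_right ▸ h)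

lemma chain_left : List.IsChain Q.LetterBorder (O.σR :: (O.α ++ O.β ++ [O.σL])) ∧
    List.IsChain Q.LetterBorder (O.σL :: (O.ρ ++ [O.σR])) :=
  cycle_chain_split.1 (O.word_left ▸ s.cycle_chain)

lemma chain_right : List.IsChain Q.LetterBorder (O.τR :: (O.γ ++ O.δ ++ [O.τL])) ∧
    List.IsChain Q.LetterBorder (O.τL :: (O.ρ ++ [O.τR])) :=
  cycle_chain_split.1 (O.word_right ▸ t.cycle_chain)

/-- The common neighbour of $\sigma_L$ and $\tau_L$ is the first letter of $\rho$. If $\rho$ is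
trivial and $f_R$ exists, it is the first signed arrow shared by $\sigma_R$ and $\tau_R$. In the
remaining case the composite is a path by compatibility. -/
lemma isPath_left (hQ : Q.IsGentle) (hO : O.Compatible) (hf : O.fL = []) :
    Q.IsPath (pathOf O.τL ++ pathOf O.σL) := by
  have h1 := O.chain_left.2
  have h2 := O.chain_right.2
  have ha : Q.IsLetter O.σL := O.isLetter_left (by simp)
  have hb : Q.IsLetter O.τL := O.isLetter_right (by simp)
  have hR : Q.IsLetter O.σR := O.isLetter_left (by simp)
  rcases hρ : O.ρ with _ | ⟨z, ρ⟩
  · rw [hρ, List.nil_append, List.isChain_pair] at h1 h2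
    by_cases hfR : O.fR = []
    · exact (hO hρ hf hfR).1
    · refine O.leftEnd.isPath_of_border hQ hf ha hb hR.ne_nil h1 ?_
      rwa [LetterBorder, O.rightEnd.head?_eq hfR]
  · rw [hρ, List.cons_append, List.isChain_cons_cons] at h1 h2
    have hz : Q.IsLetter z := O.isLetter_left (by simp [hρ])
    exact O.leftEnd.isPath_of_border hQ hf ha hb hz.ne_nil h1.1 h2.1

lemma isPath_right (hQ : Q.IsGentle) (hO : O.Compatible) (hf : O.fR = []) :
    Q.IsPath (pathOf O.τR ++ pathOf O.σR) := by
  have h1 := O.chain_left.2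
  have h2 := O.chain_right.2
  have ha : Q.IsLetter O.σR := O.isLetter_left (by simp)
  have hb : Q.IsLetter O.τR := O.isLetter_right (by simp)
  have hL : Q.IsLetter O.σL := O.isLetter_left (by simp)
  have key : ∀ z, Q.IsLetter z → Q.LetterBorder z O.σR → Q.LetterBorder z O.τR →
      Q.IsPath (pathOf O.τR ++ pathOf O.σR) := by
    intro z hz h3 h4
    rw [← ha.pathOf_invRev, ← hb.pathOf_invRev]
    exact O.rightEnd.inv.isPath_of_border hQ hf ha.inv hb.inv hz.inv.ne_nil h3.inv h4.inv
  rcases List.eq_nil_or_concat O.ρ with hρ | ⟨ρ, z, hρ⟩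
  · rw [hρ, List.nil_append, List.isChain_pair] at h1 h2
    by_cases hfL : O.fL = []
    · exact (hO hρ hfL hf).2
    · refine key O.σL hL h1 ?_
      rwa [LetterBorder, O.leftEnd.head?_eq hfL]
  · have e : ∀ x y : List (E × Bool), x :: (O.ρ ++ [y]) = (x :: ρ) ++ z :: ([] ++ [y]) := by
      simp [hρ]
    rw [e, List.isChain_split] at h1 h2
    have hz : Q.IsLetter z := O.isLetter_left (by simp [hρ])
    exact key z hz (List.isChain_pair.1 h1.2) (List.isChain_pair.1 h2.2)

variable [DecidableEq E]

/-- The letter `σL τL⁻¹` of the cone. -/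
def letterL : List (E × Bool) := FreeGroup.reduce (O.σL ++ invRev O.τL)

/-- The letter `τR⁻¹ σR` of the cone. -/
def letterR : List (E × Bool) := FreeGroup.reduce (invRev O.τR ++ O.σR)

lemma mergedLetter_left (hQ : Q.IsGentle) (hO : O.Compatible) :
    MergedLetter Q O.σL O.τL O.letterL :=
  O.leftEnd.mergedLetter hQ (O.isLetter_left (by simp)) (O.isLetter_right (by simp))
    (O.isPath_left hQ hO)

lemma invRev_letterR :
    invRev O.letterR = FreeGroup.reduce (invRev O.σR ++ invRev (invRev O.τR)) := by
  rw [letterR, reduce_invRev_append, FreeGroup.invRev_invRev]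

lemma mergedLetter_right (hQ : Q.IsGentle) (hO : O.Compatible) :
    MergedLetter Q (invRev O.σR) (invRev O.τR) (invRev O.letterR) := by
  have ha : Q.IsLetter O.σR := O.isLetter_left (by simp)
  have hb : Q.IsLetter O.τR := O.isLetter_right (by simp)
  rw [invRev_letterR]
  refine O.rightEnd.inv.mergedLetter hQ ha.inv hb.inv fun hf => ?_
  rw [ha.pathOf_invRev, hb.pathOf_invRev]
  exact O.isPath_right hQ hO hf

lemma isLetter_letterR (hQ : Q.IsGentle) (hO : O.Compatible) : Q.IsLetter O.letterR := by
  have := (O.mergedLetter_right hQ hO).isLetter.inv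
  rwa [FreeGroup.invRev_invRev] at this

lemma coneLetters_eq : O.coneLetters =
    O.β ++ [O.letterL] ++ (invWord O.δ ++ invWord O.γ) ++ [O.letterR] ++ O.α := by
  simp [coneLetters, letterL, letterR]

/-- The closed homotopy word of the cone. -/
def coneWord (hQ : Q.IsGentle) (hO : O.Compatible) : ClosedWord Q where
  letters := O.coneLetters
  ne_nil := by simp [coneLetters]
  isLetter := by
    have hinv : ∀ L : List (List (E × Bool)), (∀ l ∈ L, Q.IsLetter l) →
        ∀ l ∈ invWord L, Q.IsLetter l := by
      intro L hL l hl
      rw [invWord, List.mem_reverse, List.mem_map] at hl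
      obtain ⟨l', hl', rfl⟩ := hl
      exact (hL l' hl').inv
    intro l hl
    rw [coneLetters_eq] at hl
    simp only [List.mem_append, List.mem_singleton] at hl
    rcases hl with (((hl | rfl) | (hl | hl)) | rfl) | hl
    · exact O.isLetter_left (by simp [hl])
    · exact (O.mergedLetter_left hQ hO).isLetter
    · exact hinv _ (fun l hl => O.isLetter_right (by simp [hl])) l hl
    · exact hinv _ (fun l hl => O.isLetter_right (by simp [hl])) l hl
    · exact O.isLetter_letterR hQ hO
    · exact O.isLetter_left (by simp [hl])
  border := by
    refine (cycle_chain_iff_next (R := Q.LetterBorder) (by simp [coneLetters])).1 ?_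
    -- The cycle $c$ consists of the arc of $\sigma$ outside the overlap and the inverted arc of
    -- $\tau$ outside the overlap, glued at the two merged letters.
    rw [coneLetters_eq, cycle_chain_split]
    have hL := O.mergedLetter_left hQ hO
    have hR := O.mergedLetter_right hQ hO
    constructor
    · refine isChain_replace_ends O.chain_left.1 (fun z hz => ?_) hL.border_left
      have := (hR.border_left _ hz.inv).inv
      rwa [FreeGroup.invRev_invRev, FreeGroup.invRev_invRev] at this
    · have h := isChain_invWord O.chain_right.1
      have e : invWord (O.τR :: (O.γ ++ O.δ ++ [O.τL])) =
          invRev O.τL :: ((invWord O.δ ++ invWord O.γ) ++ [invRev O.τR]) := by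
        simp [invWord]
      rw [e] at h
      refine isChain_replace_ends h hL.border_right fun z hz => ?_
      have := (hR.border_right (invRev z) hz.inv).inv
      rwa [FreeGroup.invRev_invRev, FreeGroup.invRev_invRev] at this
  balanced := by
    rw [countP_eq_iff_sum_sgn, coneLetters_eq]
    have h1 := s.sum_sgn
    have h2 := t.sum_sgn
    rw [O.word_left] at h1
    rw [O.word_right] at h2
    simp only [List.map_append, List.sum_append, List.map_cons, List.map_nil, List.sum_cons,
      List.sum_nil, add_zero] at h1 h2 ⊢
    rw [sum_map_sgn_invWord (Q := Q) fun l hl => O.isLetter_right (by simp [hl]),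
      sum_map_sgn_invWord (Q := Q) fun l hl => O.isLetter_right (by simp [hl])]
    -- The right merged letter enters inverted, so the summands 1 of the two formulas cancel, as do
    -- the contributions of $\rho$ to the balance of $\sigma$ and of $\tau$.
    have h3 := (O.mergedLetter_left hQ hO).sgn_eq
    have h4 := (O.mergedLetter_right hQ hO).sgn_eq
    rw [(O.isLetter_letterR hQ hO).sgn_invRev,
      (O.isLetter_left (by simp) : Q.IsLetter O.σR).sgn_invRev,
      (O.isLetter_right (by simp) : Q.IsLetter O.τR).sgn_invRev] at h4
    omega

end Overlap

end ConeWord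

end Gentle

namespace Gentle

noncomputable section

/-! ### Differentials as sums over edges, and their holonomy -/

section Edges

open FreeGroup (invRev)
open BoundQuiver

/-- A homotopy letter with a scalar, which runs from the summand `x` to the summand `y` of a
complex when it is read from left to right. -/
structure Edge (k : Type u) [Field k] (E : Type w) (J : Type) where
  letter : List (E × Bool)
  scal : kˣ
  x : J
  y : J

variable {k : Type u} [Field k] {V : Type v} {E : Type w} {Q : BoundQuiver V E} {J : Type}

namespace Edge

/-- The same component of a differential, read from right to left. -/
def inv (e : Edge k E J) : Edge k E J := ⟨invRev e.letter, e.scal, e.y, e.x⟩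

/-- The contribution of an edge to the holonomy. -/
def hol (e : Edge k E J) : kˣ := if isDirect e.letter then e.scal else e.scal⁻¹

variable (Q) in
/-- The edge runs between summands which fit its letter. -/
structure Fits (v : J → V) (deg : J → ℤ) (e : Edge k E J) : Prop where
  isLetter : Q.IsLetter e.letter
  startsAt : Q.StartsAt e.letter (v e.x)
  endsAt : Q.EndsAt e.letter (v e.y)
  deg_eq : deg e.y = deg e.x + sgn e.letter

lemma Fits.inv {v : J → V} {deg : J → ℤ} {e : Edge k E J} (h : e.Fits Q v deg) :
    e.inv.Fits Q v deg where
  isLetter := h.isLetter.inv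
  startsAt := h.endsAt.inv
  endsAt := h.startsAt.inv
  deg_eq := by
    have := h.deg_eq
    simp only [Edge.inv, h.isLetter.sgn_invRev]
    omega

lemma hol_inv {e : Edge k E J} (h : Q.IsLetter e.letter) : e.inv.hol = e.hol⁻¹ := by
  rw [hol, hol, inv, h.isDirect_invRev]
  cases isDirect e.letter <;> simp

variable [Fintype V] [DecidableEq J]

variable (Q) in
/-- The component of the differential given by an edge. -/
def mat (e : Edge k E J) : Matrix J J (BQAlg k Q) :=
  if isDirect e.letter then Matrix.single e.x e.y ((e.scal : k) • pathVal k Q (pathOf e.letter))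
  else Matrix.single e.y e.x ((e.scal : k) • pathVal k Q (pathOf e.letter))

lemma mat_inv {e : Edge k E J} (h : Q.IsLetter e.letter) : e.inv.mat Q = e.mat Q := by
  rw [mat, mat, inv, h.isDirect_invRev, h.pathOf_invRev]
  cases isDirect e.letter <;> simp

lemma mat_apply_eq_zero {e : Edge k E J} {p q : J} (h : ¬ (e.x = p ∧ e.y = q))
    (h' : ¬ (e.x = q ∧ e.y = p)) : e.mat Q p q = 0 := by
  rw [mat]
  split_ifs
  · exact Matrix.single_apply_of_ne (h := h) ..
  · exact Matrix.single_apply_of_ne (h := fun h2 => h' ⟨h2.2, h2.1⟩) ..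

end Edge

section

variable [Fintype V]

lemma idem_mul_pathVal {p : List E} {a : E} (ha : a ∈ p.head?) :
    idem k Q (Q.tgt a) * pathVal k Q p = pathVal k Q p := by
  obtain ⟨p', rfl⟩ := List.head?_eq_some_iff.1 ha
  simp [pathVal, ← mul_assoc, idem_mul_arr]

lemma pathVal_mul_idem {p : List E} {a : E} (ha : a ∈ p.getLast?) :
    pathVal k Q p * idem k Q (Q.src a) = pathVal k Q p := by
  obtain ⟨p', rfl⟩ := List.getLast?_eq_some_iff.1 ha
  simp [pathVal, mul_assoc, arr_mul_idem]

lemma pathVal_append (p q : List E) :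
    pathVal k Q (p ++ q) = pathVal k Q p * pathVal k Q q := by
  simp [pathVal]

lemma idem_mul_pathVal_of_startsAt {p : List E} (hp : p ≠ []) {x : V}
    (h : Q.StartsAt (dirWalk p) x) : idem k Q x * pathVal k Q p = pathVal k Q p := by
  obtain ⟨a, ha⟩ := Option.isSome_iff_exists.1 (List.isSome_head?.2 hp)
  rw [← h (a, true) (by rw [head?_dirWalk, ha]; rfl)]
  exact idem_mul_pathVal ha

lemma pathVal_mul_idem_of_endsAt {p : List E} (hp : p ≠ []) {x : V}
    (h : Q.EndsAt (dirWalk p) x) : pathVal k Q p * idem k Q x = pathVal k Q p := by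
  obtain ⟨a, ha⟩ := Option.isSome_iff_exists.1 (List.getLast?_isSome.2 hp)
  rw [← h (a, true) (by rw [getLast?_dirWalk, ha]; rfl)]
  exact pathVal_mul_idem ha

lemma Edge.Fits.isGraded_mat [DecidableEq J] {v : J → V} {deg : J → ℤ} {e : Edge k E J}
    (h : e.Fits Q v deg) : IsGraded v deg v deg 1 (e.mat Q) := by
  obtain ⟨l, u, x, y⟩ := e
  obtain ⟨h1, h2, h3, h4⟩ := h
  obtain ⟨p, hp, rfl | rfl⟩ := h1
  · rw [Edge.mat, if_pos (isDirect_dirWalk p)]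
    refine IsGraded.single ?_ ?_ (by simpa using h4)
    · rw [mul_smul_comm, pathOf_dirWalk, idem_mul_pathVal_of_startsAt hp.1 h2]
    · rw [smul_mul_assoc, pathOf_dirWalk, pathVal_mul_idem_of_endsAt hp.1 h3]
  · have h2' := h2.inv
    have h3' := h3.inv
    simp only [invRev_invWalk] at h2' h3'
    rw [Edge.mat, if_neg (by simp [isDirect_invWalk hp.1])]
    refine IsGraded.single ?_ ?_ ?_
    · rw [mul_smul_comm, pathOf_invWalk hp.1, idem_mul_pathVal_of_startsAt hp.1 h3']
    · rw [smul_mul_assoc, pathOf_invWalk hp.1, pathVal_mul_idem_of_endsAt hp.1 h2']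
    · simp only [sgn_invWalk hp.1] at h4
      simp only
      omega

end

/-- The edges of the letters of a word, where the `i`-th vertex of the word is `pos (o + i)`. -/
def wordEdges (u : ℕ → kˣ) (pos : ℕ → J) : List (List (E × Bool)) → ℕ → List (Edge k E J)
  | [], _ => []
  | l :: L, o => ⟨l, u o, pos o, pos (o + 1)⟩ :: wordEdges u pos L (o + 1)

section

variable {u : ℕ → kˣ} {pos : ℕ → J}

lemma wordEdges_append (L L' : List (List (E × Bool))) (o : ℕ) :
    wordEdges u pos (L ++ L') o = wordEdges u pos L o ++ wordEdges u pos L' (o + L.length) := by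
  induction L generalizing o with
  | nil => simp [wordEdges]
  | cons l L ih =>
    simp only [List.cons_append, wordEdges, ih, List.length_cons]
    rw [show o + 1 + L.length = o + (L.length + 1) by ring]

lemma wordEdges_eq_ofFn (L : List (List (E × Bool))) (o : ℕ) :
    wordEdges u pos L o = List.ofFn fun i : Fin L.length =>
      (⟨L.get i, u (o + i), pos (o + i), pos (o + i + 1)⟩ : Edge k E J) := by
  induction L generalizing o with
  | nil => simp [wordEdges]
  | cons l L ih =>
    rw [wordEdges, ih]
    simp only [List.length_cons, List.ofFn_succ, Fin.val_zero, add_zero, List.get_cons_zero,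
      Fin.val_succ, List.get_cons_succ']
    congr 2
    ext1 i
    rw [show o + 1 + i.1 = o + (i.1 + 1) by ring]

lemma mem_wordEdges {L : List (List (E × Bool))} {o : ℕ} {e : Edge k E J} :
    e ∈ wordEdges u pos L o ↔ ∃ i : Fin L.length,
      e = ⟨L.get i, u (o + i), pos (o + i), pos (o + i + 1)⟩ := by
  rw [wordEdges_eq_ofFn, List.mem_ofFn]
  simp [eq_comm]

lemma map_letter_wordEdges (L : List (List (E × Bool))) (o : ℕ) :
    (wordEdges u pos L o).map Edge.letter = L := by
  induction L generalizing o with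
  | nil => rfl
  | cons l L ih => simp [wordEdges, ih]

lemma map_x_wordEdges (L : List (List (E × Bool))) (o : ℕ) :
    (wordEdges u pos L o).map Edge.x = (List.range' o L.length).map pos := by
  induction L generalizing o with
  | nil => rfl
  | cons l L ih => simp [wordEdges, ih, List.range'_succ]

lemma map_y_wordEdges (L : List (List (E × Bool))) (o : ℕ) :
    (wordEdges u pos L o).map Edge.y = (List.range' (o + 1) L.length).map pos := by
  induction L generalizing o with
  | nil => rfl
  | cons l L ih => simp [wordEdges, ih, List.range'_succ]

end

namespace ClosedWord

variable (s : ClosedWord Q)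

lemma length_pos : 0 < s.letters.length := List.length_pos_iff.2 s.ne_nil

/-- The vertex `i` of the unfolded diagram, for `i` modulo the number of letters. -/
def pos (i : ℕ) : s.Idx := ⟨i % s.letters.length, Nat.mod_lt _ s.length_pos⟩

lemma val_pos {i : ℕ} (hi : i < s.letters.length) : (s.pos i).1 = i := Nat.mod_eq_of_lt hi

lemma pos_val (i : s.Idx) : s.pos i.1 = i := Fin.ext (Nat.mod_eq_of_lt i.2)

lemma pos_length : s.pos s.letters.length = s.pos 0 := Fin.ext (by simp [pos])

lemma pos_injOn : Set.InjOn s.pos {i | i < s.letters.length} := by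
  intro i hi j hj h
  have := congrArg Fin.val h
  rwa [s.val_pos hi, s.val_pos hj] at this

lemma deg_succ (d : ℤ) (i : s.Idx) : s.deg d (i.1 + 1) = s.deg d i + sgn (s.letters.get i) := by
  rw [deg, deg, List.take_succ_eq_append_getElem i.2]
  simp [add_assoc]

lemma deg_length (d : ℤ) : s.deg d s.letters.length = s.deg d 0 := by
  simp [deg, s.sum_sgn]

lemma deg_next (d : ℤ) (i : s.Idx) : s.deg d (next i) = s.deg d i + sgn (s.letters.get i) := by
  rw [← s.deg_succ]
  rcases Nat.lt_or_ge (i.1 + 1) s.letters.length with h | h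
  · congr 1
    exact Nat.mod_eq_of_lt h
  · have h1 : i.1 + 1 = s.letters.length := le_antisymm i.2 h
    rw [h1, deg_length]
    congr 1
    change (i.1 + 1) % _ = 0
    rw [h1, Nat.mod_self]

lemma deg_pos (d : ℤ) {i : ℕ} (hi : i ≤ s.letters.length) : s.deg d (s.pos i) = s.deg d i := by
  rcases hi.lt_or_eq with h | h
  · rw [s.val_pos h]
  · rw [h, pos_length, deg_length]
    rfl

/-- The edges of a closed word, with the vertices of the unfolded diagram placed in `J`. -/
def edges (u : ℕ → kˣ) (f : s.Idx → J) : List (Edge k E J) :=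
  wordEdges u (fun i => f (s.pos i)) s.letters 0

lemma edges_eq_ofFn (u : ℕ → kˣ) (f : s.Idx → J) :
    s.edges u f = List.ofFn fun i : s.Idx => ⟨s.letters.get i, u i, f i, f (next i)⟩ := by
  rw [edges, wordEdges_eq_ofFn]
  congr 1
  ext1 i
  simp only [zero_add, pos_val]
  rfl

lemma mem_edges {u : ℕ → kˣ} {f : s.Idx → J} {e : Edge k E J} :
    e ∈ s.edges u f ↔ ∃ i : s.Idx, e = ⟨s.letters.get i, u i, f i, f (next i)⟩ := by
  rw [edges_eq_ofFn, List.mem_ofFn]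
  simp [eq_comm]

/-- The constant `c` is the shift of the word inside the larger complex: -1 for the first word of a
cone, 0 for the second word and for a word by itself. -/
lemma fits_edges (d : ℤ) {u : ℕ → kˣ} {f : s.Idx → J} {v : J → V} {deg : J → ℤ} {c : ℤ}
    (hv : ∀ i, v (f i) = s.vert i) (hdeg : ∀ i, deg (f i) = s.deg d i + c) {e : Edge k E J}
    (he : e ∈ s.edges u f) : e.Fits Q v deg := by
  obtain ⟨i, rfl⟩ := s.mem_edges.1 he
  refine ⟨s.isLetter _ (List.get_mem _ _), ?_, ?_, ?_⟩
  · simp only [hv]; exact s.startsAt i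
  · simp only [hv]; exact s.endsAt i
  · simp only [hdeg, s.deg_next]; ring

/-- A sum over letters rather than a description by entries: in a word with two letters both may
contribute to the same entry. -/
lemma diffMatrix_eq [Fintype V] (lam : kˣ) (j : ℕ) :
    Matrix.of (diffMatrix k s lam j) = ((s.edges (weight lam j) id).map (Edge.mat Q)).sum := by
  ext p q
  rw [edges_eq_ofFn, List.map_ofFn, List.sum_ofFn, Matrix.sum_apply, Matrix.of_apply, diffMatrix]
  have h : ∀ i : s.Idx, ((Edge.mat Q ∘ fun i : s.Idx =>
      (⟨s.letters.get i, weight lam j i, id i, id (next i)⟩ : Edge k E s.Idx)) i) p q =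
      (if isDirect (s.letters.get i) = true then (if i = p ∧ next i = q then
        ((weight lam j i : kˣ) : k) • pathVal k Q (pathOf (s.letters.get i)) else 0) else 0) +
      (if isDirect (s.letters.get i) = false then (if next i = p ∧ i = q then
        ((weight lam j i : kˣ) : k) • pathVal k Q (pathOf (s.letters.get i)) else 0) else 0) := by
    intro i
    simp only [Function.comp_apply, Edge.mat, id]
    cases isDirect (s.letters.get i) <;> simp [Matrix.single_apply]
  rw [Finset.sum_congr rfl fun i _ => h i, Finset.sum_add_distrib,
    Finset.sum_eq_single p, Finset.sum_eq_single q]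
  · congr 1
    · simp only [true_and, eq_comm (a := q)]
      split_ifs <;> simp_all
    · simp only [and_true, eq_comm (a := p)]
      split_ifs <;> simp_all
  · intro i _ hi
    simp [hi]
  · simp
  · intro i _ hi
    simp [hi]
  · simp

/-- All letters but `j` carry the scalar 1. As `j` is direct, its scalar enters without inversion.
-/
lemma prod_hol_edges (lam : kˣ) (j : s.Idx) (hj : isDirect (s.letters.get j) = true)
    (f : s.Idx → J) : ((s.edges (weight lam j) f).map Edge.hol).prod = lam := by
  rw [edges_eq_ofFn, List.map_ofFn, List.prod_ofFn, Finset.prod_eq_single j]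
  · simp only [Function.comp_apply, Edge.hol, weight, hj, if_true]
  · intro i _ hi
    have : i.1 ≠ j.1 := fun h => hi (Fin.ext h)
    simp [Edge.hol, weight, this]
  · simp

end ClosedWord

end Edges

end

end Gentle

namespace Gentle

noncomputable section

/-! ### Rescaling a cyclic diagram to the complex of a closed word -/

section Inclusion

open BoundQuiver

variable {k : Type u} [Field k] {V : Type v} {E : Type w} {Q : BoundQuiver V E} {J : Type}

/-- The partial products of `r` serve as scaling factors at the vertices. The only obstruction to
using them is the last letter, which leads back to vertex 0, and total product 1 removes it. -/
lemma ClosedWord.prod_range_next (c : ClosedWord Q) {r : ℕ → kˣ}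
    (h : ∏ i ∈ Finset.range c.letters.length, r i = 1) (i : c.Idx) :
    ∏ j ∈ Finset.range (next i).1, r j = (∏ j ∈ Finset.range i.1, r j) * r i := by
  rw [← Finset.prod_range_succ]
  rcases Nat.lt_or_ge (i.1 + 1) c.letters.length with h1 | h1
  · congr 2
    exact Nat.mod_eq_of_lt h1
  · have h2 : i.1 + 1 = c.letters.length := le_antisymm i.2 h1
    have h3 : (next i).1 = 0 := by
      change (i.1 + 1) % _ = 0
      rw [h2, Nat.mod_self]
    rw [h3, h2, h]
    simp

variable [Fintype V] [Fintype J] [DecidableEq J]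

/-- A closed chain of edges through distinct summands of a complex describes the complex of a
closed word inside it. -/
theorem exists_inclusion (c : ClosedWord Q) (d : ℤ) {v : J → V} {deg : J → ℤ}
    {W : List (Edge k E J)} (hlet : W.map Edge.letter = c.letters)
    (hfit : ∀ e ∈ W, e.Fits Q v deg)
    (hcyc : Cycle.Chain (fun e e' : Edge k E J => e.y = e'.x) (W : Cycle (Edge k E J)))
    (hnd : (W.map Edge.x).Nodup) (hdeg : ∀ e ∈ W.head?, deg e.x = d) {lam : kˣ} (j : c.Idx)
    (hj : isDirect (c.letters.get j) = true) (hhol : (W.map Edge.hol).prod = lam) :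
    ∃ (inc : Matrix c.Idx J (BQAlg k Q)) (prj : Matrix J c.Idx (BQAlg k Q)),
      IsGraded c.vert (fun i => c.deg d i) v deg 0 inc ∧
      IsGraded v deg c.vert (fun i => c.deg d i) 0 prj ∧
      inc * prj = idMat k Q c.vert ∧
      prj * inc = Matrix.diagonal
        (fun p => if p ∈ W.map Edge.x then idem k Q (v p) else 0) ∧
      inc * (W.map (Edge.mat Q)).sum * prj = Matrix.of (diffMatrix k c lam j) := by
  have hn : W.length = c.letters.length := by rw [← hlet, List.length_map]
  have hWne : W ≠ [] := by
    rintro rfl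
    exact c.ne_nil (by simpa using hlet.symm)
  let ed : c.Idx → Edge k E J := fun i => W[i.1]'(by rw [hn]; exact i.2)
  have hW : W = List.ofFn ed := List.ext_getElem (by simp [hn]) (by simp [ed])
  have hedW : ∀ i, ed i ∈ W := fun i => List.getElem_mem _
  have hedlet : ∀ i, (ed i).letter = c.letters.get i := by
    intro i
    simp only [ed, List.get_eq_getElem, ← hlet, List.getElem_map]
  let κ : c.Idx → J := fun i => (ed i).x
  have hκ : Function.Injective κ := by
    rw [hW, List.map_ofFn, List.nodup_ofFn] at hnd
    exact hnd
  have hy : ∀ i, (ed i).y = κ (next i) := by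
    intro i
    have h := (cycle_chain_iff_next hWne).1 hcyc ⟨i.1, by rw [hn]; exact i.2⟩
    refine h.trans ?_
    simp only [κ, ed, List.get_eq_getElem, next, hn]
  have hmem : ∀ p, p ∈ W.map Edge.x ↔ ∃ i, κ i = p := by
    intro p
    rw [hW, List.map_ofFn, List.mem_ofFn]
    rfl
  have hv : ∀ i, v (κ i) = c.vert i := by
    intro i
    have h := (hfit _ (hedW i)).startsAt
    rw [hedlet] at h
    obtain ⟨x, hx⟩ := Option.isSome_iff_exists.1 (List.isSome_head?.2
      (c.isLetter _ (List.get_mem c.letters i)).ne_nil)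
    rw [← h x hx, vert_eq c i hx]
  have hdeg' : ∀ (n : ℕ) (hn : n < c.letters.length), deg (κ ⟨n, hn⟩) = c.deg d n := by
    intro n
    induction n with
    | zero =>
      intro h
      have : ed ⟨0, h⟩ ∈ W.head? := by
        rw [List.head?_eq_getElem?]
        simp [ed]
      simpa [ClosedWord.deg] using hdeg _ this
    | succ n ih =>
      intro h
      have h1 := (hfit _ (hedW ⟨n, by omega⟩)).deg_eq
      have h2 : (next ⟨n, by omega⟩ : c.Idx) = ⟨n + 1, h⟩ := Fin.ext (Nat.mod_eq_of_lt h)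
      rw [hy, h2, hedlet] at h1
      rw [h1]
      have h3 := c.deg_succ d ⟨n, by omega⟩
      simp only at h3
      rw [h3, ← ih (by omega)]
  -- The ratio of the actual holonomy of a letter to the prescribed one. Both have total `lam`, so
  -- the ratios multiply to 1.
  let r : ℕ → kˣ := fun i => if h : i < c.letters.length then
    (ed ⟨i, h⟩).hol * (Edge.hol ⟨c.letters.get ⟨i, h⟩, weight lam j i, κ ⟨i, h⟩, κ ⟨i, h⟩⟩)⁻¹ else 1
  have hr : ∏ i ∈ Finset.range c.letters.length, r i = 1 := by
    rw [← Fin.prod_univ_eq_prod_range]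
    have h1 : ∀ i : c.Idx, r i.1 = (ed i).hol *
        (Edge.hol (⟨c.letters.get i, weight lam j i, κ i, κ (next i)⟩ : Edge k E J))⁻¹ := by
      intro i
      simp only [r, dif_pos i.2]
      rfl
    rw [Finset.prod_congr rfl fun i _ => h1 i, Finset.prod_mul_distrib, Finset.prod_inv_distrib]
    have h2 := c.prod_hol_edges lam j hj κ
    rw [ClosedWord.edges_eq_ofFn, List.map_ofFn, List.prod_ofFn] at h2
    rw [hW, List.map_ofFn, List.prod_ofFn] at hhol
    refine mul_inv_eq_one.2 (Eq.trans ?_ (hhol.trans h2.symm))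
    rfl
  let g : ℕ → kˣ := fun i => ∏ j ∈ Finset.range i, r j
  have hg : ∀ i : c.Idx, g (next i) = g i * r i := c.prod_range_next hr
  let inc : Matrix c.Idx J (BQAlg k Q) :=
    Matrix.of fun i p => if κ i = p then (g i : k) • idem k Q (v p) else 0
  let prj : Matrix J c.Idx (BQAlg k Q) :=
    Matrix.of fun p i => if κ i = p then ((g i)⁻¹ : kˣ).1 • idem k Q (v p) else 0
  -- Compression by the rescaled inclusion and projection multiplies the component from `i` to `j`
  -- by `g i / g j`; the choice of `r` makes this turn the actual scalars into the prescribed ones.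
  have hM : ∀ (M : Matrix J J (BQAlg k Q)), IsGraded v deg v deg 1 M → ∀ i j,
      (inc * M * prj) i j = (g i * (g j)⁻¹ : kˣ).1 • M (κ i) (κ j) := by
    intro M hM i j
    rw [Matrix.mul_apply, Finset.sum_eq_single (κ j), Matrix.mul_apply,
      Finset.sum_eq_single (κ i)]
    · simp only [inc, prj, Matrix.of_apply, if_true, smul_mul_assoc, mul_smul_comm, hM.left,
        hM.right, smul_smul, Units.val_mul]
      rw [mul_comm]
    · intro p _ hp
      simp [inc, hp.symm]
    · simp
    · intro p _ hp
      simp [prj, hp.symm]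
    · simp
  refine ⟨inc, prj, ⟨?_, ?_, ?_⟩, ⟨?_, ?_, ?_⟩, ?_, ?_, ?_⟩
  · intro i p
    simp only [inc, Matrix.of_apply]
    split_ifs with h
    · rw [mul_smul_comm, ← hv, h, idem_mul_idem]
    · simp
  · intro i p
    simp only [inc, Matrix.of_apply]
    split_ifs with h
    · rw [smul_mul_assoc, idem_mul_idem]
    · simp
  · intro i p hp
    simp only [inc, Matrix.of_apply] at hp
    have h : κ i = p := by
      by_contra h
      simp [h] at hp
    rw [← h, hdeg' i.1 i.2, add_zero]
  · intro p i
    simp only [prj, Matrix.of_apply]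
    split_ifs with h
    · rw [mul_smul_comm, idem_mul_idem]
    · simp
  · intro p i
    simp only [prj, Matrix.of_apply]
    split_ifs with h
    · rw [smul_mul_assoc, ← hv, h, idem_mul_idem]
    · simp
  · intro p i hp
    simp only [prj, Matrix.of_apply] at hp
    have h : κ i = p := by
      by_contra h
      simp [h] at hp
    rw [← h, hdeg' i.1 i.2, add_zero]
  · ext i j
    rw [Matrix.mul_apply, Finset.sum_eq_single (κ i)]
    · by_cases h : i = j
      · subst h
        simp [inc, prj, idMat, idem_mul_idem, hv, smul_smul]
      · have h2 : κ j ≠ κ i := fun h3 => h (hκ h3.symm)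
        simp [prj, idMat, h, h2]
    · intro p _ hp
      simp [inc, hp.symm]
    · simp
  · ext p q
    rw [Matrix.mul_apply]
    by_cases h : ∃ i, κ i = p
    · have hp : p ∈ W.map Edge.x := (hmem p).2 h
      obtain ⟨i, rfl⟩ := h
      rw [Finset.sum_eq_single i]
      · by_cases h2 : κ i = q
        · subst h2
          rw [Matrix.diagonal_apply_eq, if_pos hp]
          simp [inc, prj, idem_mul_idem, smul_smul]
        · simp [inc, h2]
      · intro j _ hj
        have h2 : κ j ≠ κ i := fun h3 => hj (hκ h3)
        simp [prj, h2]
      · simp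
    · have hp : p ∉ W.map Edge.x := fun h2 => h ((hmem p).1 h2)
      push Not at h
      rw [Finset.sum_eq_zero]
      · rw [Matrix.diagonal_apply]
        simp [hp]
      · intro i _
        simp [prj, h i]
  · rw [ClosedWord.diffMatrix_eq]
    ext p q
    rw [hM _ (IsGraded.listSum (by
      intro M hM
      obtain ⟨e, he, rfl⟩ := List.mem_map.1 hM
      exact (hfit e he).isGraded_mat)), hW, ClosedWord.edges_eq_ofFn, List.map_ofFn,
      List.map_ofFn, List.sum_ofFn, List.sum_ofFn, Matrix.sum_apply, Matrix.sum_apply,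
      Finset.smul_sum]
    refine Finset.sum_congr rfl fun i _ => ?_
    simp only [Function.comp_apply, Edge.mat, hedlet, hy, id]
    have hri : r i.1 = (ed i).hol *
        (Edge.hol (⟨c.letters.get i, weight lam j i, κ i, κ (next i)⟩ : Edge k E J))⁻¹ := by
      simp only [r, dif_pos i.2]
      rfl
    have hgi := hg i
    rw [hri] at hgi
    simp only [Edge.hol, hedlet] at hgi
    by_cases hd : isDirect (c.letters.get i) = true
    · rw [if_pos hd, if_pos hd] at hgi ⊢
      by_cases h : i = p ∧ next i = q
      · obtain ⟨rfl, rfl⟩ := h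
        change _ • (Matrix.single (κ i) _ _) _ _ = _
        rw [Matrix.single_apply_same, Matrix.single_apply_same, smul_smul, hgi, ← Units.val_mul]
        congr 2
        rw [mul_inv, mul_inv, inv_inv, mul_inv_cancel_left, mul_right_comm, inv_mul_cancel,
          one_mul]
      · rw [Matrix.single_apply_of_ne (h := h),
          Matrix.single_apply_of_ne (h := fun h2 => h ⟨hκ h2.1, hκ h2.2⟩), smul_zero]
    · rw [if_neg hd, if_neg hd] at hgi ⊢
      by_cases h : next i = p ∧ i = q
      · obtain ⟨rfl, rfl⟩ := h
        change _ • (Matrix.single _ (κ i) _) _ _ = _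
        rw [Matrix.single_apply_same, Matrix.single_apply_same, smul_smul, hgi, ← Units.val_mul]
        congr 2
        rw [inv_inv, mul_comm (g i.1), mul_assoc, mul_assoc, mul_comm, mul_assoc]
        simp
      · rw [Matrix.single_apply_of_ne (h := h),
          Matrix.single_apply_of_ne (h := fun h2 => h ⟨hκ h2.1, hκ h2.2⟩), smul_zero]

end Inclusion

end

end Gentle

namespace Gentle

noncomputable section

/-! ### The contraction of the overlap near its ends -/

section Ends

open BoundQuiver
open FreeGroup (invRev)

variable {k : Type u} [Field k] {V : Type v} {E : Type w} {Q : BoundQuiver V E}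

lemma LeftEnd.inv {a b : List (E × Bool)} {f : List E} (h : LeftEnd a b f) :
    RightEnd (invRev a) (invRev b) f := by
  cases h with
  | lg1 p f hp hf => exact RightEnd.rg2 p _ hp hf
  | lg2 p f hp hf =>
    rw [invRev_invWalk, invRev_invWalk]
    exact RightEnd.rg1 p _ hp hf
  | lg3 p q hp hq =>
    rw [invRev_dirWalk, invRev_invWalk]
    exact RightEnd.rg3 p q hp hq

lemma LeftEnd.sgn_eq {a b : List (E × Bool)} {f : List E} (h : LeftEnd a b f) (hf : f ≠ []) :
    sgn a = sgn b := by
  cases h with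
  | lg1 p f hp hf => simp
  | lg2 p f hp hf => rw [sgn_invWalk hp, sgn_invWalk (by simp [hp])]
  | lg3 p q hp hq => exact (hf rfl).elim

lemma LeftEnd.reduce_eq [DecidableEq E] {a b : List (E × Bool)} {f : List E}
    (h : LeftEnd a b f) (hf : f ≠ []) :
    FreeGroup.reduce (a ++ invRev b) = dirWalk f := by
  cases h with
  | lg1 p f hp hf => exact reduce_lg1 p f
  | lg2 p f hp hf => exact reduce_lg2 p f
  | lg3 p q hp hq => exact (hf rfl).elim

/-- If the overlap is a vertex then a direct letter of the second word before it and a direct letter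
of the first word after it meet in a relation. -/
lemma LeftEnd.rel_of_direct (hQ : Q.IsGentle) {a b a' b' : List (E × Bool)} {f f' : List E}
    (h : LeftEnd a b f) (h' : RightEnd a' b' f') (h1 : Q.LetterBorder a a')
    (h2 : Q.LetterBorder b b') (hab : f = [] → Q.IsPath (pathOf b ++ pathOf a))
    (hb : isDirect b = true) (ha' : isDirect a' = true) :
    ∀ x ∈ (pathOf b).getLast?, ∀ y ∈ (pathOf a').head?, Q.rel x y := by
  intro x hx y hy
  have key1 : ∀ z ∈ a.getLast?, Q.Border z (y, true) := fun z hz => h1 z hz _ (by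
    rw [letter_direct ha', head?_dirWalk, hy]; rfl)
  have key2 : ∀ z ∈ b'.head?, Q.Border (x, true) z := fun z hz => h2 _ (by
    rw [letter_direct hb, getLast?_dirWalk, hx]; rfl) z hz
  -- If one of the paths in the squares exists, `x` and `y` face each other across a border of one
  -- of the two words and both are direct, so they form a relation. Otherwise the first arrow of the
  -- path underlying `a` composes with `x`; if `x y` were nonzero too, this arrow would be `y`,
  -- against the border between `a` and `a'`.
  by_cases hf' : f' = []
  · by_cases hf : f = []
    · cases h with
      | lg1 p f hp hf2 => exact (hf2 hf).elim
      | lg2 p f hp hf2 => exact (hf2 hf).elim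
      | lg3 p q hp hq =>
        have hpath := hab rfl
        rw [pathOf_dirWalk] at hx
        rw [pathOf_dirWalk, pathOf_invWalk hp, isPath_append hq hp] at hpath
        obtain ⟨z, hz⟩ := Option.isSome_iff_exists.1 (List.isSome_head?.2 hp)
        have h3 := key1 (z, false) (by rw [getLast?_invWalk, hz]; rfl)
        obtain ⟨h4, h5⟩ := hpath.2.2 x hx z hz
        by_contra h6
        have h7 : z ≠ y := by simpa using h3.2
        exact h7 (hQ.right_unique x z y h4 h5 (h4.trans (by simpa [lend, rend] using h3.1)) h6)
    · have h3 := key1 (x, true) (by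
        rw [h.head?_eq hf, letter_direct hb, getLast?_dirWalk, hx]; rfl)
      simpa using h3.2
  · have h3 := key2 (y, true) (by
        rw [← h'.head?_eq hf', letter_direct ha', head?_dirWalk, hy]; rfl)
    simpa using h3.2

variable [Fintype V]

lemma pathVal_mul_pathVal_eq_zero {p q : List E} {x y : E} (hx : x ∈ p.getLast?)
    (hy : y ∈ q.head?) (hr : Q.rel x y) : pathVal k Q p * pathVal k Q q = 0 := by
  rw [← idem_mul_pathVal hy, ← mul_assoc]
  exact pathVal_mul_eq_zero k hx hy hr

variable {J : Type} [Fintype J] [DecidableEq J] {v : J → V} {deg : J → ℤ}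

variable (Q) in
/-- The inverse of the identities, up to scalars, along an overlap. -/
def contraction (v : J → V) (pu pw : ℕ → J) (c : ℕ → kˣ) (r : ℕ) : Matrix J J (BQAlg k Q) :=
  ∑ i ∈ Finset.range (r + 1), Matrix.single (pw i) (pu i)
    (((c i)⁻¹ : kˣ).1 • idem k Q (v (pu i)))

variable {pu pw : ℕ → J} {c : ℕ → kˣ} {r : ℕ}

omit [Fintype J] in
lemma isGraded_contraction (hv : ∀ i ≤ r, v (pw i) = v (pu i))
    (hdeg : ∀ i ≤ r, deg (pw i) = deg (pu i) + 1) :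
    IsGraded v deg v deg (-1) (contraction Q v pu pw c r) := by
  refine IsGraded.sum _ fun i hi => ?_
  have hi : i ≤ r := by simpa [Nat.lt_succ_iff] using hi
  refine IsGraded.single ?_ ?_ ?_
  · rw [mul_smul_comm, hv i hi, idem_mul_idem]
  · rw [smul_mul_assoc, idem_mul_idem]
  · rw [hdeg i hi]; ring

lemma single_mul_contraction (hw : Set.InjOn pw {i | i ≤ r}) {i : ℕ} (hi : i ≤ r) (p : J)
    (a : BQAlg k Q) :
    Matrix.single p (pw i) a * contraction Q v pu pw c r =
      Matrix.single p (pu i) (((c i)⁻¹ : kˣ).1 • (a * idem k Q (v (pu i)))) := by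
  rw [contraction, Finset.mul_sum, Finset.sum_eq_single i]
  · rw [Matrix.single_mul_single_same, mul_smul_comm]
  · intro j hj hij
    have hj : j ≤ r := by simpa [Nat.lt_succ_iff] using hj
    exact Matrix.single_mul_single_of_ne _ _ _ _ (fun h => hij (hw hj hi h.symm)) _
  · intro h
    simp only [Finset.mem_range] at h
    omega

lemma single_mul_contraction_of_ne {p q : J} (hq : ∀ i ≤ r, q ≠ pw i) (a : BQAlg k Q) :
    Matrix.single p q a * contraction Q v pu pw c r = 0 := by
  rw [contraction, Finset.mul_sum]
  refine Finset.sum_eq_zero fun j hj => ?_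
  have hj : j ≤ r := by simpa [Nat.lt_succ_iff] using hj
  exact Matrix.single_mul_single_of_ne _ _ _ _ (hq j hj) _

/-- Two edges composed through an overlap. -/
lemma mat_mul_contraction_mul_mat (hv : ∀ i ≤ r, v (pw i) = v (pu i))
    (hu : Set.InjOn pu {i | i ≤ r}) (hw : Set.InjOn pw {i | i ≤ r})
    {e e' : Edge k E J} {i j : ℕ} (hi : i ≤ r) (hj : j ≤ r) (he : e.y = pw i) (he' : e'.y = pu j)
    (hx : ∀ l ≤ r, e.x ≠ pw l) (hx' : ∀ l ≤ r, e'.x ≠ pu l) (hfit : e.Fits Q v deg) :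
    e.mat Q * contraction Q v pu pw c r * e'.mat Q =
      if isDirect e.letter = true ∧ isDirect e'.letter = false ∧ i = j then
        Matrix.single e.x e'.x ((e.scal * (c i)⁻¹ * e'.scal : kˣ).1 •
          (pathVal k Q (pathOf e.letter) * pathVal k Q (pathOf e'.letter))) else 0 := by
  by_cases h1 : isDirect e.letter = true
  · have h2 : pathVal k Q (pathOf e.letter) * idem k Q (v (pu i)) =
        pathVal k Q (pathOf e.letter) := by
      rw [← hv i hi, ← he]
      have := hfit.endsAt
      rw [letter_direct h1] at this
      exact pathVal_mul_idem_of_endsAt hfit.isLetter.isPath.1 this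
    rw [Edge.mat, if_pos h1, he, single_mul_contraction hw hi, smul_mul_assoc, h2, smul_smul,
      Edge.mat]
    -- Both edges are read towards the overlap, so `e'` carries a component out of it only if it is
    -- inverse, just as `e` carries one into it only if it is direct.
    by_cases h3 : isDirect e'.letter = true
    · rw [if_pos h3, Matrix.single_mul_single_of_ne (h := (hx' i hi).symm), if_neg]
      simp [h3]
    · have h3' : isDirect e'.letter = false := by simpa using h3
      rw [if_neg h3, he']
      by_cases h4 : i = j
      · subst h4
        rw [Matrix.single_mul_single_same, if_pos ⟨h1, h3', rfl⟩, smul_mul_smul_comm]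
        simp [mul_comm]
      · rw [Matrix.single_mul_single_of_ne (h := fun h => h4 (hu hi hj h)), if_neg]
        exact fun h => h4 h.2.2
  · rw [Edge.mat, if_neg h1, single_mul_contraction_of_ne hx, Matrix.zero_mul, if_neg]
    exact fun h => h1 h.1

/-- The component of the cone at an end of an overlap, after the overlap has been contracted. -/
lemma LeftEnd.exists_mat_eq [DecidableEq E] (hv : ∀ i ≤ r, v (pw i) = v (pu i))
    (hu : Set.InjOn pu {i | i ≤ r}) (hw : Set.InjOn pw {i | i ≤ r})
    {a b : List (E × Bool)} {f : List E} (h : LeftEnd a b f) {x y : J} {wa wb aL : kˣ} {i : ℕ}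
    (hi : i ≤ r) (hx : ∀ l ≤ r, x ≠ pu l) (hy : ∀ l ≤ r, y ≠ pw l)
    (hb : (⟨b, wb, y, pw i⟩ : Edge k E J).Fits Q v deg)
    (hsq : f ≠ [] → if isDirect a then aL * wb = wa * c i else c i * wb = wa * aL) :
    ∃ u : kˣ, (⟨FreeGroup.reduce (a ++ invRev b), u, x, y⟩ : Edge k E J).hol =
        c i * (⟨a, wa, x, pu i⟩ : Edge k E J).hol * (⟨b, wb, y, pw i⟩ : Edge k E J).hol⁻¹ ∧
      Matrix.single x y ((aL : k) • endVal k f) -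
          (⟨b, wb, y, pw i⟩ : Edge k E J).mat Q * contraction Q v pu pw c r *
            (⟨a, -wa, x, pu i⟩ : Edge k E J).mat Q =
        (⟨FreeGroup.reduce (a ++ invRev b), u, x, y⟩ : Edge k E J).mat Q := by
  rw [mat_mul_contraction_mul_mat hv hu hw hi hi rfl rfl hy hx hb]
  by_cases hf : f = []
  · cases h with
    | lg1 p f hp hf' => exact (hf' hf).elim
    | lg2 p f hp hf' => exact (hf' hf).elim
    | lg3 p q hp hq =>
      -- Without a path in the square the component comes from the composite alone. The sign of
      -- $-DhD$ cancels the one in `-wa`, which leaves `wb * (c i)⁻¹ * wa`, on an inverse letter.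
      refine ⟨(c i * wa⁻¹ * wb⁻¹)⁻¹, ?_, ?_⟩
      · simp [Edge.hol, reduce_lg3, isDirect_invWalk hp,
          isDirect_invWalk (show q ++ p ≠ [] by simp [hp])]
      · rw [if_pos ⟨isDirect_dirWalk q, isDirect_invWalk hp, rfl⟩, reduce_lg3, Edge.mat, if_neg
          (by simp [isDirect_invWalk (show q ++ p ≠ [] by simp [hp])])]
        simp only [endVal, if_true, smul_zero, Matrix.single_zero, zero_sub, pathOf_dirWalk,
          pathOf_invWalk hp, pathOf_invWalk (show q ++ p ≠ [] by simp [hp]), pathVal_append]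
        rw [Matrix.single_neg, ← neg_smul]
        congr 2
        simp [mul_comm, mul_left_comm]
  -- With a path in the square both letters have the same direction, so the composite through the
  -- overlap vanishes and the component of the graph map survives unchanged. The commuting square
  -- computes its holonomy.
  · refine ⟨aL, ?_, ?_⟩
    · rw [h.reduce_eq hf]
      have hsq := hsq hf
      cases h with
      | lg1 p f hp hf' =>
        simp only [isDirect_dirWalk, if_true] at hsq
        simp only [Edge.hol, isDirect_dirWalk, if_true]
        rw [eq_mul_inv_iff_mul_eq, hsq, mul_comm]
      | lg2 p f hp hf' =>
        rw [isDirect_invWalk hp] at hsq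
        simp only [Edge.hol, isDirect_dirWalk, if_true, isDirect_invWalk hp,
          isDirect_invWalk (show p ++ f ≠ [] by simp [hp]), Bool.false_eq_true, if_false, inv_inv]
        have hsq : c i * wb = wa * aL := by simpa using hsq
        rw [mul_right_comm, hsq, mul_comm wa, mul_inv_cancel_right]
      | lg3 p q hp hq => exact (hf rfl).elim
    · rw [h.reduce_eq hf, Edge.mat, if_pos (isDirect_dirWalk f), endVal, if_neg hf,
        pathOf_dirWalk, if_neg, sub_zero]
      rintro ⟨h1, h2, -⟩
      cases h with
      | lg1 p f hp hf' => simp at h2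
      | lg2 p f hp hf' =>
        simp [isDirect_invWalk (show p ++ f ≠ [] by simp [hp])] at h1
      | lg3 p q hp hq => exact hf rfl

omit [Fintype V] [Fintype J] [DecidableEq J] in
lemma MergedLetter.fits {a b l : List (E × Bool)} (h : MergedLetter Q a b l) {x y x' y' : J}
    {wa wb u : kˣ} (ha : (⟨a, wa, x, x'⟩ : Edge k E J).Fits Q v deg)
    (hb : (⟨b, wb, y, y'⟩ : Edge k E J).Fits Q v deg) (hdeg : deg y' = deg x' + 1) :
    (⟨l, u, x, y⟩ : Edge k E J).Fits Q v deg where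
  isLetter := h.isLetter
  startsAt := h.startsAt _ ha.startsAt
  endsAt := h.endsAt _ hb.startsAt
  deg_eq := by
    have h1 := ha.deg_eq
    have h2 := hb.deg_eq
    have h3 := h.sgn_eq
    simp only at h1 h2 ⊢
    omega

omit [Fintype J] [DecidableEq J] in
/-- The path in the square at an end of an overlap is a component of degree zero. -/
lemma LeftEnd.isGraded_single [DecidableEq E] {ι ι' : Type} [DecidableEq ι] [DecidableEq ι']
    {v : ι → V} {deg : ι → ℤ}
    {v' : ι' → V} {deg' : ι' → ℤ} {a b : List (E × Bool)} {f : List E} (h : LeftEnd a b f)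
    (hm : MergedLetter Q a b (FreeGroup.reduce (a ++ invRev b))) {x : ι} {y : ι'} (aL : kˣ)
    (hx : Q.StartsAt a (v x)) (hy : Q.StartsAt b (v' y))
    (hdeg : deg' y + sgn b = deg x + sgn a) :
    IsGraded v deg v' deg' 0 (Matrix.single x y ((aL : k) • endVal (Q := Q) k f)) := by
  by_cases hf : f = []
  · simp only [endVal, if_pos hf, smul_zero, Matrix.single_zero]
    exact IsGraded.zero
  · have hs := h.sgn_eq hf
    have h1 := hm.startsAt _ hx
    have h2 := hm.endsAt _ hy
    rw [h.reduce_eq hf] at h1 h2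
    rw [endVal, if_neg hf]
    refine IsGraded.single ?_ ?_ (by omega)
    · rw [mul_smul_comm, idem_mul_pathVal_of_startsAt hf h1]
    · rw [smul_mul_assoc, pathVal_mul_idem_of_endsAt hf h2]

end Ends

end

end Gentle

namespace Gentle

noncomputable section

/-! ### The edges of a word inside, outside and at the border of a subword -/

section Splitting

open BoundQuiver
open FreeGroup (invRev)

variable {k : Type u} [Field k] {V : Type v} {E : Type w} {Q : BoundQuiver V E} {J : Type}

namespace ClosedWord

variable (s : ClosedWord Q) {β ρ α : List (List (E × Bool))} {a b : List (E × Bool)}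
  {w : ℕ → kˣ} {f : s.Idx → J}

lemma edges_split (hs : s.letters = β ++ [a] ++ ρ ++ [b] ++ α) :
    s.edges w f = wordEdges w (fun i => f (s.pos i)) β 0 ++
      [⟨a, w β.length, f (s.pos β.length), f (s.pos (β.length + 1))⟩] ++
      wordEdges w (fun i => f (s.pos i)) ρ (β.length + 1) ++
      [⟨b, w (β.length + 1 + ρ.length), f (s.pos (β.length + 1 + ρ.length)),
        f (s.pos (β.length + 1 + ρ.length + 1))⟩] ++
      wordEdges w (fun i => f (s.pos i)) α (β.length + 1 + ρ.length + 1) := by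
  rw [edges, hs, wordEdges_append, wordEdges_append, wordEdges_append, wordEdges_append]
  simp [wordEdges, add_assoc, add_comm 1]

lemma length_split (hs : s.letters = β ++ [a] ++ ρ ++ [b] ++ α) :
    s.letters.length = β.length + 1 + ρ.length + 1 + α.length := by
  rw [hs]
  simp only [List.length_append, List.length_cons, List.length_nil]

/-- The value `n = s.letters.length` is admitted because the right end of the letter after the
subword may be vertex 0, reached by wrapping around. -/
lemma outer_ne (hs : s.letters = β ++ [a] ++ ρ ++ [b] ++ α) (hf : Function.Injective f) {n i : ℕ}
    (hn : n ≤ s.letters.length) (h : n ≤ β.length ∨ β.length + 1 + ρ.length + 1 ≤ n)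
    (hi : i ≤ ρ.length) : f (s.pos n) ≠ f (s.pos (β.length + 1 + i)) := by
  intro h1
  have h2 := hf h1
  have h3 := s.length_split hs
  rcases hn.lt_or_eq with h4 | h4
  · have := s.pos_injOn h4 (show β.length + 1 + i < _ by omega) h2
    omega
  · rw [h4, pos_length] at h2
    have := s.pos_injOn s.length_pos (show β.length + 1 + i < _ by omega) h2
    omega

lemma inner_injOn (hs : s.letters = β ++ [a] ++ ρ ++ [b] ++ α) (hf : Function.Injective f) :
    Set.InjOn (fun i => f (s.pos (β.length + 1 + i))) {i | i ≤ ρ.length} := by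
  intro i hi j hj h
  have h3 := s.length_split hs
  have hi : i ≤ ρ.length := hi
  have hj : j ≤ ρ.length := hj
  have := s.pos_injOn (show β.length + 1 + i < _ by omega) (show β.length + 1 + j < _ by omega)
    (hf h)
  omega

lemma outer_edges_ne (hs : s.letters = β ++ [a] ++ ρ ++ [b] ++ α) (hf : Function.Injective f)
    {e : Edge k E J}
    (he : e ∈ wordEdges w (fun i => f (s.pos i)) β 0 ∨
      e ∈ wordEdges w (fun i => f (s.pos i)) α (β.length + 1 + ρ.length + 1))
    {i : ℕ} (hi : i ≤ ρ.length) :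
    e.x ≠ f (s.pos (β.length + 1 + i)) ∧ e.y ≠ f (s.pos (β.length + 1 + i)) := by
  have h3 := s.length_split hs
  rcases he with he | he
  · obtain ⟨n, rfl⟩ := mem_wordEdges.1 he
    have := n.2
    exact ⟨s.outer_ne hs hf (by omega) (by omega) hi, s.outer_ne hs hf (by omega) (by omega) hi⟩
  · obtain ⟨n, rfl⟩ := mem_wordEdges.1 he
    have := n.2
    exact ⟨s.outer_ne hs hf (by omega) (by omega) hi, s.outer_ne hs hf (by omega) (by omega) hi⟩

lemma inner_edges_eq {e : Edge k E J}
    (he : e ∈ wordEdges w (fun i => f (s.pos i)) ρ (β.length + 1)) :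
    ∃ i ≤ ρ.length, ∃ j ≤ ρ.length, e.x = f (s.pos (β.length + 1 + i)) ∧
      e.y = f (s.pos (β.length + 1 + j)) := by
  obtain ⟨n, rfl⟩ := mem_wordEdges.1 he
  exact ⟨n, n.2.le, n + 1, n.2, rfl, rfl⟩

variable [Fintype V] [DecidableEq J]

lemma sum_mat_apply_eq_zero {L : List (Edge k E J)} {p q : J}
    (h : ∀ e ∈ L, e.mat Q p q = 0) : (L.map (Edge.mat Q)).sum p q = 0 := by
  induction L with
  | nil => rfl
  | cons e L ih =>
    rw [List.map_cons, List.sum_cons, Matrix.add_apply, h e (by simp),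
      ih fun e he => h e (by simp [he]), add_zero]

/-- The letters of `ρ` and the two letters next to it all touch the subword, hence have no component
between outer vertices. -/
lemma sum_edges_apply_outer (hs : s.letters = β ++ [a] ++ ρ ++ [b] ++ α) {p q : J}
    (hp : ∀ i ≤ ρ.length, p ≠ f (s.pos (β.length + 1 + i)))
    (hq : ∀ i ≤ ρ.length, q ≠ f (s.pos (β.length + 1 + i))) :
    ((s.edges w f).map (Edge.mat Q)).sum p q =
      ((wordEdges w (fun i => f (s.pos i)) β 0).map (Edge.mat Q)).sum p q +
      ((wordEdges w (fun i => f (s.pos i)) α (β.length + 1 + ρ.length + 1)).map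
        (Edge.mat Q)).sum p q := by
  have h1 : ∀ e : Edge k E J, ((∃ i ≤ ρ.length, e.x = f (s.pos (β.length + 1 + i))) ∨
      (∃ i ≤ ρ.length, e.y = f (s.pos (β.length + 1 + i)))) → e.mat Q p q = 0 := by
    rintro e (⟨i, hi, h⟩ | ⟨i, hi, h⟩)
    · exact Edge.mat_apply_eq_zero (fun h2 => hp i hi (h2.1 ▸ h)) fun h2 => hq i hi (h2.1 ▸ h)
    · exact Edge.mat_apply_eq_zero (fun h2 => hq i hi (h2.2 ▸ h)) fun h2 => hp i hi (h2.2 ▸ h)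
  rw [s.edges_split hs]
  simp only [List.map_append, List.sum_append, List.map_cons, List.map_nil, List.sum_cons,
    List.sum_nil, add_zero, Matrix.add_apply]
  have hρ : ((wordEdges w (fun i => f (s.pos i)) ρ (β.length + 1)).map (Edge.mat Q)).sum p q =
      0 := by
    refine sum_mat_apply_eq_zero fun e he => h1 e ?_
    obtain ⟨i, hi, j, hj, h2, h3⟩ := s.inner_edges_eq he
    exact Or.inl ⟨i, hi, h2⟩
  rw [h1 ⟨a, _, _, _⟩ (Or.inr ⟨0, Nat.zero_le _, rfl⟩),
    h1 ⟨b, _, _, _⟩ (Or.inl ⟨ρ.length, le_rfl, rfl⟩), hρ]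
  simp

/-- Only the letters `a` and `b` join a vertex of the subword to an outer one. Both directions are
recorded: the cone needs components into the overlap for the second word and out of it for the
first. -/
lemma sum_edges_apply_border (hs : s.letters = β ++ [a] ++ ρ ++ [b] ++ α)
    (hf : Function.Injective f) {p : J}
    (hp : ∀ i ≤ ρ.length, p ≠ f (s.pos (β.length + 1 + i))) {q : J} {i : ℕ} (hi : i ≤ ρ.length)
    (hq : q = f (s.pos (β.length + 1 + i))) :
    ((s.edges w f).map (Edge.mat Q)).sum p q =
        ((⟨a, w β.length, f (s.pos β.length), f (s.pos (β.length + 1))⟩ : Edge k E J).mat Q +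
        (⟨b, w (β.length + 1 + ρ.length), f (s.pos (β.length + 1 + ρ.length)),
          f (s.pos (β.length + 1 + ρ.length + 1))⟩ : Edge k E J).mat Q) p q ∧
    ((s.edges w f).map (Edge.mat Q)).sum q p =
        ((⟨a, w β.length, f (s.pos β.length), f (s.pos (β.length + 1))⟩ : Edge k E J).mat Q +
        (⟨b, w (β.length + 1 + ρ.length), f (s.pos (β.length + 1 + ρ.length)),
          f (s.pos (β.length + 1 + ρ.length + 1))⟩ : Edge k E J).mat Q) q p := by
  have h1 : ∀ e : Edge k E J, e.x ≠ q ∧ e.y ≠ q → e.mat Q p q = 0 ∧ e.mat Q q p = 0 :=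
    fun e he => ⟨Edge.mat_apply_eq_zero (fun h => he.2 h.2) fun h => he.1 h.1,
      Edge.mat_apply_eq_zero (fun h => he.1 h.1) fun h => he.2 h.2⟩
  have h2 : ∀ e : Edge k E J, e.x ≠ p ∧ e.y ≠ p → e.mat Q p q = 0 ∧ e.mat Q q p = 0 :=
    fun e he => ⟨Edge.mat_apply_eq_zero (fun h => he.1 h.1) fun h => he.2 h.2,
      Edge.mat_apply_eq_zero (fun h => he.2 h.2) fun h => he.1 h.1⟩
  have hρ : ∀ e ∈ wordEdges w (fun i => f (s.pos i)) ρ (β.length + 1), e.x ≠ p ∧ e.y ≠ p := by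
    intro e he
    obtain ⟨i, hi, j, hj, h2, h3⟩ := s.inner_edges_eq he
    exact ⟨fun h => hp i hi (h ▸ h2), fun h => hp j hj (h ▸ h3)⟩
  rw [s.edges_split hs]
  simp only [List.map_append, List.sum_append, List.map_cons, List.map_nil, List.sum_cons,
    List.sum_nil, add_zero, Matrix.add_apply]
  subst hq
  constructor
  · rw [sum_mat_apply_eq_zero fun e he => (h1 e (s.outer_edges_ne hs hf (Or.inl he) hi)).1,
      sum_mat_apply_eq_zero fun e he => (h1 e (s.outer_edges_ne hs hf (Or.inr he) hi)).1,
      sum_mat_apply_eq_zero fun e he => (h2 e (hρ e he)).1]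
    simp
  · rw [sum_mat_apply_eq_zero fun e he => (h1 e (s.outer_edges_ne hs hf (Or.inl he) hi)).2,
      sum_mat_apply_eq_zero fun e he => (h1 e (s.outer_edges_ne hs hf (Or.inr he) hi)).2,
      sum_mat_apply_eq_zero fun e he => (h2 e (hρ e he)).2]
    simp

omit [Fintype V] [DecidableEq J] in
lemma cycle_chain_edges :
    Cycle.Chain (fun e e' : Edge k E J => e.y = e'.x) (s.edges w f : Cycle (Edge k E J)) := by
  have hlen : (s.edges w f).length = s.letters.length := by simp [edges_eq_ofFn]
  have hne : s.edges w f ≠ [] := by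
    intro h
    rw [h] at hlen
    exact s.length_pos.ne hlen
  rw [cycle_chain_iff_next hne]
  have key : ∀ i : Fin (s.edges w f).length, (s.edges w f).get i =
      ⟨s.letters.get (i.cast hlen), w i, f (i.cast hlen), f (next (i.cast hlen))⟩ := by
    intro i
    simp only [edges_eq_ofFn, List.get_eq_getElem, List.getElem_ofFn]
    rfl
  intro i
  rw [key, key]
  simp only
  congr 1
  exact Fin.ext (by simp [next, hlen])

lemma sum_edges_inl {J' : Type} [DecidableEq J'] :
    ((s.edges w fun i => (Sum.inl (f i) : J ⊕ J')).map (Edge.mat Q)).sum =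
      Matrix.fromBlocks ((s.edges w f).map (Edge.mat Q)).sum 0 0 0 := by
  rw [edges_eq_ofFn, edges_eq_ofFn, List.map_ofFn, List.map_ofFn, List.sum_ofFn, List.sum_ofFn]
  ext (p | p) (q | q)
  · rw [Matrix.fromBlocks_apply₁₁, Matrix.sum_apply, Matrix.sum_apply]
    refine Finset.sum_congr rfl fun i _ => ?_
    simp only [Function.comp_apply, Edge.mat]
    cases isDirect (s.letters.get i) <;> simp [Matrix.single_apply]
  all_goals
    rw [Matrix.sum_apply]
    refine Finset.sum_eq_zero fun i _ => ?_
    simp only [Function.comp_apply, Edge.mat]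
    cases isDirect (s.letters.get i) <;> simp

lemma sum_edges_inr {J' : Type} [DecidableEq J'] :
    ((s.edges w fun i => (Sum.inr (f i) : J' ⊕ J)).map (Edge.mat Q)).sum =
      Matrix.fromBlocks 0 0 0 ((s.edges w f).map (Edge.mat Q)).sum := by
  rw [edges_eq_ofFn, edges_eq_ofFn, List.map_ofFn, List.map_ofFn, List.sum_ofFn, List.sum_ofFn]
  ext (p | p) (q | q)
  on_goal 4 =>
    rw [Matrix.fromBlocks_apply₂₂, Matrix.sum_apply, Matrix.sum_apply]
    refine Finset.sum_congr rfl fun i _ => ?_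
    simp only [Function.comp_apply, Edge.mat]
    cases isDirect (s.letters.get i) <;> simp [Matrix.single_apply]
  all_goals
    rw [Matrix.sum_apply]
    refine Finset.sum_eq_zero fun i _ => ?_
    simp only [Function.comp_apply, Edge.mat]
    cases isDirect (s.letters.get i) <;> simp

lemma sum_edges_neg :
    ((s.edges (fun i => -w i) f).map (Edge.mat Q)).sum =
      -((s.edges w f).map (Edge.mat Q)).sum := by
  rw [edges_eq_ofFn, edges_eq_ofFn, List.map_ofFn, List.map_ofFn, List.sum_ofFn, List.sum_ofFn,
    ← Finset.sum_neg_distrib]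
  refine Finset.sum_congr rfl fun i _ => ?_
  simp only [Function.comp_apply, Edge.mat]
  split_ifs <;> simp [Matrix.single_neg]

end ClosedWord

end Splitting

end

end Gentle

namespace Gentle

noncomputable section

/-! ### Cancelling a diagonal block of isomorphisms -/

section Contraction

open BoundQuiver

variable {k : Type u} [Field k] {V : Type v} {E : Type w} {Q : BoundQuiver V E} [Fintype V]
  {J : Type} [Fintype J] [DecidableEq J] {v : J → V} {deg : J → ℤ}
  {pu pw : ℕ → J} {c : ℕ → kˣ} {r : ℕ}

lemma contraction_mul_single (hu : Set.InjOn pu {i | i ≤ r}) {i : ℕ} (hi : i ≤ r) (q : J)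
    (a : BQAlg k Q) :
    contraction Q v pu pw c r * Matrix.single (pu i) q a =
      Matrix.single (pw i) q (((c i)⁻¹ : kˣ).1 • (idem k Q (v (pu i)) * a)) := by
  rw [contraction, Finset.sum_mul, Finset.sum_eq_single i]
  · rw [Matrix.single_mul_single_same, smul_mul_assoc]
  · intro j hj hij
    have hj : j ≤ r := by simpa [Nat.lt_succ_iff] using hj
    exact Matrix.single_mul_single_of_ne _ _ _ _ (fun h => hij (hu hj hi h)) _
  · intro h
    simp only [Finset.mem_range] at h
    omega

lemma contraction_mul_single_of_ne {p q : J} (hp : ∀ i ≤ r, p ≠ pu i) (a : BQAlg k Q) :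
    contraction Q v pu pw c r * Matrix.single p q a = 0 := by
  rw [contraction, Finset.sum_mul]
  refine Finset.sum_eq_zero fun j hj => ?_
  have hj : j ≤ r := by simpa [Nat.lt_succ_iff] using hj
  exact Matrix.single_mul_single_of_ne _ _ _ _ (hp j hj).symm _

lemma mul_single_mul_apply (M N : Matrix J J (BQAlg k Q)) (a b x y : J) (z : BQAlg k Q) :
    (M * Matrix.single a b z * N) x y = M x a * z * N b y := by
  rw [Matrix.mul_apply, Finset.sum_eq_single b]
  · rw [Matrix.mul_single_apply_same]
  · intro q _ hq
    rw [Matrix.mul_single_apply_of_ne (hbj := hq), zero_mul]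
  · simp

/-- The contraction runs from the `pw i` to the `pu i`, so the product sees `M` only on components
into the `pw i` and `N` only on components out of the `pu i`. -/
lemma mul_contraction_mul_congr {M M' N N' : Matrix J J (BQAlg k Q)} {x y : J}
    (hM : ∀ i ≤ r, M x (pw i) = M' x (pw i)) (hN : ∀ i ≤ r, N (pu i) y = N' (pu i) y) :
    (M * contraction Q v pu pw c r * N) x y = (M' * contraction Q v pu pw c r * N') x y := by
  simp only [contraction, Finset.mul_sum, Finset.sum_mul, Matrix.sum_apply, mul_single_mul_apply]
  refine Finset.sum_congr rfl fun i hi => ?_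
  have hi : i ≤ r := by simpa [Nat.lt_succ_iff] using hi
  rw [hM i hi, hN i hi]

omit [Fintype J] in
/-- The projection to finitely many distinct summands. -/
lemma sum_single_eq_diagonal (hu : Set.InjOn pu {i | i ≤ r}) :
    ∑ i ∈ Finset.range (r + 1), Matrix.single (pu i) (pu i) (idem k Q (v (pu i))) =
      Matrix.diagonal (open Classical in fun p =>
        if ∃ i ≤ r, pu i = p then idem k Q (v p) else 0) := by
  classical
  ext p q
  rw [Matrix.sum_apply, Matrix.diagonal_apply]
  by_cases h : ∃ i ≤ r, pu i = p
  · obtain ⟨i, hi, rfl⟩ := h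
    rw [Finset.sum_eq_single i]
    · have h1 : ∃ j ≤ r, pu j = pu i := ⟨i, hi, rfl⟩
      rw [if_pos h1, Matrix.single_apply]
      simp
    · intro j hj hij
      have hj : j ≤ r := by simpa [Nat.lt_succ_iff] using hj
      exact Matrix.single_apply_of_ne (h := fun h => hij (hu hj hi h.1)) ..
    · intro h
      simp only [Finset.mem_range] at h
      omega
  · rw [if_neg h, ite_self]
    refine Finset.sum_eq_zero fun j hj => ?_
    have hj : j ≤ r := by simpa [Nat.lt_succ_iff] using hj
    exact Matrix.single_apply_of_ne (h := fun h2 => h ⟨j, hj, h2.1⟩) ..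

/-- Contracting identities, up to scalars, between pairs of summands of a complex. -/
def contractionEquiv {ι : Type} [Fintype ι] [DecidableEq ι] {v' : ι → V} {deg' : ι → ℤ}
    {D : Matrix J J (BQAlg k Q)} {hD : IsGraded v deg v deg 1 D} {hDD : D * D = 0}
    {D' : Matrix ι ι (BQAlg k Q)} {hD' : IsGraded v' deg' v' deg' 1 D'} {hDD' : D' * D' = 0}
    (hv : ∀ i ≤ r, v (pw i) = v (pu i)) (hdeg : ∀ i ≤ r, deg (pw i) = deg (pu i) + 1)
    (hu : Set.InjOn pu {i | i ≤ r}) (hw : Set.InjOn pw {i | i ≤ r})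
    (huw : ∀ i j, pu i ≠ pw j)
    (hc : ∀ i ≤ r, ∀ j ≤ r,
      D (pu i) (pw j) = if i = j then (c i : k) • idem k Q (v (pu i)) else 0)
    (inc : Matrix ι J (BQAlg k Q)) (prj : Matrix J ι (BQAlg k Q)) (R : J → Prop) [DecidablePred R]
    (hR : ∀ p, R p ↔ (∀ i ≤ r, p ≠ pu i) ∧ ∀ i ≤ r, p ≠ pw i)
    (hinc : IsGraded v' deg' v deg 0 inc) (hprj : IsGraded v deg v' deg' 0 prj)
    (h1 : inc * prj = idMat k Q v')
    (h2 : prj * inc = Matrix.diagonal (fun p => if R p then idem k Q (v p) else 0))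
    (S : Matrix J J (BQAlg k Q))
    (hS : ∀ x y, R x → R y → (D - D * contraction Q v pu pw c r * D) x y = S x y)
    (hSD : inc * S * prj = D') :
    HomotopyEquiv (matComplex v deg D hD hDD) (matComplex v' deg' D' hD' hDD') := by
  let eU : Matrix J J (BQAlg k Q) :=
    ∑ i ∈ Finset.range (r + 1), Matrix.single (pu i) (pu i) (idem k Q (v (pu i)))
  let eW : Matrix J J (BQAlg k Q) :=
    ∑ i ∈ Finset.range (r + 1), Matrix.single (pw i) (pw i) (idem k Q (v (pw i)))
  have hle : ∀ i ∈ Finset.range (r + 1), i ≤ r := fun i hi => by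
    simpa [Nat.lt_succ_iff] using hi
  have h2' : prj * inc = idMat k Q v - eU - eW := by
    classical
    rw [h2, idMat]
    simp only [eU, eW]
    rw [sum_single_eq_diagonal hu, sum_single_eq_diagonal hw, Matrix.diagonal_sub,
      Matrix.diagonal_sub]
    congr 1
    ext1 p
    by_cases h3 : ∃ i ≤ r, pu i = p
    · have h4 : ¬ ∃ i ≤ r, pw i = p := by
        rintro ⟨j, hj, h⟩
        obtain ⟨i, hi, h'⟩ := h3
        exact huw i j (h'.trans h.symm)
      rw [if_neg h4, if_pos h3, if_neg]
      · simp
      · intro h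
        obtain ⟨i, hi, h'⟩ := h3
        exact ((hR p).1 h).1 i hi h'.symm
    · by_cases h4 : ∃ i ≤ r, pw i = p
      · rw [if_neg h3, if_pos h4, if_neg]
        · simp
        · intro h
          obtain ⟨i, hi, h'⟩ := h4
          exact ((hR p).1 h).2 i hi h'.symm
      · rw [if_neg h3, if_neg h4, if_pos]
        · simp
        · exact (hR p).2 ⟨fun i hi h => h3 ⟨i, hi, h.symm⟩, fun i hi h => h4 ⟨i, hi, h.symm⟩⟩
  have hh := isGraded_contraction (c := c) (Q := Q) hv hdeg
  have hWh : eW * contraction Q v pu pw c r = contraction Q v pu pw c r := by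
    simp only [eW]
    rw [Finset.sum_mul]
    conv_rhs => rw [contraction]
    refine Finset.sum_congr rfl fun i hi => ?_
    rw [single_mul_contraction hw (hle i hi), hv i (hle i hi), idem_mul_idem]
  have hhU : contraction Q v pu pw c r * eU = contraction Q v pu pw c r := by
    simp only [eU]
    rw [Finset.mul_sum]
    conv_rhs => rw [contraction]
    refine Finset.sum_congr rfl fun i hi => ?_
    rw [contraction_mul_single hu (hle i hi), idem_mul_idem]
  have hUh : eU * contraction Q v pu pw c r = 0 := by
    simp only [eU]
    rw [Finset.sum_mul]
    exact Finset.sum_eq_zero fun i _ => single_mul_contraction_of_ne (fun j _ => huw i j) _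
  have hhW : contraction Q v pu pw c r * eW = 0 := by
    simp only [eW]
    rw [Finset.mul_sum]
    exact Finset.sum_eq_zero fun i _ =>
      contraction_mul_single_of_ne (fun j _ => (huw j i).symm) _
  have hinc' : inc = inc * (prj * inc) := by
    rw [← Matrix.mul_assoc, h1, hinc.id_mul]
  have hprj' : prj = prj * inc * prj := by
    rw [Matrix.mul_assoc, h1, hprj.mul_id]
  -- Both `inc` and `prj` absorb the projector `prj * inc` to the remaining summands, so entries at
  -- cancelled summands do not matter.
  have hres : ∀ M N : Matrix J J (BQAlg k Q), (∀ x y, R x → R y → M x y = N x y) →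
      inc * M * prj = inc * N * prj := by
    intro M N hMN
    have h3 : prj * inc * M * (prj * inc) = prj * inc * N * (prj * inc) := by
      rw [h2]
      ext x y
      rw [Matrix.mul_diagonal, Matrix.mul_diagonal, Matrix.diagonal_mul, Matrix.diagonal_mul]
      by_cases hx : R x
      · by_cases hy : R y
        · rw [hMN x y hx hy]
        · simp [hy]
      · simp [hx]
    have h4 (M : Matrix J J (BQAlg k Q)) :
        inc * (prj * inc * M * (prj * inc)) * prj = inc * M * prj := by
      calc _ = (inc * (prj * inc)) * M * (prj * inc * prj) := by simp only [Matrix.mul_assoc]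
        _ = _ := by rw [← hinc', ← hprj']
    rw [← h4 M, h3, h4]
  refine gaussEquiv inc prj (contraction Q v pu pw c r) eU eW hinc hprj hh h1 h2' ?_ ?_ hWh ?_ ?_ ?_
    ?_
  -- By `hc` the block of `D` from the `pu i` to the `pw j` is diagonal with units `c i`, and
  -- `contraction` is its inverse block. This goal and the next are the two sides of that inversion.
  · simp only [eW]
    rw [Finset.mul_sum]
    refine Finset.sum_congr rfl fun j hj => ?_
    rw [contraction, Finset.sum_mul, Finset.sum_mul, Finset.sum_eq_single j]
    · rw [Matrix.single_mul_mul_single, hc j (hle j hj) j (hle j hj), if_pos rfl, hv j (hle j hj),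
        smul_mul_smul_comm, smul_mul_assoc, idem_mul_idem, idem_mul_idem]
      simp
    · intro i hi hij
      rw [Matrix.single_mul_mul_single, hc i (hle i hi) j (hle j hj), if_neg hij]
      simp
    · exact fun h => (h hj).elim
  · simp only [eU]
    rw [Finset.sum_mul, Finset.sum_mul]
    refine Finset.sum_congr rfl fun i hi => ?_
    rw [contraction, Finset.mul_sum, Finset.sum_eq_single i]
    · rw [Matrix.single_mul_mul_single, hc i (hle i hi) i (hle i hi), if_pos rfl]
      simp only [mul_smul_comm, smul_mul_assoc, smul_smul, idem_mul_idem]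
      simp
    · intro j hj hij
      rw [Matrix.single_mul_mul_single, hc i (hle i hi) j (hle j hj), if_neg (Ne.symm hij)]
      simp
    · exact fun h => (h hi).elim
  · rw [← hhU, Matrix.mul_assoc, ← Matrix.mul_assoc eU, hUh, Matrix.zero_mul, Matrix.mul_zero]
  · rw [hinc', h2', Matrix.mul_assoc, Matrix.sub_mul, Matrix.sub_mul, hUh, hWh, hh.id_mul]
    simp
  · rw [hprj', h2', ← Matrix.mul_assoc, Matrix.mul_sub, Matrix.mul_sub, hhU, hhW, hh.mul_id]
    simp
  · rw [← hSD, ← hres _ _ hS, Matrix.mul_sub, Matrix.sub_mul]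
    simp only [Matrix.mul_assoc]

end Contraction

end

end Gentle

namespace Gentle

noncomputable section

/-! ### Vertices and degrees along the overlap and outside of it -/

section Geometry

open BoundQuiver
open FreeGroup (invRev)

variable {k : Type u} [Field k] {V : Type v} {E : Type w} {Q : BoundQuiver V E}

lemma BoundQuiver.StartsAt.unique {l : List (E × Bool)} {x y : V} (hl : l ≠ [])
    (hx : Q.StartsAt l x) (hy : Q.StartsAt l y) : x = y := by
  obtain ⟨z, hz⟩ := Option.isSome_iff_exists.1 (List.isSome_head?.2 hl)
  exact (hx z hz).symm.trans (hy z hz)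

namespace ClosedWord

variable (s : ClosedWord Q)

lemma startsAt_of_eq_append {L M : List (List (E × Bool))} {l : List (E × Bool)}
    (h : s.letters = L ++ l :: M) : Q.StartsAt l (s.vert (s.pos L.length)) := by
  have h1 := s.startsAt (s.pos L.length)
  have h2 : s.letters.get (s.pos L.length) = l := by
    have h3 : (s.pos L.length).1 = L.length := s.val_pos (by simp [h])
    simp only [List.get_eq_getElem, h3]
    simp [h]
  rwa [h2] at h1

lemma deg_of_eq_append {L M : List (List (E × Bool))} (h : s.letters = L ++ M) (d : ℤ) (i : ℕ) :
    s.deg d (L.length + i) = s.deg d L.length + ((M.take i).map sgn).sum := by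
  rw [deg, deg, h, List.take_length_add_append, List.take_left, List.map_append, List.sum_append,
    add_assoc]

lemma nodup_map_pos (o : ℕ) : ((List.range' o s.letters.length).map s.pos).Nodup := by
  refine List.Nodup.map_on ?_ List.nodup_range'
  intro i hi j hj h
  rw [List.mem_range'_1] at hi hj
  have h1 : i % s.letters.length = j % s.letters.length := congrArg Fin.val h
  have h2 : (i - o) % s.letters.length = (j - o) % s.letters.length := by
    refine Nat.ModEq.add_right_cancel' o ?_
    rw [Nat.sub_add_cancel hi.1, Nat.sub_add_cancel hj.1]
    exact h1
  rw [Nat.mod_eq_of_lt (by omega), Nat.mod_eq_of_lt (by omega)] at h2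
  omega

end ClosedWord

lemma range'_append_of_eq {o m n p : ℕ} (h : o + m = p) :
    List.range' o m ++ List.range' p n = List.range' o (m + n) := by
  subst h
  exact List.range'_append_1

/-- A list without repetitions whose length is the cardinality exhausts the type, so its two parts
are complementary. -/
lemma nodup_and_mem_of_append {α : Type*} [Fintype α] [DecidableEq α] {l l' : List α}
    (h : (l ++ l').Nodup) (hc : l.length + l'.length = Fintype.card α) :
    l.Nodup ∧ ∀ p, p ∈ l ↔ p ∉ l' := by
  obtain ⟨h1, h2, h3⟩ := List.nodup_append.1 h
  refine ⟨h1, fun p => ⟨fun hp hp' => h3 p hp p hp' rfl, fun hp => ?_⟩⟩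
  have h4 : (l ++ l').toFinset = Finset.univ := by
    rw [← Finset.card_eq_iff_eq_univ, List.toFinset_card_of_nodup h, List.length_append, hc]
  have h5 : p ∈ (l ++ l').toFinset := h4 ▸ Finset.mem_univ p
  rw [List.mem_toFinset, List.mem_append] at h5
  exact h5.resolve_right hp

namespace ClosedWord

variable (s : ClosedWord Q) {β ρ α : List (List (E × Bool))} {a b : List (E × Bool)}

/-- The vertices outside of a subword, up to the first one. -/
lemma outer_left (hs : s.letters = β ++ [a] ++ ρ ++ [b] ++ α) :
    ((List.range' 0 (β.length + 1) ++
      List.range' (β.length + 1 + ρ.length + 1) α.length).map s.pos).Nodup ∧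
    ∀ p, p ∈ (List.range' 0 (β.length + 1) ++
      List.range' (β.length + 1 + ρ.length + 1) α.length).map s.pos ↔
        ∀ i ≤ ρ.length, p ≠ s.pos (β.length + 1 + i) := by
  have h3 := s.length_split hs
  have h := nodup_and_mem_of_append (l := (List.range' 0 (β.length + 1) ++
      List.range' (β.length + 1 + ρ.length + 1) α.length).map s.pos)
      (l' := (List.range' (β.length + 1) (ρ.length + 1)).map s.pos) ?_ ?_
  · refine ⟨h.1, fun p => (h.2 p).trans ?_⟩
    simp only [List.mem_map, List.mem_range'_1, not_exists, not_and]
    constructor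
    · intro h i hi h2
      exact h (β.length + 1 + i) (by omega) h2.symm
    · intro h i hi h2
      refine h (i - (β.length + 1)) (by omega) ?_
      rw [Nat.add_sub_cancel' hi.1, h2]
  · rw [← List.map_append]
    refine ((List.Perm.map s.pos ?_).nodup_iff).1 (s.nodup_map_pos 0)
    have e : List.range' 0 s.letters.length = List.range' 0 (β.length + 1) ++
        (List.range' (β.length + 1) (ρ.length + 1) ++
          List.range' (β.length + 1 + ρ.length + 1) α.length) := by
      rw [range'_append_of_eq (add_assoc _ _ _).symm, range'_append_of_eq (zero_add _)]
      congr 1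
      omega
    rw [e, List.append_assoc]
    exact List.Perm.append_left _ List.perm_append_comm
  · simp
    omega

/-- The vertices outside of a subword, starting with the first one after it. -/
lemma outer_right (hs : s.letters = β ++ [a] ++ ρ ++ [b] ++ α) :
    ((List.range' (β.length + 1 + ρ.length + 1) (α.length + 1) ++
      List.range' 1 β.length).map s.pos).Nodup ∧
    ∀ p, p ∈ (List.range' (β.length + 1 + ρ.length + 1) (α.length + 1) ++
      List.range' 1 β.length).map s.pos ↔
        ∀ i ≤ ρ.length, p ≠ s.pos (β.length + 1 + i) := by
  have h3 := s.length_split hs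
  have h := nodup_and_mem_of_append
      (l := (List.range' (β.length + 1 + ρ.length + 1) (α.length + 1) ++
        List.range' 1 β.length).map s.pos)
      (l' := (List.range' (β.length + 1) (ρ.length + 1)).map s.pos) ?_ ?_
  · refine ⟨h.1, fun p => (h.2 p).trans ?_⟩
    simp only [List.mem_map, List.mem_range'_1, not_exists, not_and]
    constructor
    · intro h i hi h2
      exact h (β.length + 1 + i) (by omega) h2.symm
    · intro h i hi h2
      refine h (i - (β.length + 1)) (by omega) ?_
      rw [Nat.add_sub_cancel' hi.1, h2]
  · rw [← List.map_append]
    -- The second word is traversed backwards in the cone, so its vertices are listed as right ends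
    -- of letters: they are numbered from 1 to `s.letters.length`, the last standing for vertex 0.
    refine ((List.Perm.map s.pos ?_).nodup_iff).1 (s.nodup_map_pos 1)
    have e : List.range' 1 s.letters.length = List.range' 1 β.length ++
        (List.range' (β.length + 1) (ρ.length + 1) ++
          List.range' (β.length + 1 + ρ.length + 1) (α.length + 1)) := by
      rw [range'_append_of_eq (add_assoc _ _ _).symm, range'_append_of_eq (add_comm _ _)]
      congr 1
      omega
    rw [e, List.append_assoc]
    refine (List.perm_append_comm (l₁ := List.range' 1 β.length)).trans ?_
    refine (List.Perm.append_right _ List.perm_append_comm).trans ?_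
    rw [List.append_assoc]
    exact List.Perm.append_left _ List.perm_append_comm
  · simp
    omega

end ClosedWord

namespace Overlap

variable {s t : ClosedWord Q} (O : Overlap s t)

/-- Each letter of $\rho$ determines the vertex at its left end. The right end of $\rho$ is not the
left end of a letter common to both words, which is where `O.vertex` enters. -/
lemma vert_pos_eq {i : ℕ} (hi : i ≤ O.ρ.length) :
    t.vert (t.pos (O.δ.length + 1 + i)) = s.vert (s.pos (O.β.length + 1 + i)) := by
  rcases hi.lt_or_eq with h | h
  · have e : O.ρ = O.ρ.take i ++ O.ρ[i] :: O.ρ.drop (i + 1) := by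
      rw [List.getElem_cons_drop, List.take_append_drop]
    have hl : (O.ρ.take i).length = i := by simp [hi]
    have h1 := s.startsAt_of_eq_append (L := O.β ++ [O.σL] ++ O.ρ.take i) (l := O.ρ[i])
      (M := O.ρ.drop (i + 1) ++ [O.σR] ++ O.α) (by
        rw [O.word_left]; conv_lhs => rw [e]
        simp only [List.append_assoc, List.cons_append, List.nil_append])
    have h2 := t.startsAt_of_eq_append (L := O.δ ++ [O.τL] ++ O.ρ.take i) (l := O.ρ[i])
      (M := O.ρ.drop (i + 1) ++ [O.τR] ++ O.γ) (by
        rw [O.word_right]; conv_lhs => rw [e]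
        simp only [List.append_assoc, List.cons_append, List.nil_append])
    rw [List.length_append, List.length_append, hl] at h1 h2
    exact h2.unique (O.isLetter_left (by simp)).ne_nil h1
  · subst h
    have h1 := s.startsAt_of_eq_append (L := O.β ++ [O.σL] ++ O.ρ) (l := O.σR)
      (M := O.α) (by rw [O.word_left]; simp)
    have h2 := t.startsAt_of_eq_append (L := O.δ ++ [O.τL] ++ O.ρ) (l := O.τR)
      (M := O.γ) (by rw [O.word_right]; simp)
    rw [List.length_append, List.length_append] at h1 h2
    obtain ⟨x, hx⟩ := Option.isSome_iff_exists.1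
      (List.isSome_head?.2 (O.isLetter_left (l := O.σR) (by simp)).ne_nil)
    obtain ⟨y, hy⟩ := Option.isSome_iff_exists.1
      (List.isSome_head?.2 (O.isLetter_right (l := O.τR) (by simp)).ne_nil)
    exact (h2 y hy).symm.trans ((O.vertex x hx y hy).symm.trans (h1 x hx))

lemma deg_pos_eq {d e : ℤ} (h : s.deg d (O.β.length + 1) = t.deg e (O.δ.length + 1)) {i : ℕ}
    (hi : i ≤ O.ρ.length) : t.deg e (t.pos (O.δ.length + 1 + i)) =
      s.deg d (s.pos (O.β.length + 1 + i)) := by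
  have hs := s.length_split O.word_left
  have ht := t.length_split O.word_right
  rw [t.deg_pos e (by omega), s.deg_pos d (by omega)]
  have h1 := s.deg_of_eq_append (L := O.β ++ [O.σL]) (M := O.ρ ++ ([O.σR] ++ O.α))
    (by rw [O.word_left]; simp) d i
  have h2 := t.deg_of_eq_append (L := O.δ ++ [O.τL]) (M := O.ρ ++ ([O.τR] ++ O.γ))
    (by rw [O.word_right]; simp) e i
  rw [List.take_append_of_le_length hi] at h1 h2
  rw [List.length_append] at h1 h2
  exact h2.trans ((congrArg (· + _) h.symm).trans h1.symm)

end Overlap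

end Geometry

end

end Gentle

namespace Gentle

noncomputable section

/-! ### The entries of the differential of the cone -/

section ConeEntries

open BoundQuiver
open FreeGroup (invRev)

variable {k : Type u} [Field k] {V : Type v} {E : Type w} {Q : BoundQuiver V E}

namespace ClosedWord

variable (s : ClosedWord Q) {β ρ α : List (List (E × Bool))} {a b : List (E × Bool)} {J : Type}
  (w : ℕ → kˣ) (f : s.Idx → J)

lemma left_mem_edges (hs : s.letters = β ++ [a] ++ ρ ++ [b] ++ α) :
    ⟨a, w β.length, f (s.pos β.length), f (s.pos (β.length + 1))⟩ ∈ s.edges w f := by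
  rw [s.edges_split hs]
  simp

lemma right_mem_edges (hs : s.letters = β ++ [a] ++ ρ ++ [b] ++ α) :
    ⟨b, w (β.length + 1 + ρ.length), f (s.pos (β.length + 1 + ρ.length)),
      f (s.pos (β.length + 1 + ρ.length + 1))⟩ ∈ s.edges w f := by
  rw [s.edges_split hs]
  simp

end ClosedWord

namespace Overlap

variable {s t : ClosedWord Q} (O : Overlap s t)

/-- The vertices of the overlap in the first word, as summands of the cone. -/
def posL (i : ℕ) : s.Idx ⊕ t.Idx := Sum.inl (s.pos (O.β.length + 1 + i))

/-- The vertices of the overlap in the second word, as summands of the cone. -/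
def posR (i : ℕ) : s.Idx ⊕ t.Idx := Sum.inr (t.pos (O.δ.length + 1 + i))

lemma posL_injOn : Set.InjOn O.posL {i | i ≤ O.ρ.length} :=
  s.inner_injOn O.word_left Sum.inl_injective

lemma posR_injOn : Set.InjOn O.posR {i | i ≤ O.ρ.length} :=
  t.inner_injOn O.word_right Sum.inr_injective

lemma outer_ne_posL {n i : ℕ} (hn : n ≤ s.letters.length)
    (h : n ≤ O.β.length ∨ O.β.length + 1 + O.ρ.length + 1 ≤ n) (hi : i ≤ O.ρ.length) :
    Sum.inl (s.pos n) ≠ O.posL i := s.outer_ne O.word_left Sum.inl_injective hn h hi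

lemma outer_ne_posR {n i : ℕ} (hn : n ≤ t.letters.length)
    (h : n ≤ O.δ.length ∨ O.δ.length + 1 + O.ρ.length + 1 ≤ n) (hi : i ≤ O.ρ.length) :
    Sum.inr (t.pos n) ≠ O.posR i := t.outer_ne O.word_right Sum.inr_injective hn h hi

/-- The edges of `β` in the cone. -/
def edgesβ (w : ℕ → kˣ) : List (Edge k E (s.Idx ⊕ t.Idx)) :=
  wordEdges (fun i => -w i) (fun i => Sum.inl (s.pos i)) O.β 0

/-- The edges of `α` in the cone. -/
def edgesα (w : ℕ → kˣ) : List (Edge k E (s.Idx ⊕ t.Idx)) :=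
  wordEdges (fun i => -w i) (fun i => Sum.inl (s.pos i)) O.α (O.β.length + 1 + O.ρ.length + 1)

/-- The edges of `δ` in the cone. -/
def edgesδ (w' : ℕ → kˣ) : List (Edge k E (s.Idx ⊕ t.Idx)) :=
  wordEdges w' (fun i => Sum.inr (t.pos i)) O.δ 0

/-- The edges of `γ` in the cone. -/
def edgesγ (w' : ℕ → kˣ) : List (Edge k E (s.Idx ⊕ t.Idx)) :=
  wordEdges w' (fun i => Sum.inr (t.pos i)) O.γ (O.δ.length + 1 + O.ρ.length + 1)

/-- The edge of `σL` in the cone. -/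
def edgeσL (w : ℕ → kˣ) : Edge k E (s.Idx ⊕ t.Idx) :=
  ⟨O.σL, -w O.β.length, Sum.inl (s.pos O.β.length), O.posL 0⟩

/-- The edge of `σR` in the cone. -/
def edgeσR (w : ℕ → kˣ) : Edge k E (s.Idx ⊕ t.Idx) :=
  ⟨O.σR, -w (O.β.length + 1 + O.ρ.length), O.posL O.ρ.length,
    Sum.inl (s.pos (O.β.length + 1 + O.ρ.length + 1))⟩

/-- The edge of `τL` in the cone. -/
def edgeτL (w' : ℕ → kˣ) : Edge k E (s.Idx ⊕ t.Idx) :=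
  ⟨O.τL, w' O.δ.length, Sum.inr (t.pos O.δ.length), O.posR 0⟩

/-- The edge of `τR` in the cone. -/
def edgeτR (w' : ℕ → kˣ) : Edge k E (s.Idx ⊕ t.Idx) :=
  ⟨O.τR, w' (O.δ.length + 1 + O.ρ.length), O.posR O.ρ.length,
    Sum.inr (t.pos (O.δ.length + 1 + O.ρ.length + 1))⟩

variable [Fintype V]

/-- The components of a graph map. -/
def mapMatrix (c : ℕ → kˣ) (aL aR : kˣ) : Matrix s.Idx t.Idx (BQAlg k Q) :=
  ∑ i ∈ Finset.range (O.ρ.length + 1),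
    Matrix.single (s.pos (O.β.length + 1 + i)) (t.pos (O.δ.length + 1 + i))
      ((c i : k) • idem k Q (s.vert (s.pos (O.β.length + 1 + i)))) +
  Matrix.single (s.pos O.β.length) (t.pos O.δ.length) ((aL : k) • endVal k O.fL) +
  Matrix.single (s.pos (O.β.length + 1 + O.ρ.length + 1))
    (t.pos (O.δ.length + 1 + O.ρ.length + 1)) ((aR : k) • endVal k O.fR)

lemma isGraded_mapMatrix [DecidableEq E] (hQ : Q.IsGentle) (hO : O.Compatible) {d e : ℤ}
    (h : s.deg d (O.β.length + 1) = t.deg e (O.δ.length + 1)) (c : ℕ → kˣ) (aL aR : kˣ) :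
    IsGraded s.vert (fun i => s.deg d i) t.vert (fun i => t.deg e i) 0
      (O.mapMatrix c aL aR) := by
  have hσL := s.fits_edges d (c := 0) (fun _ => rfl) (fun _ => (add_zero _).symm)
    (s.left_mem_edges (fun _ => (1 : kˣ)) id O.word_left)
  have hσR := s.fits_edges d (c := 0) (fun _ => rfl) (fun _ => (add_zero _).symm)
    (s.right_mem_edges (fun _ => (1 : kˣ)) id O.word_left)
  have hτL := t.fits_edges e (c := 0) (fun _ => rfl) (fun _ => (add_zero _).symm)
    (t.left_mem_edges (fun _ => (1 : kˣ)) id O.word_right)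
  have hτR := t.fits_edges e (c := 0) (fun _ => rfl) (fun _ => (add_zero _).symm)
    (t.right_mem_edges (fun _ => (1 : kˣ)) id O.word_right)
  refine ((IsGraded.sum _ fun i hi => ?_).add ?_).add ?_
  · have hi : i ≤ O.ρ.length := by simpa [Nat.lt_succ_iff] using hi
    refine IsGraded.single ?_ ?_ ?_
    · rw [mul_smul_comm, idem_mul_idem]
    · rw [smul_mul_assoc, O.vert_pos_eq hi, idem_mul_idem]
    · rw [O.deg_pos_eq h hi, add_zero]
  · refine O.leftEnd.isGraded_single (O.mergedLetter_left hQ hO) aL hσL.startsAt hτL.startsAt ?_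
    have h1 := hσL.deg_eq
    have h2 := hτL.deg_eq
    have h3 := O.deg_pos_eq h (Nat.zero_le _)
    simp only [id, add_zero] at h1 h2 h3 ⊢
    omega
  · have hm := O.mergedLetter_right hQ hO
    rw [invRev_letterR] at hm
    refine O.rightEnd.inv.isGraded_single hm aR hσR.endsAt.inv hτR.endsAt.inv ?_
    have h1 := hσR.deg_eq
    have h2 := hτR.deg_eq
    have h3 := O.deg_pos_eq h le_rfl
    rw [(O.isLetter_left (by simp) : Q.IsLetter O.σR).sgn_invRev,
      (O.isLetter_right (by simp) : Q.IsLetter O.τR).sgn_invRev]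
    simp only [id] at h1 h2 ⊢
    omega

/-- `graphMatrix` has plain scalars on the overlap, which are not graded entries; multiplied by the
idempotents of the summands they define the same map. -/
lemma matMap_graphMatrix (d e : ℤ) (c : ℕ → kˣ) (aL aR : kˣ) (n : ℤ) :
    matMap k Q s.vert (fun i => s.deg d i) t.vert (fun i => t.deg e i)
      (graphMatrix k O c aL aR) n n =
    matrixHom s.vert (fun i => s.deg d i) t.vert (fun i => t.deg e i)
      (O.mapMatrix c aL aR) n n := by
  have hs := s.length_split O.word_left
  have ht := t.length_split O.word_right
  have hps : ∀ (p : s.Idx) {n : ℕ}, n < s.letters.length → (s.pos n = p ↔ p.1 = n) := by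
    intro p n hn
    rw [Fin.ext_iff, s.val_pos hn, eq_comm]
  have hpt : ∀ (p : t.Idx) {n : ℕ}, n < t.letters.length → (t.pos n = p ↔ p.1 = n) := by
    intro p n hn
    rw [Fin.ext_iff, t.val_pos hn, eq_comm]
  refine congrArg ModuleCat.ofHom (matrixLin_congr (F := Matrix.of (graphMatrix k O c aL aR))
    (fun p q => ?_) n n)
  rw [Matrix.of_apply, graphMatrix, mapMatrix, Matrix.add_apply, Matrix.add_apply,
    Matrix.sum_apply]
  simp only [mul_add, add_mul, Finset.mul_sum, Finset.sum_mul]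
  congr 1
  · congr 1
    · refine Finset.sum_congr rfl fun i hi => ?_
      have hi : i ≤ O.ρ.length := by simpa [Nat.lt_succ_iff] using hi
      simp only [Matrix.single_apply, hps p (show O.β.length + 1 + i < _ by omega),
        hpt q (show O.δ.length + 1 + i < _ by omega)]
      split_ifs with h1
      · have h2 := (hps p (by omega)).2 h1.1
        rw [h2, Algebra.algebraMap_eq_smul_one, mul_smul_comm, mul_one, mul_smul_comm,
          idem_mul_idem]
      · rfl
    · simp only [Matrix.single_apply, hps p (show O.β.length < _ by omega),
        hpt q (show O.δ.length < _ by omega)]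
  · have e1 : s.pos (O.β.length + 1 + O.ρ.length + 1) = p ↔
        p.1 = (O.β.length + O.ρ.length + 2) % s.letters.length := by
      rw [show O.β.length + O.ρ.length + 2 = O.β.length + 1 + O.ρ.length + 1 by ring, eq_comm,
        Fin.ext_iff]
      rfl
    have e2 : t.pos (O.δ.length + 1 + O.ρ.length + 1) = q ↔
        q.1 = (O.δ.length + O.ρ.length + 2) % t.letters.length := by
      rw [show O.δ.length + O.ρ.length + 2 = O.δ.length + 1 + O.ρ.length + 1 by ring, eq_comm,
        Fin.ext_iff]
      rfl
    simp only [Matrix.single_apply, e1, e2]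

/-- The differential of the mapping cone of a graph map. -/
def coneDiff (w w' : ℕ → kˣ) (c : ℕ → kˣ) (aL aR : kˣ) :
    Matrix (s.Idx ⊕ t.Idx) (s.Idx ⊕ t.Idx) (BQAlg k Q) :=
  ((s.edges (fun i => -w i) Sum.inl).map (Edge.mat Q)).sum +
  (∑ i ∈ Finset.range (O.ρ.length + 1), Matrix.single (O.posL i) (O.posR i)
      ((c i : k) • idem k Q (s.vert (s.pos (O.β.length + 1 + i)))) +
    Matrix.single (Sum.inl (s.pos O.β.length)) (Sum.inr (t.pos O.δ.length))
      ((aL : k) • endVal k O.fL) +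
    Matrix.single (Sum.inl (s.pos (O.β.length + 1 + O.ρ.length + 1)))
      (Sum.inr (t.pos (O.δ.length + 1 + O.ρ.length + 1))) ((aR : k) • endVal k O.fR)) +
  ((t.edges w' Sum.inr).map (Edge.mat Q)).sum

variable {w w' c : ℕ → kˣ} {aL aR : kˣ}

lemma coneMatrix_eq : coneMatrix ((s.edges w id).map (Edge.mat Q)).sum
    ((t.edges w' id).map (Edge.mat Q)).sum (O.mapMatrix c aL aR) =
      O.coneDiff w w' c aL aR := by
  have h1 := s.sum_edges_inl (w := fun i => -w i) (f := id) (J' := t.Idx)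
  have h2 := t.sum_edges_inr (w := w') (f := id) (J' := s.Idx)
  simp only [id] at h1 h2
  rw [coneDiff, h1, h2, s.sum_edges_neg, coneMatrix]
  ext (p | p) (q | q) <;>
    simp [mapMatrix, Matrix.sum_apply, Matrix.single_apply, posL, posR]

/-- The block to be cancelled. It is diagonal because $D_\sigma$ and $D_\tau$ do not lead from one
word to the other and the components $f_L$, $f_R$ start outside the overlap. Its inverse thus
creates no longer zigzags. -/
lemma coneDiff_posL_posR {i j : ℕ} (hi : i ≤ O.ρ.length) (hj : j ≤ O.ρ.length) :
    O.coneDiff w w' c aL aR (O.posL i) (O.posR j) =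
      if i = j then (c i : k) • idem k Q (coneVert s.vert t.vert (O.posL i)) else 0 := by
  have hs := s.length_split O.word_left
  have h1 := s.sum_edges_inl (w := fun i => -w i) (f := id) (J' := t.Idx) (k := k)
  have h2 := t.sum_edges_inr (w := w') (f := id) (J' := s.Idx) (k := k)
  simp only [id] at h1 h2
  rw [coneDiff, h1, h2, Matrix.add_apply, Matrix.add_apply, Matrix.add_apply, Matrix.add_apply,
    Matrix.single_apply_of_ne (h := fun h => O.outer_ne_posL (by omega) (by omega) hi h.1),
    Matrix.single_apply_of_ne (h := fun h => O.outer_ne_posL (by omega) (by omega) hi h.1),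
    Matrix.sum_apply, Finset.sum_eq_single i]
  · rw [Matrix.single_apply]
    have h3 : O.posR i = O.posR j ↔ i = j := ⟨fun h => O.posR_injOn hi hj h, fun h => h ▸ rfl⟩
    simp only [true_and, h3]
    simp [posL, posR]
  · intro l hl hli
    have hl : l ≤ O.ρ.length := by simpa [Nat.lt_succ_iff] using hl
    exact Matrix.single_apply_of_ne (h := fun h => hli (O.posL_injOn hl hi h.1)) ..
  · intro h
    simp only [Finset.mem_range] at h
    omega

/-- The ways into the cancelled targets: a component of the graph map ending there starts at a
cancelled source, so only the letters of $\tau$ at the border remain. `coneDiff_posL` is the dual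
statement for the ways out of the cancelled sources. -/
lemma coneDiff_posR {x : s.Idx ⊕ t.Idx} (hx : ∀ i ≤ O.ρ.length, x ≠ O.posL i)
    (hx' : ∀ i ≤ O.ρ.length, x ≠ O.posR i) {i : ℕ} (hi : i ≤ O.ρ.length) :
    O.coneDiff w w' c aL aR x (O.posR i) =
      ((O.edgeτL w').mat Q + (O.edgeτR w').mat Q) x (O.posR i) := by
  have ht := t.length_split O.word_right
  have h1 := s.sum_edges_inl (w := fun i => -w i) (f := id) (J' := t.Idx) (k := k)
  simp only [id] at h1
  have h2 := (t.sum_edges_apply_border (w := w') O.word_right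
    (Sum.inr_injective (α := s.Idx)) hx' hi rfl).1
  rw [coneDiff, Matrix.add_apply, Matrix.add_apply, Matrix.add_apply, Matrix.add_apply,
    Matrix.single_apply_of_ne (h := fun h => O.outer_ne_posR (by omega) (by omega) hi h.2),
    Matrix.single_apply_of_ne (h := fun h => O.outer_ne_posR (by omega) (by omega) hi h.2),
    Matrix.sum_apply, Finset.sum_eq_zero, h1]
  · refine Eq.trans ?_ h2
    rcases x with x | x <;> simp [posR]
  · intro l hl
    have hl : l ≤ O.ρ.length := by simpa [Nat.lt_succ_iff] using hl
    exact Matrix.single_apply_of_ne (h := fun h => hx l hl h.1.symm) ..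

lemma coneDiff_posL {y : s.Idx ⊕ t.Idx} (hy : ∀ i ≤ O.ρ.length, y ≠ O.posL i)
    (hy' : ∀ i ≤ O.ρ.length, y ≠ O.posR i) {i : ℕ} (hi : i ≤ O.ρ.length) :
    O.coneDiff w w' c aL aR (O.posL i) y =
      ((O.edgeσL w).mat Q + (O.edgeσR w).mat Q) (O.posL i) y := by
  have hs := s.length_split O.word_left
  have h1 := t.sum_edges_inr (w := w') (f := id) (J' := s.Idx) (k := k)
  simp only [id] at h1
  have h2 := (s.sum_edges_apply_border (w := fun i => -w i) O.word_left
    (Sum.inl_injective (β := t.Idx)) hy hi rfl).2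
  rw [coneDiff, Matrix.add_apply, Matrix.add_apply, Matrix.add_apply, Matrix.add_apply,
    Matrix.single_apply_of_ne (h := fun h => O.outer_ne_posL (by omega) (by omega) hi h.1),
    Matrix.single_apply_of_ne (h := fun h => O.outer_ne_posL (by omega) (by omega) hi h.1),
    Matrix.sum_apply, Finset.sum_eq_zero, h1]
  · refine Eq.trans ?_ h2
    rcases y with y | y <;> simp [posL]
  · intro l hl
    have hl : l ≤ O.ρ.length := by simpa [Nat.lt_succ_iff] using hl
    exact Matrix.single_apply_of_ne (h := fun h => hy' l hl h.2.symm) ..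

lemma coneDiff_outer {x y : s.Idx ⊕ t.Idx} (hx : ∀ i ≤ O.ρ.length, x ≠ O.posL i)
    (hx' : ∀ i ≤ O.ρ.length, x ≠ O.posR i) (hy : ∀ i ≤ O.ρ.length, y ≠ O.posL i)
    (hy' : ∀ i ≤ O.ρ.length, y ≠ O.posR i) :
    O.coneDiff w w' c aL aR x y =
      (((O.edgesβ w).map (Edge.mat Q)).sum + ((O.edgesα w).map (Edge.mat Q)).sum +
      (Matrix.single (Sum.inl (s.pos O.β.length)) (Sum.inr (t.pos O.δ.length))
        ((aL : k) • endVal k O.fL) +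
      Matrix.single (Sum.inl (s.pos (O.β.length + 1 + O.ρ.length + 1)))
        (Sum.inr (t.pos (O.δ.length + 1 + O.ρ.length + 1))) ((aR : k) • endVal k O.fR)) +
      (((O.edgesδ w').map (Edge.mat Q)).sum + ((O.edgesγ w').map (Edge.mat Q)).sum) :
        Matrix (s.Idx ⊕ t.Idx) (s.Idx ⊕ t.Idx) (BQAlg k Q)) x y := by
  rw [coneDiff, Matrix.add_apply, Matrix.add_apply,
    s.sum_edges_apply_outer O.word_left hx hy, t.sum_edges_apply_outer O.word_right hx' hy',
    Matrix.add_apply, Matrix.add_apply, Matrix.sum_apply, Finset.sum_eq_zero, zero_add]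
  · rfl
  · intro l hl
    have hl : l ≤ O.ρ.length := by simpa [Nat.lt_succ_iff] using hl
    exact Matrix.single_apply_of_ne (h := fun h => hx l hl h.1.symm) ..

end Overlap

end ConeEntries

end

end Gentle

namespace Gentle

noncomputable section

/-! ### The cycle of edges that survives in the cone -/

section ConeEdges

open BoundQuiver
open FreeGroup (invRev)

variable {k : Type u} [Field k] {V : Type v} {E : Type w} {Q : BoundQuiver V E} {J : Type}

lemma Edge.hol_neg (l : List (E × Bool)) (a : kˣ) (x y : J) :
    (⟨l, -a, x, y⟩ : Edge k E J).hol = -(⟨l, a, x, y⟩ : Edge k E J).hol := by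
  rw [Edge.hol, Edge.hol]
  cases isDirect l <;> simp [inv_neg]

lemma prod_hol_wordEdges_neg {u : ℕ → kˣ} {pos : ℕ → J} (L : List (List (E × Bool))) (o : ℕ) :
    ((wordEdges (fun i => -u i) pos L o).map Edge.hol).prod =
      (-1) ^ L.length * ((wordEdges u pos L o).map Edge.hol).prod := by
  induction L generalizing o with
  | nil => simp [wordEdges]
  | cons l L ih =>
    simp only [wordEdges, List.map_cons, List.prod_cons, ih, Edge.hol_neg, List.length_cons,
      pow_succ]
    simp [mul_left_comm]

/-- Each commuting square exchanges the holonomies of a letter in the two complexes at the cost of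
replacing `c i` by `c (i + 1)`; the induction telescopes. -/
lemma prod_hol_wordEdges_of_squares {J' : Type} {u u' : ℕ → kˣ} {pos : ℕ → J} {pos' : ℕ → J'}
    (L : List (List (E × Bool))) (o o' : ℕ) (c : ℕ → kˣ)
    (h : ∀ (i : ℕ) (hi : i < L.length), if isDirect L[i] then
      c i * u' (o' + i) = u (o + i) * c (i + 1) else c (i + 1) * u' (o' + i) = u (o + i) * c i) :
    c 0 * ((wordEdges u' pos' L o').map Edge.hol).prod =
      c L.length * ((wordEdges u pos L o).map Edge.hol).prod := by
  induction L generalizing o o' c with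
  | nil => simp [wordEdges]
  | cons l L ih =>
    have h0 := h 0 (by simp)
    have ih := ih (o + 1) (o' + 1) (fun i => c (i + 1)) fun i hi => by
      have := h (i + 1) (by simpa using hi)
      rwa [List.getElem_cons_succ, show o' + (i + 1) = o' + 1 + i by ring,
        show o + (i + 1) = o + 1 + i by ring] at this
    simp only [wordEdges, List.map_cons, List.prod_cons, List.length_cons]
    have h1 : c 0 * (⟨l, u' o', pos' o', pos' (o' + 1)⟩ : Edge k E J').hol =
        (⟨l, u o, pos o, pos (o + 1)⟩ : Edge k E J).hol * c 1 := by
      simp only [List.getElem_cons_zero, add_zero, zero_add] at h0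
      rw [Edge.hol, Edge.hol]
      simp only
      split_ifs at h0 ⊢ with hl
      · exact h0
      · rw [← div_eq_mul_inv, div_eq_iff_eq_mul, mul_assoc, h0, inv_mul_cancel_left]
    rw [← mul_assoc, h1, mul_assoc, ih, mul_left_comm]

lemma prod_hol_inv_reverse {L : List (Edge k E J)} (h : ∀ e ∈ L, Q.IsLetter e.letter) :
    (((L.map Edge.inv).reverse).map Edge.hol).prod = (L.map Edge.hol).prod⁻¹ := by
  rw [List.map_reverse, List.prod_reverse, List.prod_inv, List.map_map, List.map_map]
  congr 1
  exact List.map_congr_left fun e he => Edge.hol_inv (h e he)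

lemma sum_mat_inv_reverse [Fintype V] [DecidableEq J] {L : List (Edge k E J)}
    (h : ∀ e ∈ L, Q.IsLetter e.letter) :
    (((L.map Edge.inv).reverse).map (Edge.mat Q)).sum = (L.map (Edge.mat Q)).sum := by
  rw [List.map_reverse, List.sum_reverse, List.map_map]
  congr 1
  exact List.map_congr_left fun e he => Edge.mat_inv (h e he)

lemma LeftEnd.pathVal_mul_eq_zero [Fintype V] (hQ : Q.IsGentle) {a b a' b' : List (E × Bool)}
    {f f' : List E} (h : LeftEnd a b f) (h' : RightEnd a' b' f') (h1 : Q.LetterBorder a a')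
    (h2 : Q.LetterBorder b b') (hab : f = [] → Q.IsPath (pathOf b ++ pathOf a))
    (hb : isDirect b = true) (ha' : isDirect a' = true) (hlb : Q.IsLetter b)
    (hla' : Q.IsLetter a') : pathVal k Q (pathOf b) * pathVal k Q (pathOf a') = 0 := by
  obtain ⟨x, hx⟩ := Option.isSome_iff_exists.1 (List.getLast?_isSome.2 hlb.isPath.1)
  obtain ⟨y, hy⟩ := Option.isSome_iff_exists.1 (List.isSome_head?.2 hla'.isPath.1)
  exact pathVal_mul_pathVal_eq_zero hx hy (h.rel_of_direct hQ h' h1 h2 hab hb ha' x hx y hy)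

namespace Overlap

variable {s t : ClosedWord Q} (O : Overlap s t) {w w' : ℕ → kˣ} {c : ℕ → kˣ} {aL aR : kˣ}

lemma edges_left : s.edges (fun i => -w i) (Sum.inl (β := t.Idx)) =
    O.edgesβ w ++ [O.edgeσL w] ++
      wordEdges (fun i => -w i) (fun i => Sum.inl (s.pos i)) O.ρ (O.β.length + 1) ++
      [O.edgeσR w] ++ O.edgesα w := s.edges_split O.word_left

lemma edges_right : t.edges w' (Sum.inr (α := s.Idx)) =
    O.edgesδ w' ++ [O.edgeτL w'] ++
      wordEdges w' (fun i => Sum.inr (t.pos i)) O.ρ (O.δ.length + 1) ++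
      [O.edgeτR w'] ++ O.edgesγ w' := t.edges_split O.word_right

lemma fits_left (d e : ℤ) {ed : Edge k E (s.Idx ⊕ t.Idx)}
    (h : ed ∈ O.edgesβ w ++ [O.edgeσL w] ++
      wordEdges (fun i => -w i) (fun i => Sum.inl (s.pos i)) O.ρ (O.β.length + 1) ++
      [O.edgeσR w] ++ O.edgesα w) :
    ed.Fits Q (coneVert s.vert t.vert) (coneDeg (fun i => s.deg d i) (fun i => t.deg e i)) :=
  s.fits_edges d (u := fun i => -w i) (f := Sum.inl) (v := coneVert s.vert t.vert)
    (deg := coneDeg (fun i => s.deg d i) (fun i => t.deg e i)) (c := -1) (fun _ => rfl)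
    (fun _ => rfl) (O.edges_left (w := w) ▸ h)

lemma fits_right (d e : ℤ) {ed : Edge k E (s.Idx ⊕ t.Idx)}
    (h : ed ∈ O.edgesδ w' ++ [O.edgeτL w'] ++
      wordEdges w' (fun i => Sum.inr (t.pos i)) O.ρ (O.δ.length + 1) ++
      [O.edgeτR w'] ++ O.edgesγ w') :
    ed.Fits Q (coneVert s.vert t.vert) (coneDeg (fun i => s.deg d i) (fun i => t.deg e i)) :=
  t.fits_edges e (u := w') (f := Sum.inr) (v := coneVert s.vert t.vert)
    (deg := coneDeg (fun i => s.deg d i) (fun i => t.deg e i)) (c := 0) (fun _ => rfl)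
    (fun _ => (add_zero _).symm) (O.edges_right (w' := w') ▸ h)

variable [DecidableEq E]

/-- The edge of the letter `σL τL⁻¹` of the cone. -/
def edgeL (u : kˣ) : Edge k E (s.Idx ⊕ t.Idx) :=
  ⟨O.letterL, u, Sum.inl (s.pos O.β.length), Sum.inr (t.pos O.δ.length)⟩

/-- The edge of the letter `σR⁻¹ τR` of the cone. -/
def edgeR (u : kˣ) : Edge k E (s.Idx ⊕ t.Idx) :=
  ⟨invRev O.letterR, u, Sum.inl (s.pos (O.β.length + 1 + O.ρ.length + 1)),
    Sum.inr (t.pos (O.δ.length + 1 + O.ρ.length + 1))⟩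

/-- The edges of the closed word of the cone. -/
def coneEdges (w w' : ℕ → kˣ) (uL uR : kˣ) : List (Edge k E (s.Idx ⊕ t.Idx)) :=
  O.edgesβ w ++ [O.edgeL uL] ++ ((O.edgesγ w' ++ O.edgesδ w').map Edge.inv).reverse ++
    [(O.edgeR uR).inv] ++ O.edgesα w

variable {uL uR : kˣ}

lemma map_letter_coneEdges : (O.coneEdges w w' uL uR).map Edge.letter = O.coneLetters := by
  have h : ∀ L : List (Edge k E (s.Idx ⊕ t.Idx)), ((L.map Edge.inv).reverse).map Edge.letter =
      invWord (L.map Edge.letter) := by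
    intro L
    rw [invWord, List.map_reverse, List.map_map, List.map_map]
    rfl
  simp only [coneEdges, List.map_append, h, edgesβ, edgesα, edgesγ, edgesδ, map_letter_wordEdges,
    coneLetters_eq, List.map_cons, List.map_nil, List.reverse_append]
  simp [edgeL, edgeR, Edge.inv, invWord]

/-- The same surgery as for the letters in `coneWord`. The edges at the cuts may be exchanged since
only their outer ends are compared with their neighbours. -/
lemma cycle_chain_coneEdges : Cycle.Chain (fun e e' : Edge k E (s.Idx ⊕ t.Idx) => e.y = e'.x)
    (O.coneEdges w w' uL uR : Cycle (Edge k E (s.Idx ⊕ t.Idx))) := by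
  have h1 := s.cycle_chain_edges (w := fun i => -w i) (f := (Sum.inl : s.Idx → s.Idx ⊕ t.Idx))
  have h2 := t.cycle_chain_edges (w := w') (f := (Sum.inr : t.Idx → s.Idx ⊕ t.Idx))
  rw [edges_left, cycle_chain_split] at h1
  rw [edges_right, cycle_chain_split] at h2
  rw [coneEdges, cycle_chain_split]
  refine ⟨isChain_replace_ends h1.1 (fun _ h => h) fun _ h => h, ?_⟩
  have h3 : List.IsChain (fun e e' : Edge k E (s.Idx ⊕ t.Idx) => e.y = e'.x)
      ((O.edgeτL w').inv :: (((O.edgesγ w' ++ O.edgesδ w').map Edge.inv).reverse ++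
        [(O.edgeτR w').inv])) := by
    have e : (O.edgeτL w').inv :: (((O.edgesγ w' ++ O.edgesδ w').map Edge.inv).reverse ++
        [(O.edgeτR w').inv]) = ((O.edgeτR w' ::
          (O.edgesγ w' ++ O.edgesδ w' ++ [O.edgeτL w'])).map Edge.inv).reverse := by simp
    rw [e, List.isChain_reverse, List.isChain_map]
    exact h2.1.imp fun _ _ h => h.symm
  exact isChain_replace_ends h3 (fun _ h => h) fun _ h => h

lemma map_x_coneEdges_perm : ((O.coneEdges w w' uL uR).map Edge.x).Perm
    (((List.range' 0 (O.β.length + 1) ++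
      List.range' (O.β.length + 1 + O.ρ.length + 1) O.α.length).map s.pos).map Sum.inl ++
    ((List.range' (O.δ.length + 1 + O.ρ.length + 1) (O.γ.length + 1) ++
      List.range' 1 O.δ.length).map t.pos).map Sum.inr) := by
  have h : ∀ L : List (Edge k E (s.Idx ⊕ t.Idx)), ((L.map Edge.inv).reverse).map Edge.x =
      (L.map Edge.y).reverse := by
    intro L
    rw [List.map_reverse, List.map_map]
    rfl
  have e1 : List.range' 0 (O.β.length + 1) = List.range' 0 O.β.length ++ [O.β.length] := by
    rw [List.range'_1_concat, zero_add]
  rw [coneEdges, List.map_append, List.map_append, List.map_append, List.map_append, h]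
  simp only [List.map_append, edgesβ, edgesα, edgesγ, edgesδ, map_x_wordEdges,
    map_y_wordEdges, List.map_cons, List.map_nil, e1, List.range'_succ, List.map_map]
  simp only [edgeL, edgeR, Edge.inv, Function.comp_def]
  -- The order in which the vertices are visited is irrelevant, so both sides are compared as sums
  -- of multisets.
  rw [← Multiset.coe_eq_coe]
  simp only [← Multiset.coe_add, Multiset.coe_reverse, zero_add, ← Multiset.cons_coe]
  simp only [← Multiset.singleton_add, Multiset.coe_nil, add_zero]
  abel

lemma nodup_coneEdges : ((O.coneEdges w w' uL uR).map Edge.x).Nodup := by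
  rw [O.map_x_coneEdges_perm.nodup_iff, List.nodup_append]
  refine ⟨(s.outer_left O.word_left).1.map Sum.inl_injective,
    (t.outer_right O.word_right).1.map Sum.inr_injective, ?_⟩
  rintro x hx y hy rfl
  obtain ⟨p, -, rfl⟩ := List.mem_map.1 hx
  obtain ⟨q, -, h⟩ := List.mem_map.1 hy
  cases h

/-- The cycle passes through all summands that are not cancelled; this matches it with the retract
in `contractionEquiv`. -/
lemma mem_coneEdges (p : s.Idx ⊕ t.Idx) : p ∈ (O.coneEdges w w' uL uR).map Edge.x ↔
    (∀ i ≤ O.ρ.length, p ≠ O.posL i) ∧ ∀ i ≤ O.ρ.length, p ≠ O.posR i := by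
  rw [O.map_x_coneEdges_perm.mem_iff, List.mem_append]
  rcases p with p | p
  · rw [List.mem_map_of_injective Sum.inl_injective, (s.outer_left O.word_left).2 p]
    simp [posL, posR]
  · rw [List.mem_map_of_injective Sum.inr_injective, (t.outer_right O.word_right).2 p]
    simp [posL, posR]

/-- The first edge starts at vertex 0 of the first word even if $\beta$ is empty, since then
$\sigma_L$ is the first letter. This fixes the grading of the cone word. -/
lemma head_coneEdges (d e : ℤ) : ∀ ed ∈ (O.coneEdges w w' uL uR).head?,
    coneDeg (fun i : s.Idx => s.deg d i) (fun i : t.Idx => t.deg e i) ed.x = d - 1 := by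
  have key : coneDeg (fun i : s.Idx => s.deg d i) (fun i : t.Idx => t.deg e i)
      (Sum.inl (s.pos 0)) = d - 1 := by
    rw [coneDeg, Sum.elim_inl, s.deg_pos d (Nat.zero_le _)]
    simp [ClosedWord.deg]
  intro ed hed
  rcases hβ : O.β with _ | ⟨l, L⟩
  · simp only [coneEdges, edgesβ, hβ, wordEdges, List.nil_append, List.append_assoc,
      List.cons_append, List.head?_cons, Option.mem_def, Option.some.injEq] at hed
    rw [← hed, edgeL, hβ]
    exact key
  · simp only [coneEdges, edgesβ, hβ, wordEdges, List.append_assoc,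
      List.cons_append, List.head?_cons, Option.mem_def, Option.some.injEq] at hed
    rw [← hed]
    exact key

lemma fits_coneEdges (hQ : Q.IsGentle) (hO : O.Compatible) {d e : ℤ}
    (h : s.deg d (O.β.length + 1) = t.deg e (O.δ.length + 1)) {ed : Edge k E (s.Idx ⊕ t.Idx)}
    (hed : ed ∈ O.coneEdges w w' uL uR) :
    ed.Fits Q (coneVert s.vert t.vert) (coneDeg (fun i => s.deg d i) (fun i => t.deg e i)) := by
  have hdeg : ∀ i ≤ O.ρ.length,
      coneDeg (fun i : s.Idx => s.deg d i) (fun i : t.Idx => t.deg e i) (O.posR i) =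
        coneDeg (fun i : s.Idx => s.deg d i) (fun i : t.Idx => t.deg e i) (O.posL i) + 1 :=
    fun i hi => (O.deg_pos_eq h hi).trans (sub_add_cancel _ _).symm
  simp only [coneEdges, List.mem_append, List.mem_singleton, List.mem_reverse, List.mem_map] at hed
  rcases hed with (((hed | rfl) | ⟨ed, hed, rfl⟩) | rfl) | hed
  · exact O.fits_left (w := w) d e (by simp [hed])
  · exact (O.mergedLetter_left hQ hO).fits (wa := -w O.β.length)
      (O.fits_left (w := w) d e (ed := O.edgeσL w) (by simp))
      (O.fits_right (w' := w') d e (ed := O.edgeτL w') (by simp)) (hdeg 0 (Nat.zero_le _))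
  · exact (O.fits_right (w' := w') d e (by rcases hed with hed | hed <;> simp [hed])).inv
  · exact ((O.mergedLetter_right hQ hO).fits
      (O.fits_left (w := w) d e (ed := O.edgeσR w) (by simp)).inv
      (O.fits_right (w' := w') d e (ed := O.edgeτR w') (by simp)).inv (hdeg _ le_rfl)).inv
  · exact O.fits_left (w := w) d e (by simp [hed])

end Overlap

end ConeEdges

end

end Gentle

namespace Gentle

noncomputable section

/-! ### Cancelling the overlap in the cone, and the resulting scalar -/

section ConeElimination

open BoundQuiver
open FreeGroup (invRev)

variable {k : Type u} [Field k] {V : Type v} {E : Type w} {Q : BoundQuiver V E}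

/-- In `h1` and `h2`, `x` and `y` are the holonomies of the two words, with parts `p` and `p'` along
the overlap; `h3` is the telescoped relation of the squares. The signs of the two merged letters
cancel. What remains is the sign of the `r` letters which $\sigma$ loses. -/
lemma cone_holonomy {b sL p sR a d tL p' tR g c c' x y : kˣ} {r : ℕ}
    (h1 : b * sL * ((-1) ^ r * p) * sR * a = x) (h2 : d * tL * p' * tR * g = y)
    (h3 : c * p' = c' * p) :
    b * -(c * sL * tL⁻¹) * (g * d)⁻¹ * -(c'⁻¹ * sR * tR⁻¹) * a = (-1) ^ r * (x * y⁻¹) := by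
  obtain rfl : c = c' * p * p'⁻¹ := eq_mul_inv_of_mul_eq h3
  subst h1 h2
  apply Units.ext
  push_cast
  field_simp
  rw [← pow_mul, mul_comm r, pow_mul, neg_one_sq, one_pow]

namespace Overlap

variable [Fintype V] {s t : ClosedWord Q} (O : Overlap s t) {w w' : ℕ → kˣ}
  {c : ℕ → kˣ} {aL aR : kˣ}

omit [Fintype V] in
lemma letterBorder_left (hρ : O.ρ = []) : Q.LetterBorder O.σL O.σR := by
  simpa [hρ] using O.chain_left.2

omit [Fintype V] in
lemma letterBorder_right (hρ : O.ρ = []) : Q.LetterBorder O.τL O.τR := by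
  simpa [hρ] using O.chain_right.2

variable (d e : ℤ)

/-- The two composites through an overlap from one end to the other vanish. -/
lemma mat_mul_contraction_mul_mat_cross (hQ : Q.IsGentle) (hO : O.Compatible) :
    (O.edgeτL w').mat Q *
        contraction Q (coneVert s.vert t.vert) O.posL O.posR c O.ρ.length *
        (O.edgeσR w).mat Q = 0 ∧
      (O.edgeτR w').mat Q *
        contraction Q (coneVert s.vert t.vert) O.posL O.posR c O.ρ.length *
        (O.edgeσL w).mat Q = 0 := by
  have hs := s.length_split O.word_left
  have ht := t.length_split O.word_right
  have hσL : Q.IsLetter O.σL := O.isLetter_left (by simp)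
  have hσR : Q.IsLetter O.σR := O.isLetter_left (by simp)
  have hτL : Q.IsLetter O.τL := O.isLetter_right (by simp)
  have hτR : Q.IsLetter O.τR := O.isLetter_right (by simp)
  constructor
  -- The edge is reversed so that both edges end in the overlap, as `mat_mul_contraction_mul_mat`
  -- requires.
  · rw [← Edge.mat_inv (e := O.edgeσR w) hσR,
      mat_mul_contraction_mul_mat
        (deg := coneDeg (fun i : s.Idx => s.deg 0 i) (fun i : t.Idx => t.deg 0 i))
        (e := O.edgeτL w') (e' := (O.edgeσR w).inv)
        (fun i hi => O.vert_pos_eq hi) O.posL_injOn O.posR_injOn (Nat.zero_le _) le_rfl rfl rfl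
        (fun l hl => O.outer_ne_posR (n := O.δ.length) (by omega) (by omega) hl)
        (fun l hl => O.outer_ne_posL (n := O.β.length + 1 + O.ρ.length + 1) (by omega) (by omega)
          hl)
        (O.fits_right (w' := w') 0 0 (by simp))]
    split_ifs with h
    · obtain ⟨h1, h2, h3⟩ := h
      -- The contraction joins equal positions only, so a composite from position 0 to the last one
      -- forces a trivial overlap. There the two paths meet in a relation.
      have hρ : O.ρ = [] := List.length_eq_zero_iff.1 h3.symm
      have h2 : isDirect O.σR = true := by
        rw [Edge.inv, edgeσR, hσR.isDirect_invRev] at h2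
        simpa using h2
      have h4 := O.leftEnd.pathVal_mul_eq_zero (k := k) hQ O.rightEnd (O.letterBorder_left hρ)
        (O.letterBorder_right hρ) (O.isPath_left hQ hO) h1 h2 hτL hσR
      have h5 : pathOf (O.edgeσR w).inv.letter = pathOf O.σR := hσR.pathOf_invRev
      rw [h5]
      refine (congrArg _ (congrArg _ h4)).trans ?_
      simp
    · rfl
  · rw [← Edge.mat_inv (e := O.edgeτR w') hτR,
      mat_mul_contraction_mul_mat
        (deg := coneDeg (fun i : s.Idx => s.deg 0 i) (fun i : t.Idx => t.deg 0 i))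
        (e := (O.edgeτR w').inv) (e' := O.edgeσL w)
        (fun i hi => O.vert_pos_eq hi) O.posL_injOn O.posR_injOn le_rfl (Nat.zero_le _) rfl rfl
        (fun l hl => O.outer_ne_posR (n := O.δ.length + 1 + O.ρ.length + 1) (by omega) (by omega)
          hl)
        (fun l hl => O.outer_ne_posL (n := O.β.length) (by omega) (by omega) hl)
        (O.fits_right (w' := w') (ed := O.edgeτR w') 0 0 (by simp)).inv]
    split_ifs with h
    · obtain ⟨h1, h2, h3⟩ := h
      have hρ : O.ρ = [] := List.length_eq_zero_iff.1 h3
      have h2 : isDirect (invRev O.σL) = true := by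
        rw [hσL.isDirect_invRev]
        simpa [edgeσL] using h2
      have h4 := O.rightEnd.inv.pathVal_mul_eq_zero (k := k) hQ O.leftEnd.inv
        (O.letterBorder_left hρ).inv (O.letterBorder_right hρ).inv (fun hf => by
          rw [hσR.pathOf_invRev, hτR.pathOf_invRev]
          exact O.isPath_right hQ hO hf) h1 h2 hτR.inv hσL.inv
      rw [hσL.pathOf_invRev] at h4
      refine (congrArg _ (congrArg _ h4)).trans ?_
      simp
    · rfl

variable [DecidableEq E]

lemma sum_mat_coneEdges {uL uR : kˣ} (hR : Q.IsLetter O.letterR) :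
    ((O.coneEdges w w' uL uR).map (Edge.mat Q)).sum =
      ((O.edgesβ w).map (Edge.mat Q)).sum + ((O.edgesα w).map (Edge.mat Q)).sum +
      ((O.edgeL uL).mat Q + (O.edgeR uR).mat Q) +
      (((O.edgesδ w').map (Edge.mat Q)).sum + ((O.edgesγ w').map (Edge.mat Q)).sum) := by
  have h : ∀ ed ∈ O.edgesγ w' ++ O.edgesδ w', Q.IsLetter ed.letter := by
    intro ed hed
    refine (O.fits_right (w' := w') 0 0 (ed := ed) ?_).isLetter
    rcases List.mem_append.1 hed with hed | hed <;> simp [hed]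
  rw [coneEdges, List.map_append, List.map_append, List.map_append, List.map_append,
    List.sum_append, List.sum_append, List.sum_append, List.sum_append, sum_mat_inv_reverse h,
    List.map_append, List.sum_append, List.map_singleton, List.map_singleton, List.sum_singleton,
    List.sum_singleton, Edge.mat_inv hR.inv]
  abel

/-- The holonomies of the two letters at the ends, and the contraction of the cone along the
overlap. -/
lemma exists_contraction_eq (hQ : Q.IsGentle) (hO : O.Compatible) {lam mu : kˣ} {js jt : ℕ}
    (hsq : SquaresCommute O lam js mu jt c aL aR)
    (hw : w = weight lam js) (hw' : w' = weight mu jt) :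
    ∃ uL uR : kˣ,
      (O.edgeL uL).hol = -(c 0 * (O.edgeσL w).hol * (O.edgeτL w').hol⁻¹) ∧
      (O.edgeR uR).inv.hol = -((c O.ρ.length)⁻¹ * (O.edgeσR w).hol * (O.edgeτR w').hol⁻¹) ∧
      ∀ x y, x ∈ (O.coneEdges w w' uL uR).map Edge.x → y ∈ (O.coneEdges w w' uL uR).map Edge.x →
        (O.coneDiff w w' c aL aR - O.coneDiff w w' c aL aR *
          contraction Q (coneVert s.vert t.vert) O.posL O.posR c O.ρ.length *
          O.coneDiff w w' c aL aR) x y =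
        ((O.coneEdges w w' uL uR).map (Edge.mat Q)).sum x y := by
  subst hw hw'
  have hs := s.length_split O.word_left
  have ht := t.length_split O.word_right
  have hσR : Q.IsLetter O.σR := O.isLetter_left (by simp)
  have hτR : Q.IsLetter O.τR := O.isLetter_right (by simp)
  have hR := O.isLetter_letterR hQ hO
  obtain ⟨uL, hL1, hL2⟩ := O.leftEnd.exists_mat_eq (pu := O.posL) (pw := O.posR) (c := c)
    (v := coneVert s.vert t.vert)
    (deg := coneDeg (fun i : s.Idx => s.deg 0 i) (fun i : t.Idx => t.deg 0 i))
    (x := Sum.inl (s.pos O.β.length)) (y := Sum.inr (t.pos O.δ.length))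
    (fun i hi => O.vert_pos_eq hi) O.posL_injOn O.posR_injOn (Nat.zero_le _)
    (fun l hl => O.outer_ne_posL (by omega) (by omega) hl)
    (fun l hl => O.outer_ne_posR (by omega) (by omega) hl)
    (O.fits_right (w' := weight mu jt) 0 0 (ed := O.edgeτL (weight mu jt)) (by simp)) hsq.left
  -- The right end is treated as the left end of the inverted words. Its edge therefore runs from
  -- the first word to the second and appears inverted in the cycle.
  obtain ⟨uR, hR1, hR2⟩ := O.rightEnd.inv.exists_mat_eq (pu := O.posL) (pw := O.posR) (c := c)
    (v := coneVert s.vert t.vert)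
    (deg := coneDeg (fun i : s.Idx => s.deg 0 i) (fun i : t.Idx => t.deg 0 i))
    (x := Sum.inl (s.pos (O.β.length + 1 + O.ρ.length + 1)))
    (y := Sum.inr (t.pos (O.δ.length + 1 + O.ρ.length + 1)))
    (wa := weight lam js (O.β.length + 1 + O.ρ.length))
    (wb := weight mu jt (O.δ.length + 1 + O.ρ.length)) (aL := aR)
    (fun i hi => O.vert_pos_eq hi) O.posL_injOn O.posR_injOn le_rfl
    (fun l hl => O.outer_ne_posL (by omega) (by omega) hl)
    (fun l hl => O.outer_ne_posR (by omega) (by omega) hl)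
    (O.fits_right (w' := weight mu jt) 0 0 (ed := O.edgeτR (weight mu jt)) (by simp)).inv
    (fun hf => by
      have h := hsq.right hf
      rw [hσR.isDirect_invRev]
      cases hd : isDirect O.σR <;> simpa [hd] using h)
  rw [← invRev_letterR] at hR1 hR2
  refine ⟨uL, uR, ?_, ?_, fun x y hx hy => ?_⟩
  · refine hL1.trans ?_
    -- The edge in the cone carries `-w`, while `exists_mat_eq` computes the holonomy with `w`; this
    -- is the origin of the minus sign.
    rw [edgeσL, Edge.hol_neg]
    simp [edgeτL]
  · have h1 : (⟨invRev O.σR, weight lam js (O.β.length + 1 + O.ρ.length),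
        Sum.inl (s.pos (O.β.length + 1 + O.ρ.length + 1)), O.posL O.ρ.length⟩ :
          Edge k E (s.Idx ⊕ t.Idx)).hol = -(O.edgeσR (weight lam js)).hol⁻¹ := by
      rw [edgeσR, Edge.hol_neg, inv_neg, neg_neg, ← Edge.hol_inv (Q := Q) hσR]
      rfl
    have h2 : (⟨invRev O.τR, weight mu jt (O.δ.length + 1 + O.ρ.length),
        Sum.inr (t.pos (O.δ.length + 1 + O.ρ.length + 1)), O.posR O.ρ.length⟩ :
          Edge k E (s.Idx ⊕ t.Idx)).hol = (O.edgeτR (weight mu jt)).hol⁻¹ := by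
      rw [← Edge.hol_inv (Q := Q) hτR]
      rfl
    rw [h1, h2] at hR1
    have h3 : (O.edgeR uR).hol = _ := hR1
    rw [Edge.hol_inv (Q := Q) hR.inv, h3]
    simp [inv_neg, mul_comm]
  · obtain ⟨hx, hx'⟩ := (O.mem_coneEdges x).1 hx
    obtain ⟨hy, hy'⟩ := (O.mem_coneEdges y).1 hy
    obtain ⟨h1, h2⟩ := O.mat_mul_contraction_mul_mat_cross (w := weight lam js)
      (w' := weight mu jt) (c := c) hQ hO
    rw [Matrix.sub_apply, mul_contraction_mul_congr (pu := O.posL) (pw := O.posR)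
      (fun i hi => O.coneDiff_posR hx hx' hi) (fun i hi => O.coneDiff_posL hy hy' hi),
      O.coneDiff_outer hx hx' hy hy', O.sum_mat_coneEdges hR, ← Matrix.sub_apply]
    refine congrFun (congrFun ?_ x) y
    have h3 : (O.edgeL uL).mat Q = _ := hL2.symm
    have h4 : (O.edgeR uR).mat Q = _ := hR2.symm
    have h5 : (O.edgeτR (weight mu jt)).inv.mat Q = (O.edgeτR (weight mu jt)).mat Q :=
      Edge.mat_inv hτR
    have h6 : (O.edgeσR (weight lam js)).inv.mat Q = (O.edgeσR (weight lam js)).mat Q :=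
      Edge.mat_inv hσR
    have h7 : (O.edgeR uR).mat Q = Matrix.single (Sum.inl (s.pos (O.β.length + 1 + O.ρ.length + 1)))
        (Sum.inr (t.pos (O.δ.length + 1 + O.ρ.length + 1))) ((aR : k) • endVal k O.fR) -
        (O.edgeτR (weight mu jt)).mat Q *
          contraction Q (coneVert s.vert t.vert) O.posL O.posR c O.ρ.length *
          (O.edgeσR (weight lam js)).mat Q := by
      rw [← h5, ← h6]
      exact h4
    rw [h7, h3]
    -- Four composites arise: the two across the overlap vanish by `h1` and `h2`, the other two are
    -- the corrections contained in `h3` and `h7`.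
    simp only [Matrix.add_mul, Matrix.mul_add]
    rw [h1, h2]
    simp only [edgeτL, edgeσL]
    abel

-- Determines the parameter of the band complex of $c$: each of the three relations between
-- holonomies, for $\sigma$, for $\tau$ and along $\rho$, is one hypothesis of `cone_holonomy`.
omit [Fintype V] in
lemma prod_hol_coneEdges (lam mu : kˣ) (js : s.Idx) (hjs : isDirect (s.letters.get js) = true)
    (jt : t.Idx) (hjt : isDirect (t.letters.get jt) = true)
    (hsq : SquaresCommute O lam js mu jt c aL aR) (hw : w = weight lam js)
    (hw' : w' = weight mu jt) {uL uR : kˣ}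
    (hL : (O.edgeL uL).hol = -(c 0 * (O.edgeσL w).hol * (O.edgeτL w').hol⁻¹))
    (hR : (O.edgeR uR).inv.hol =
      -((c O.ρ.length)⁻¹ * (O.edgeσR w).hol * (O.edgeτR w').hol⁻¹)) :
    ((O.coneEdges w w' uL uR).map Edge.hol).prod = (-1) ^ O.ρ.length * (lam * mu⁻¹) := by
  subst hw hw'
  have h : ∀ ed ∈ O.edgesγ (weight mu jt) ++ O.edgesδ (weight mu jt), Q.IsLetter ed.letter := by
    intro ed hed
    refine (O.fits_right (w' := weight mu jt) 0 0 (ed := ed) ?_).isLetter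
    rcases List.mem_append.1 hed with hed | hed <;> simp [hed]
  have h1 : ((s.edges (fun i => -weight lam js i) (Sum.inl (β := t.Idx))).map Edge.hol).prod =
      lam := by
    -- The signs on the letters of $\sigma$ cancel in total, because their number is even.
    rw [ClosedWord.edges, prod_hol_wordEdges_neg, s.even_length.neg_one_pow, one_mul]
    exact s.prod_hol_edges lam js hjs _
  have h2 := t.prod_hol_edges mu jt hjt (Sum.inr (α := s.Idx))
  have h3 := prod_hol_wordEdges_of_squares (u := weight lam js) (u' := weight mu jt)
    (pos := fun i => (Sum.inl (s.pos i) : s.Idx ⊕ t.Idx))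
    (pos' := fun i => (Sum.inr (t.pos i) : s.Idx ⊕ t.Idx)) O.ρ (O.β.length + 1)
    (O.δ.length + 1) c hsq.inner
  have h4 := prod_hol_wordEdges_neg (u := weight lam js)
    (pos := fun i => (Sum.inl (s.pos i) : s.Idx ⊕ t.Idx)) O.ρ (O.β.length + 1)
  rw [O.edges_left] at h1
  rw [O.edges_right] at h2
  rw [coneEdges]
  simp only [List.map_append, List.prod_append, List.map_cons, List.map_nil, List.prod_cons,
    List.prod_nil, mul_one] at h1 h2 ⊢
  rw [← List.map_append (f := Edge.inv), prod_hol_inv_reverse h, hL, hR,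
    List.map_append, List.prod_append]
  rw [h4] at h1
  exact cone_holonomy h1 h2 h3

end Overlap

end ConeElimination

end

end Gentle

namespace Gentle

noncomputable section

/-! ### Assembly -/

section MainTheorem

open BoundQuiver

variable {k : Type u} [Field k] {V : Type v} {E : Type w} {Q : BoundQuiver V E} [Fintype V]

namespace ClosedWord

variable (s : ClosedWord Q) (d : ℤ) (lam : kˣ) (j : ℕ)

lemma isGraded_diffMatrix : IsGraded s.vert (fun i => s.deg d i) s.vert (fun i => s.deg d i) 1
    (Matrix.of (diffMatrix k s lam j)) := by
  rw [diffMatrix_eq]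
  refine IsGraded.listSum fun F hF => ?_
  obtain ⟨e, he, rfl⟩ := List.mem_map.1 hF
  exact (s.fits_edges d (c := 0) (fun _ => rfl) (fun _ => (add_zero _).symm) he).isGraded_mat

/-- `diffMatrix_sq` has an idempotent between the two factors; a graded entry absorbs it. -/
lemma diffMatrix_mul_self :
    Matrix.of (diffMatrix k s lam j) * Matrix.of (diffMatrix k s lam j) = 0 := by
  ext p r
  rw [Matrix.mul_apply]
  refine Finset.sum_eq_zero fun q _ => ?_
  rw [← (s.isGraded_diffMatrix 0 lam j).right p q]
  exact diffMatrix_sq k s lam j p q r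

end ClosedWord

/-- The mapping cone of a graph map between band complexes. -/
theorem nonempty_mappingCone_iso [DecidableEq E] {s t : ClosedWord Q} (O : Overlap s t)
    (hQ : Q.IsGentle) (hO : O.Compatible) {lam mu : kˣ} {d e : ℤ} {js : s.Idx} {jt : t.Idx}
    (hjs : isDirect (s.letters.get js) = true) (hjt : isDirect (t.letters.get jt) = true)
    (f : bandComplex k s d lam js ⟶ bandComplex k t e mu jt)
    (hf : IsGraphMap O d lam js e mu jt f) (jc : (O.coneWord hQ hO).Idx)
    (hjc : isDirect ((O.coneWord hQ hO).letters.get jc) = true) :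
    Nonempty
      ((HomotopyCategory.quotient (ModuleCat.{max u v w} (BQAlg k Q))
          (ComplexShape.up ℤ)).obj (CochainComplex.mappingCone f) ≅
        (HomotopyCategory.quotient (ModuleCat.{max u v w} (BQAlg k Q))
          (ComplexShape.up ℤ)).obj
          (bandComplex k (O.coneWord hQ hO) (d - 1) ((-1) ^ O.ρ.length * (lam * mu⁻¹)) jc)) := by
  obtain ⟨hdeg, c, aL, aR, hsq, hcomp⟩ := hf
  have hD := s.isGraded_diffMatrix d lam js
  have hDD := s.diffMatrix_mul_self lam js
  have hD' := t.isGraded_diffMatrix e mu jt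
  have hDD' := t.diffMatrix_mul_self mu jt
  have hF := O.isGraded_mapMatrix hQ hO hdeg c aL aR
  -- The band complexes are definitionally the matrix complexes of their differentials, so $f$
  -- itself serves as `f'`.
  let f' : matComplex s.vert (fun i => s.deg d i) _ hD hDD ⟶
    matComplex t.vert (fun i => t.deg e i) _ hD' hDD' := f
  have hf' : ∀ n, f'.f n = matComplexComp hD hDD hD' hDD' (O.mapMatrix c aL aR) n n :=
    fun n => (hcomp n).trans (O.matMap_graphMatrix d e c aL aR n)
  let hcone := mappingConeIso f' hF hf'
  obtain ⟨uL, uR, hL, hR, hS⟩ := O.exists_contraction_eq hQ hO hsq rfl rfl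
  have hhol := O.prod_hol_coneEdges lam mu js hjs jt hjt hsq rfl rfl hL hR
  obtain ⟨inc, prj, hinc, hprj, h1, h2, hSD⟩ := exists_inclusion (O.coneWord hQ hO) (d - 1)
    (v := coneVert s.vert t.vert)
    (deg := coneDeg (fun i : s.Idx => s.deg d i) (fun i : t.Idx => t.deg e i))
    O.map_letter_coneEdges (fun ed hed => O.fits_coneEdges hQ hO hdeg hed)
    O.cycle_chain_coneEdges O.nodup_coneEdges (O.head_coneEdges d e) jc hjc hhol
  have hM : coneMatrix (Matrix.of (diffMatrix k s lam js)) (Matrix.of (diffMatrix k t mu jt))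
      (O.mapMatrix c aL aR) = O.coneDiff (weight lam js) (weight mu jt) c aL aR := by
    rw [s.diffMatrix_eq, t.diffMatrix_eq, O.coneMatrix_eq]
  -- Fixes the instance deciding membership, in agreement with the diagonal matrix in `h2`.
  let _ : DecidablePred fun p => p ∈
      (O.coneEdges (weight lam js) (weight mu jt) uL uR).map Edge.x :=
    fun p => @List.instDecidableMemOfLawfulBEq _ instBEqOfDecidableEq _ p _
  let hequiv := contractionEquiv (r := O.ρ.length) (c := c) (pu := O.posL) (pw := O.posR)
    (hD := isGraded_coneMatrix hD hD' hF)
    (hDD := coneMatrix_mul_self hDD hDD' (matrix_comm_of_hom f' hF hf'))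
    (hD' := (O.coneWord hQ hO).isGraded_diffMatrix (d - 1) _ jc)
    (hDD' := (O.coneWord hQ hO).diffMatrix_mul_self _ jc)
    (fun i hi => O.vert_pos_eq hi)
    (fun i hi => (O.deg_pos_eq hdeg hi).trans (sub_add_cancel _ _).symm)
    O.posL_injOn O.posR_injOn (fun i j h => by cases h)
    (fun i hi j hj => by rw [hM]; exact O.coneDiff_posL_posR hi hj)
    inc prj _ (fun p => O.mem_coneEdges p) hinc hprj h1 h2 _
    (fun x y hx hy => by rw [hM]; exact hS x y hx hy) hSD
  exact ⟨(HomotopyCategory.quotient _ _).mapIso hcone ≪≫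
    HomotopyCategory.isoOfHomotopyEquiv hequiv⟩

end MainTheorem

end

end Gentle

/-- A closed word is nonempty and balanced, hence has direct letters, so the quantifier over `jc` is
not vacuous. -/
theorem mainTheorem5 {k : Type u} [Field k] [IsAlgClosed k] {V : Type v} {E : Type w}
    [Fintype V] [Finite E] [DecidableEq E] (Q : Gentle.BoundQuiver V E) (hQ : Q.IsGentle)
    (σ τ : Gentle.HomotopyBand Q) (lam mu : kˣ) (d e : ℤ)
    (js : σ.Idx) (hjs : Gentle.isDirect (σ.letters.get js) = true)
    (jt : τ.Idx) (hjt : Gentle.isDirect (τ.letters.get jt) = true)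
    (O : Gentle.Overlap σ.toClosedWord τ.toClosedWord) (hO : O.Compatible)
    (f : Gentle.bandComplex k σ.toClosedWord d lam js ⟶
      Gentle.bandComplex k τ.toClosedWord e mu jt)
    (hf : Gentle.IsGraphMap O d lam js e mu jt f) :
    ∃ c : Gentle.ClosedWord Q, c.letters = O.coneLetters ∧
      ∀ jc : c.Idx, Gentle.isDirect (c.letters.get jc) = true →
        Nonempty
          ((HomotopyCategory.quotient (ModuleCat.{max u v w} (Gentle.BQAlg k Q))
              (ComplexShape.up ℤ)).obj (CochainComplex.mappingCone f) ≅
            (HomotopyCategory.quotient (ModuleCat.{max u v w} (Gentle.BQAlg k Q))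
              (ComplexShape.up ℤ)).obj
              (Gentle.bandComplex k c (d - 1) ((-1) ^ O.ρ.length * (lam * mu⁻¹)) jc)) :=
  ⟨O.coneWord hQ hO, rfl, fun jc hjc =>
    Gentle.nonempty_mappingCone_iso O hQ hO hjs hjt f hf jc hjc⟩
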